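/- Setting. Let $(D,\mathcal M,\mu)$ be a standard Borel probability space, $H=L^2(D,\mathcal M,\mu;\mathbb R)$, $H_+=\{x\in H: x\ge 0\}$. Let $\mathcal A:\mathcal D(\mathcal A)\subseteq H\to H$ be self-adjoint, closed, densely defined, with $\langle \mathcal Ax,x\rangle\le-\delta|x|^2$ for all $x\in\mathcal D(\mathcal A)$ and some $\delta>0$, and such that the $C_0$-semigroup $(e^{t\mathcal A})_{t\ge0}$ it generates maps $H_+$ into $H_+$. Let $(\Omega,\mathcal F,\mathbb F=(\mathcal F_t)_{t\ge0},\mathsf P)$ be a filtered probability space satisfying the usual conditions, $W$ a cylindrical $\mathbb F$-Wiener process in a real Hilbert space $K$, $\sigma:K\to H$ a Hilbert–Schmidt operator, and let $W^{\mathcal A,\sigma}_t=\int_0^te^{(t-s)\mathcal A}\sigma\,dW_s$ be the (continuous version of the) stochastic convolution. Let $G:H\to\mathbb R$ be convex with $\kappa_1|x|^2-\kappa_2\le G(x)\le c_o(1+|x|^2)$ for some $c_o,\kappa_1,\kappa_2>0$, and semiconcave: for some $c_1>0$, $lG(x)+(1-l)G(y)-G(lx+(1-l)y)\le\frac{c_1}{2}l(1-l)|x-y|^2$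 for all $x,y\in H$, $l\in[0,1]$. Let $\rho>0$, let $q\in H$ satisfy $q\ge q_o$ $\mu$-a.e. for some constant $q_o>0$, and let $\hat n\in H_+\setminus\{0\}$ satisfy $\langle q,\hat n\rangle=1$, $\hat n\in\mathcal D(\mathcal A)$ and $\mathcal A\hat n=\lambda\hat n$. Let $\Theta=\{\theta\in\Delta:\langle q,\theta\rangle=1\}$ with $\Delta=\{c\hat n: c\ge0\}$ (so $\Theta=\{\hat n\}$). An admissible control is a pair $I=(\vartheta,\nu)$ with $\vartheta$ adapted and $\Theta$-valued (so $\vartheta\equiv\hat n$) and $\nu:\Omega\times[0,\infty)\to[0,\infty)$ adapted, càdlàg and nondecreasing, $\nu_{0-}=0$, such that $\mathsf E[(\int_{[0,T]}|\vartheta_s|\,d\nu_s)^2]+\mathsf E[\int_{[0,T]}|\vartheta_s|^2\,d\nu_s]<\infty$ for all $T$. For $x\in H$ put $$X^{x,I}_t=e^{t\mathcal A}x+W^{\mathcal A,\sigma}_t+\int_{[0,t]}e^{(t-s)\mathcal A}\vartheta_s\,d\nu_s,\qquad X^{x,0}_t=e^{t\mathcal A}x+W^{\mathcal A,\sigma}_t,$$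 $$\mathcal J(x;I)=\mathsf E\Big[\int_0^\infty e^{-\rho t}G(X^{x,I}_t)\,dt+\int_{[0,\infty)}e^{-\rho t}\langle q,\vartheta_t\rangle\,d\nu_t\Big]\in(-\infty,+\infty],\qquad V(x)=\inf_I\mathcal J(x;I).$$ Theorem 4.1. $G$ and $V$ are real-valued and Fréchet differentiable on $H$; write $G_{\hat n}(x)=\langle DG(x),\hat n\rangle$ and $V_{\hat n}(x)=\langle DV(x),\hat n\rangle$. For every $x\in H$, the function $(\omega,t)\mapsto e^{-(\rho-\lambda)t}G_{\hat n}(X^{x,0}_t(\omega))$ is $\mathsf P\otimes dt$-integrable on $\Omega\times[0,\infty)$, the random variables in the supremum below are integrable, and $$V_{\hat n}(x)=\sup_{\tau}\mathsf E\Big[\int_0^{\tau}e^{-(\rho-\lambda)t}G_{\hat n}(X^{x,0}_t)\,dt-e^{-(\rho-\lambda)\tau}\Big],$$ the supremum being over all $\mathbb F$-stopping times $\tau:\Omega\to[0,\infty]$, with $e^{-(\rho-\lambda)\cdot\infty}=0$. Moreover, for every $x\in H$ there is an admissible control $I^\star$ with $\mathcal J(x;I^\star)=V(x)$, and if $G$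 is strictly convex, any two such controls are indistinguishable. -/

import Mathlib

open MeasureTheory ProbabilityTheory Filter Topology Set
open scoped NNReal ENNReal InnerProductSpace

namespace SingularControl

noncomputable section

/-! ### Semigroups, Hilbert-Schmidt operators, filtrations -/

/-- `C₀`-semigroups of bounded operators. -/
structure IsC0Semigroup {H : Type*} [NormedAddCommGroup H] [NormedSpace ℝ H]
    (S : ℝ≥0 → H →L[ℝ] H) : Prop where
  map_zero : S 0 = ContinuousLinearMap.id ℝ H
  map_add : ∀ s t, S (s + t) = (S s).comp (S t)
  tendsto_zero : ∀ x, Tendsto (fun t => S t x) (𝓝 0) (𝓝 x)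

/-- `S` is the semigroup `(e^{tA})_{t ≥ 0}`: a `C₀`-semigroup whose infinitesimal generator,
domain included, is the unbounded operator `A`. A `C₀`-semigroup is determined by its generator. -/
structure IsSemigroupGeneratedBy {H : Type*} [NormedAddCommGroup H] [NormedSpace ℝ H]
    (A : H →ₗ.[ℝ] H) (S : ℝ≥0 → H →L[ℝ] H) : Prop extends IsC0Semigroup S where
  mem_graph_iff : ∀ x y : H, (x, y) ∈ A.graph ↔
    Tendsto (fun t : ℝ≥0 => (t : ℝ)⁻¹ • (S t x - x)) (𝓝[>] 0) (𝓝 y)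

/-- Hilbert-Schmidt operators (the sum does not depend on the orthonormal basis). -/
def IsHilbertSchmidt {K H : Type*} [NormedAddCommGroup K] [InnerProductSpace ℝ K]
    [NormedAddCommGroup H] [InnerProductSpace ℝ H] (σ : K →L[ℝ] H) : Prop :=
  ∃ (w : Set K) (b : HilbertBasis w ℝ K), Summable fun i => ‖σ (b i)‖ ^ 2

/-- The usual conditions: right-continuity, and all null sets belong to the initial
σ-algebra (in particular the probability space is complete). -/
structure UsualConditions {Ω : Type*} {mΩ : MeasurableSpace Ω} (P : Measure Ω)
    (𝓕 : Filtration ℝ≥0 mΩ) : Prop where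
  rightCont : ∀ t, ⨅ s > t, 𝓕 s = 𝓕 t
  null_mem : ∀ N : Set Ω, P N = 0 → MeasurableSet[𝓕 0] N

/-- Lebesgue measure on the time interval `[0, ∞)`. -/
def timeMeasure : Measure ℝ≥0 := ((volume : Measure ℝ).restrict (Ici 0)).map Real.toNNReal

/-! ### Cylindrical noise and the stochastic convolution -/

/-- `W` is a cylindrical Wiener process in the Hilbert space `K` with respect to `𝓕`;
`W t k` plays the role of `⟨W_t, k⟩`. By linearity, `W t h` and `W s k` have covariance
`min t s * ⟨h, k⟩`. -/
structure IsCylindricalWiener {Ω K : Type*} {mΩ : MeasurableSpace Ω} [NormedAddCommGroup K]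
    [InnerProductSpace ℝ K] (P : Measure Ω) (𝓕 : Filtration ℝ≥0 mΩ)
    (W : ℝ≥0 → K → Ω → ℝ) : Prop where
  adapted : ∀ t k, Measurable[𝓕 t] (W t k)
  linear : ∀ t (a b : ℝ) (h k : K),
    W t (a • h + b • k) =ᵐ[P] fun ω => a * W t h ω + b * W t k ω
  brownian : ∀ k, ‖k‖ = 1 → IsBrownianReal (fun t => W t k) P
  indep : ∀ (s t : ℝ≥0) (k : K), s ≤ t →
    Indep (MeasurableSpace.comap (fun ω => W t k ω - W s k ω) inferInstance) (𝓕 s) P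

/-- `Y` is (a version of) the stochastic integral `∫₀ᵗ ⟨φ_s, dW_s⟩` of the continuous
deterministic integrand `φ : [0, t] → K`: the `L²(P)`-limit of the stochastic integrals of the
step functions which equal `φ (i t / n)` on the `i`-th of `n` equal subintervals. -/
def IsWienerIntegral {Ω K : Type*} {mΩ : MeasurableSpace Ω} (P : Measure Ω)
    (W : ℝ≥0 → K → Ω → ℝ) (φ : ℝ≥0 → K) (t : ℝ≥0) (Y : Ω → ℝ) : Prop :=
  MemLp Y 2 P ∧
    Tendsto (fun n : ℕ => eLpNorm (fun ω => Y ω - ∑ i ∈ Finset.range n,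
      (W (((i : ℝ≥0) + 1) * t / n) (φ ((i : ℝ≥0) * t / n)) ω
        - W ((i : ℝ≥0) * t / n) (φ ((i : ℝ≥0) * t / n)) ω)) 2 P) atTop (𝓝 0)

/-- `Z` is (the continuous version of) the stochastic convolution
`Z_t = ∫₀ᵗ e^{(t-s)A} σ dW_s`, the `H`-valued stochastic integral being characterised by
`⟨Z_t, h⟩ = ∫₀ᵗ ⟨σ* (e^{(t-s)A})* h, dW_s⟩` for every `h`. -/
structure IsStochasticConvolution {Ω K H : Type*} {mΩ : MeasurableSpace Ω}
    [NormedAddCommGroup K] [InnerProductSpace ℝ K] [CompleteSpace K]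
    [NormedAddCommGroup H] [InnerProductSpace ℝ H] [CompleteSpace H] (P : Measure Ω)
    (W : ℝ≥0 → K → Ω → ℝ) (S : ℝ≥0 → H →L[ℝ] H) (σ : K →L[ℝ] H) (Z : ℝ≥0 → Ω → H) : Prop where
  continuous : ∀ᵐ ω ∂P, Continuous fun t => Z t ω
  inner_eq : ∀ (t : ℝ≥0) (h : H), IsWienerIntegral P W
    (fun s => ContinuousLinearMap.adjoint σ (ContinuousLinearMap.adjoint (S (t - s)) h)) t
    (fun ω => ⟪Z t ω, h⟫_ℝ)

/-! ### Controls -/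

/-- The class of intensities: adapted, nonnegative, nondecreasing, càdlàg processes (left limits
exist by monotonicity), with the convention `ν_{0-} = 0`. -/
structure Intensity {Ω : Type*} {mΩ : MeasurableSpace Ω} (𝓕 : Filtration ℝ≥0 mΩ) where
  val : ℝ≥0 → Ω → ℝ≥0
  adapted : ∀ t, Measurable[𝓕 t] (val t)
  mono : ∀ ω, Monotone fun t => val t ω
  rightCont : ∀ ω t, ContinuousWithinAt (fun s => val s ω) (Ici t) t

/-- The path `t ↦ ν_t`, extended by `0` to negative times. -/
def Intensity.path {Ω : Type*} {mΩ : MeasurableSpace Ω} {𝓕 : Filtration ℝ≥0 mΩ}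
    (ν : Intensity 𝓕) (ω : Ω) : StieltjesFunction ℝ where
  toFun r := if r < 0 then 0 else (ν.val r.toNNReal ω : ℝ)
  mono' := by
    intro a b hab
    dsimp only
    split_ifs with h1 h2
    · exact le_rfl
    · exact NNReal.coe_nonneg _
    · linarith
    · exact_mod_cast ν.mono ω (Real.toNNReal_le_toNNReal hab)
  right_continuous' := by
    intro x
    by_cases hx : x < 0
    · refine ContinuousAt.continuousWithinAt ?_
      refine (continuousAt_const (y := (0 : ℝ))).congr ?_
      filter_upwards [Iio_mem_nhds hx] with r hr
      simp [mem_Iio.1 hr]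
    · have h : ContinuousWithinAt (fun r : ℝ => (ν.val r.toNNReal ω : ℝ)) (Ici x) x := by
        refine (NNReal.continuous_coe.continuousAt).comp_continuousWithinAt ?_
        refine ContinuousWithinAt.comp (t := Ici x.toNNReal) (ν.rightCont ω x.toNNReal)
          continuous_real_toNNReal.continuousWithinAt ?_
        intro r hr
        exact Real.toNNReal_le_toNNReal hr
      refine h.congr ?_ ?_
      · intro r hr
        have : ¬ r < 0 := not_lt.2 ((not_lt.1 hx).trans hr)
        simp [this]
      · simp [hx]

/-- The random measure `dν` on `[0, ∞)`, with an atom of mass `ν_0` at `0`;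
thus `dν [0, t] = ν_t`. -/
def Intensity.measure {Ω : Type*} {mΩ : MeasurableSpace Ω} {𝓕 : Filtration ℝ≥0 mΩ}
    (ν : Intensity 𝓕) (ω : Ω) : Measure ℝ≥0 :=
  (ν.path ω).measure.map Real.toNNReal

section

variable {Ω H : Type*} {mΩ : MeasurableSpace Ω} [NormedAddCommGroup H] [InnerProductSpace ℝ H]

/-- The set of normalised directions `Θ = {θ ∈ Δ : ⟨q, θ⟩ = 1}`. -/
def directions (q : H) (Δ : Set H) : Set H := {θ | θ ∈ Δ ∧ ⟪q, θ⟫_ℝ = 1}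

/-- The convex cone generated by the vector `n`. -/
def ray (n : H) : Set H := {y | ∃ c : ℝ, 0 ≤ c ∧ y = c • n}

/-- Admissible controls `I = (ϑ, ν)`, where `dI_t = ϑ_t dν_t` with directions in `Δ`. -/
structure Control (P : Measure Ω) (𝓕 : Filtration ℝ≥0 mΩ) (q : H) (Δ : Set H) where
  dir : ℝ≥0 → Ω → H
  intensity : Intensity 𝓕
  dir_mem : ∀ t ω, dir t ω ∈ directions q Δ
  dir_adapted : ∀ t, StronglyMeasurable[𝓕 t] (dir t)
  sq_integrable : ∀ T : ℝ≥0,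
    ∫⁻ ω, (∫⁻ s in Iic T, ‖dir s ω‖ₑ ∂(intensity.measure ω)) ^ 2 ∂P < ∞
  integrable_sq : ∀ T : ℝ≥0,
    ∫⁻ ω, ∫⁻ s in Iic T, ‖dir s ω‖ₑ ^ 2 ∂(intensity.measure ω) ∂P < ∞

/-! ### State processes, cost functional and value function -/

/-- The uncontrolled state `X^{x,0}_t = e^{tA} x + Z_t`, where `S t = e^{tA}` and `Z` is the
stochastic convolution. -/
def freeState (S : ℝ≥0 → H →L[ℝ] H) (Z : ℝ≥0 → Ω → H) (x : H) (t : ℝ≥0) (ω : Ω) : H :=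
  S t x + Z t ω

variable {P : Measure Ω} {𝓕 : Filtration ℝ≥0 mΩ} {q : H} {Δ : Set H}

/-- The mild solution
`X^{x,I}_t = e^{tA} x + Z_t + ∫_{[0,t]} e^{(t-s)A} dI_s`, with `dI_s = ϑ_s dν_s`. -/
def state (S : ℝ≥0 → H →L[ℝ] H) (Z : ℝ≥0 → Ω → H) (x : H) (I : Control P 𝓕 q Δ)
    (t : ℝ≥0) (ω : Ω) : H :=
  S t x + Z t ω + ∫ s in Iic t, S (t - s) (I.dir s ω) ∂(I.intensity.measure ω)

/-- The cost
`J(x; I) = E[∫₀^∞ e^{-ρt} G(X^{x,I}_t) dt + ∫_{[0,∞)} e^{-ρt} ⟨q, dI_t⟩]`, which may be `+∞`: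
the contributions of the positive and of the negative part of `G` are separate
`[0, ∞]`-valued integrals, the latter finite if `G` is bounded below and `ρ > 0`. -/
def cost (S : ℝ≥0 → H →L[ℝ] H) (Z : ℝ≥0 → Ω → H) (G : H → ℝ) (ρ : ℝ) (x : H)
    (I : Control P 𝓕 q Δ) : EReal :=
  ((∫⁻ ω, ∫⁻ t, ENNReal.ofReal (Real.exp (-ρ * t) * G (state S Z x I t ω)) ∂timeMeasure ∂P :
      ℝ≥0∞) : EReal)
    - ((∫⁻ ω, ∫⁻ t, ENNReal.ofReal (-(Real.exp (-ρ * t) * G (state S Z x I t ω)))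
      ∂timeMeasure ∂P : ℝ≥0∞) : EReal)
    + ((∫⁻ ω, ∫⁻ t, ENNReal.ofReal (Real.exp (-ρ * t) * ⟪q, I.dir t ω⟫_ℝ)
      ∂(I.intensity.measure ω) ∂P : ℝ≥0∞) : EReal)

/-- The value function `V(x) = inf_I J(x; I)`. -/
def value (P : Measure Ω) (𝓕 : Filtration ℝ≥0 mΩ) (q : H) (Δ : Set H)
    (S : ℝ≥0 → H →L[ℝ] H) (Z : ℝ≥0 → Ω → H) (G : H → ℝ) (ρ : ℝ) (x : H) : EReal :=
  ⨅ I : Control P 𝓕 q Δ, cost S Z G ρ x I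

/-- The directional derivative `⟨DF(x), n⟩`. -/
def dirDeriv [CompleteSpace H] (F : H → ℝ) (n x : H) : ℝ := ⟪gradient F x, n⟫_ℝ

/-- The discount factor `e^{-rτ}`, equal to `0` for `τ = ∞`. -/
def discount (r : ℝ) : WithTop ℝ≥0 → ℝ
  | ⊤ => 0
  | (t : ℝ≥0) => Real.exp (-r * t)

/-- The payoff `∫₀^τ e^{-rt} g(X_t) dt - e^{-rτ}` of stopping at `τ`. -/
def stoppingPayoff (r : ℝ) (g : H → ℝ) (X : ℝ≥0 → Ω → H) (τ : Ω → WithTop ℝ≥0) (ω : Ω) : ℝ :=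
  (∫ t in {t : ℝ≥0 | (t : WithTop ℝ≥0) < τ ω}, Real.exp (-r * t) * g (X t ω) ∂timeMeasure)
    - discount r (τ ω)

/-- Requirements on the running cost: convexity, two-sided quadratic growth, and
semiconcavity with a linear modulus. -/
structure IsRunningCost (G : H → ℝ) : Prop where
  convex : ConvexOn ℝ univ G
  growth : ∃ c κ₁ κ₂ : ℝ, 0 < c ∧ 0 < κ₁ ∧ 0 < κ₂ ∧
    ∀ x, κ₁ * ‖x‖ ^ 2 - κ₂ ≤ G x ∧ G x ≤ c * (1 + ‖x‖ ^ 2)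
  semiconcave : ∃ c : ℝ, 0 < c ∧ ∀ x y : H, ∀ l ∈ Icc (0 : ℝ) 1,
    l * G x + (1 - l) * G y - G (l • x + (1 - l) • y) ≤ c / 2 * l * (1 - l) * ‖x - y‖ ^ 2

end

end

end SingularControl

/-!
The only direction of action `n` is an eigenvector, so `e^{(t-s)A} n = e^{λ(t-s)} n` and a control with
intensity `ν` moves the state by `e^{λt} u_t n`, where `u_t = ∫_{[0,t]} e^{-λs} dν_s` is again an
adapted, nondecreasing, càdlàg process. The bound on `A` gives `λ < 0` and makes the semigroup
contractive. An integration by parts turns the cost of acting, `E ∫ e^{-ρt} dν_t = E ∫ e^{-(ρ-λ)t} du_t`,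
into the time integral `E ∫ (ρ - λ) e^{-(ρ-λ)t} u_t dt`. Hence (`IsReducedProblem.cost_eq`), up to the
constant `κ₂ / ρ`, the cost of the control is the integral over `Ω × [0, ∞)` of a nonnegative integrand
`runCost` which depends on `ω`, on `t` and on the number `u_t` alone, and which is jointly convex in the
initial state and in `u_t`.

*Optimal controls.* The quadratic lower bound on `G` makes the reduced cost coercive in a weighted `L²`
norm of `u`, and it is convex and lower semicontinuous. Almost minimal elements of almost minimal norm
converge in `L²`, and an almost everywhere limit of intensities is an intensity, up to the right-continuous
regularisation which the usual conditions allow; this gives a minimiser (`exists_minimizer`), unique when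
`G` is strictly convex (`minimizer_unique`).

*Differentiability.* `G` and the value function are convex, of quadratic growth and semiconcave. For the
value function this is joint convexity, comparison with the control which never acts, and use of one
optimal control from the three states `x`, `x + z`, `x - z`. Such functions are Fréchet differentiable
(`differentiable_of_convexOn_of_semiconcave`).

*The stopping problem.* Starting from `x + ε n` with the control `u` is starting from `x` with the process
`u + ε`, except for the cost of the initial jump. Adding the jump `ε` only at a stopping time `τ` to an
optimal control from `x + ε n` and comparing costs bounds the payoff of `τ` by the difference quotient of
the value function (`payoff_le_dirDeriv`). Conversely, if `u` is optimal from `x`, the control `(u - ε)⁺`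
from `x + ε n` shows, as `ε → 0`, that the derivative is at most the payoff of the first time at which
`u` acts (`dirDeriv_le_payoff`). So the supremum is the derivative, and it is attained.

The moments of the stochastic convolution which make all these integrals finite come from Itô's isometry
for step functions and the Hilbert–Schmidt norm of `σ` (`IsStochasticConvolution.integrable_freeState_sq`).
-/

namespace SingularControl

/-! ### Convex functions with a semiconcavity bound -/

/-- A continuous convex function has a subgradient at every point: separate the open strict
epigraph from the point of the graph. -/
theorem exists_subgradient {E : Type*} [NormedAddCommGroup E] [NormedSpace ℝ E] {f : E → ℝ}
    (hf : ConvexOn ℝ univ f) (hc : Continuous f) (x : E) :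
    ∃ p : E →L[ℝ] ℝ, ∀ y, f x + p (y - x) ≤ f y := by
  have hconv : Convex ℝ {z : E × ℝ | z.1 ∈ univ ∧ f z.1 < z.2} := hf.convex_strict_epigraph
  have hopen : IsOpen {z : E × ℝ | z.1 ∈ univ ∧ f z.1 < z.2} := by
    simp only [mem_univ, true_and]
    exact isOpen_lt (hc.comp continuous_fst) continuous_snd
  obtain ⟨L, hL⟩ := geometric_hahn_banach_open_point hconv hopen
    (x := (x, f x)) (by simp)
  have hsplit : ∀ w r, L (w, r) = L (w, 0) + r * L (0, 1) := fun w r => by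
    rw [← smul_eq_mul, ← map_smul, ← map_add]
    simp
  have hneg : L (0, 1) < 0 := by
    have := hL (x, f x + 1) (by simp)
    rw [hsplit, hsplit x (f x)] at this
    linarith
  have key : ∀ w, L (w, 0) + f w * L (0, 1) ≤ L (x, 0) + f x * L (0, 1) := fun w => by
    refine le_of_forall_pos_le_add fun ε hε => ?_
    have := hL (w, f w + ε / (-L (0, 1)))
      ⟨mem_univ _, lt_add_of_pos_right _ (div_pos hε (neg_pos.2 hneg))⟩
    rw [hsplit, hsplit x (f x)] at this
    have h2 : (f w + ε / (-L (0, 1))) * L (0, 1) = f w * L (0, 1) - ε := by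
      field_simp [hneg.ne]
      ring
    linarith
  refine ⟨(-(L (0, 1))⁻¹) • L.comp (ContinuousLinearMap.inl ℝ E ℝ), fun y => ?_⟩
  have hy := key y
  have hsub : L (y - x, 0) = L (y, 0) - L (x, 0) := by
    rw [← map_sub]; simp
  simp only [smul_apply, ContinuousLinearMap.comp_apply,
    ContinuousLinearMap.inl_apply, smul_eq_mul, hsub]
  have : -(L (0, 1))⁻¹ * (L (y, 0) - L (x, 0)) = (L (y, 0) - L (x, 0)) / (-L (0, 1)) := by
    rw [div_eq_mul_inv, inv_neg]; ring
  rw [this, ← le_sub_iff_add_le', div_le_iff₀ (neg_pos.2 hneg)]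
  nlinarith

/-- A convex function of at most quadratic growth is continuous. -/
theorem continuous_of_convexOn_of_le {E : Type*} [NormedAddCommGroup E] [NormedSpace ℝ E]
    {f : E → ℝ} (hf : ConvexOn ℝ univ f) {c : ℝ} (hc : ∀ x, f x ≤ c * (1 + ‖x‖ ^ 2)) :
    Continuous f := by
  rw [← continuousOn_univ]
  have htfae : (∃ x₀ ∈ univ, (𝓝 x₀).IsBoundedUnder (· ≤ ·) f) ↔ ContinuousOn f univ :=
    (hf.continuousOn_tfae isOpen_univ univ_nonempty).out 3 1
  refine htfae.1 ⟨0, mem_univ _, |c| * 2, ?_⟩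
  rw [eventually_map]
  filter_upwards [Metric.ball_mem_nhds (0 : E) one_pos] with x hx
  have hx' : ‖x‖ < 1 := by simpa using hx
  have h1 : ‖x‖ ^ 2 ≤ 1 := by nlinarith [norm_nonneg x]
  calc f x ≤ c * (1 + ‖x‖ ^ 2) := hc x
    _ ≤ |c| * (1 + ‖x‖ ^ 2) := by gcongr; exact le_abs_self c
    _ ≤ |c| * 2 := by gcongr; linarith

/-- A convex function of at most quadratic growth with second symmetric differences bounded by
`C * ‖h‖ ^ 2` is Fréchet differentiable: a subgradient bounds the increment from below, and, through
the second difference, also from above. -/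
theorem differentiable_of_convexOn_of_semiconcave {E : Type*} [NormedAddCommGroup E]
    [NormedSpace ℝ E] {f : E → ℝ} (hf : ConvexOn ℝ univ f) {c : ℝ}
    (hc : ∀ x, f x ≤ c * (1 + ‖x‖ ^ 2)) {C : ℝ}
    (hC : ∀ x h, f (x + h) + f (x - h) - 2 * f x ≤ C * ‖h‖ ^ 2) : Differentiable ℝ f := by
  intro x
  obtain ⟨p, hp⟩ := exists_subgradient hf (continuous_of_convexOn_of_le hf hc) x
  refine HasFDerivAt.differentiableAt (f' := p) ?_
  rw [hasFDerivAt_iff_isLittleO_nhds_zero]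
  have hO : (fun h : E => f (x + h) - f x - p h) =O[𝓝 0] fun h : E => ‖h‖ ^ 2 := by
    refine Asymptotics.IsBigO.of_bound C (Eventually.of_forall fun h => ?_)
    have h1 := hp (x + h)
    have h2 := hp (x - h)
    have h3 := hC x h
    simp only [add_sub_cancel_left, sub_sub_cancel_left, map_neg] at h1 h2
    rw [Real.norm_eq_abs, abs_of_nonneg (by linarith), norm_pow, norm_norm]
    linarith
  refine hO.trans_isLittleO ?_
  simpa using (Asymptotics.isLittleO_norm_pow_id (E' := E) one_lt_two)

/-- A decreasing sequence of nonempty convex sets in a Euclidean space whose first member is bounded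
admits a Cauchy selection: elements of almost minimal norm, by the parallelogram law. -/
theorem exists_cauchySeq_of_antitone_convex {E : Type*} [NormedAddCommGroup E]
    [InnerProductSpace ℝ E] {C : ℕ → Set E} (hanti : Antitone C) (hconv : ∀ k, Convex ℝ (C k))
    (hne : ∀ k, (C k).Nonempty) {R : ℝ} (hR : ∀ x ∈ C 0, ‖x‖ ≤ R) :
    ∃ x : ℕ → E, (∀ k, x k ∈ C k) ∧ CauchySeq x := by
  set a : ℕ → ℝ := fun k => sInf ((fun x => ‖x‖ ^ 2) '' C k) with ha
  have hbdd : ∀ k, BddBelow ((fun x : E => ‖x‖ ^ 2) '' C k) := fun k =>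
    ⟨0, by rintro _ ⟨x, -, rfl⟩; positivity⟩
  have hle : ∀ k, ∀ x ∈ C k, a k ≤ ‖x‖ ^ 2 := fun k x hx =>
    csInf_le (hbdd k) (mem_image_of_mem _ hx)
  have hmono : Monotone a := fun k l hkl =>
    csInf_le_csInf (hbdd k) ((hne l).image _) (image_mono (hanti hkl))
  have haR : ∀ k, a k ≤ R ^ 2 := fun k => by
    obtain ⟨x, hx⟩ := hne k
    exact (hle k x hx).trans (pow_le_pow_left₀ (norm_nonneg _) (hR x (hanti k.zero_le hx)) 2)
  have hx : ∀ k : ℕ, ∃ x ∈ C k, ‖x‖ ^ 2 < a k + 1 / ((k : ℝ) + 1) := fun k => by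
    obtain ⟨_, ⟨x, hx, rfl⟩, hlt⟩ := exists_lt_of_csInf_lt ((hne k).image fun x => ‖x‖ ^ 2)
      (lt_add_of_pos_right (a k) (Nat.one_div_pos_of_nat (α := ℝ) (n := k)))
    exact ⟨x, hx, hlt⟩
  choose x hxC hxlt using hx
  refine ⟨x, hxC, ?_⟩
  have hlim : Tendsto a atTop (𝓝 (⨆ k, a k)) :=
    tendsto_atTop_ciSup hmono ⟨R ^ 2, by rintro _ ⟨k, rfl⟩; exact haR k⟩
  have hsup : ∀ k, a k ≤ ⨆ k, a k := fun k => hmono.ge_of_tendsto hlim k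
  refine cauchySeq_of_le_tendsto_0'
    (fun k => √(2 * ((⨆ k, a k) - a k) + 4 * (1 / ((k : ℝ) + 1)))) (fun k l hkl => ?_) ?_
  · rw [dist_eq_norm]
    refine Real.le_sqrt_of_sq_le ?_
    have hmid : (1 / 2 : ℝ) • (x k + x l) ∈ C k := by
      rw [smul_add]
      exact hconv k (hxC k) (hanti hkl (hxC l)) (by norm_num) (by norm_num) (by norm_num)
    have h1 := hle k _ hmid
    rw [norm_smul, mul_pow] at h1
    have h2 := parallelogram_law_with_norm ℝ (x k) (x l)
    have h3 : 1 / ((l : ℝ) + 1) ≤ 1 / ((k : ℝ) + 1) := by gcongr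
    have h4 := hxlt k
    have h5 := hxlt l
    have h6 := hsup l
    norm_num at h1
    simp only [one_div] at h3 h4 h5 ⊢
    nlinarith
  · have h0 : Tendsto (fun k : ℕ => 2 * ((⨆ k, a k) - a k) + 4 * (1 / ((k : ℝ) + 1))) atTop
        (𝓝 (2 * ((⨆ k, a k) - ⨆ k, a k) + 4 * 0)) :=
      ((tendsto_const_nhds.sub hlim).const_mul 2).add
        (tendsto_one_div_add_atTop_nhds_zero_nat.const_mul 4)
    simpa using h0.sqrt

end SingularControl

namespace SingularControl

/-! ### Dissipative semigroups -/

section Semigroup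

variable {H : Type*} [NormedAddCommGroup H]

/-- The uniform boundedness principle, applied along a sequence of times tending to `0`. -/
theorem IsC0Semigroup.exists_norm_le_near_zero [NormedSpace ℝ H] [CompleteSpace H]
    {S : ℝ≥0 → H →L[ℝ] H} (hS : IsC0Semigroup S) :
    ∃ η > 0, ∃ M, ∀ t ≤ η, ‖S t‖ ≤ M := by
  by_contra! hcon
  have hpos : ∀ k : ℕ, (0 : ℝ≥0) < 1 / ((k : ℝ≥0) + 1) := fun k => by positivity
  choose t ht hlt using fun k : ℕ => hcon (1 / ((k : ℝ≥0) + 1)) (hpos k) k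
  have ht0 : Tendsto t atTop (𝓝 0) :=
    tendsto_of_tendsto_of_tendsto_of_le_of_le tendsto_const_nhds
      (tendsto_one_div_add_atTop_nhds_zero_nat (𝕜 := ℝ≥0)) (fun _ => zero_le) ht
  obtain ⟨C, hC⟩ := banach_steinhaus (g := fun k => S (t k)) fun x => by
    obtain ⟨C, hC⟩ := (((hS.tendsto_zero x).comp ht0).norm.bddAbove_range)
    exact ⟨C, fun i => hC ⟨i, rfl⟩⟩
  obtain ⟨k, hk⟩ := exists_nat_gt C
  exact absurd (hC k) (not_le.2 (hk.trans (hlt k)))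

theorem IsC0Semigroup.exists_norm_le [NormedSpace ℝ H] [CompleteSpace H]
    {S : ℝ≥0 → H →L[ℝ] H} (hS : IsC0Semigroup S) (t : ℝ≥0) : ∃ M, ∀ s ≤ t, ‖S s‖ ≤ M := by
  obtain ⟨η, hη, M, hM⟩ := hS.exists_norm_le_near_zero
  have key : ∀ k : ℕ, ∃ M', ∀ s ≤ k * η, ‖S s‖ ≤ M' := by
    intro k
    induction k with
    | zero => exact ⟨M, fun s hs => hM s (hs.trans (by simp))⟩
    | succ k ih =>
      obtain ⟨M', hM'⟩ := ih
      refine ⟨max M (M' * M), fun s hs => ?_⟩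
      rcases le_total s η with h | h
      · exact (hM s h).trans (le_max_left _ _)
      · have hsub : s - η ≤ k * η := by
          rw [tsub_le_iff_right]
          calc s ≤ ((k + 1 : ℕ) : ℝ≥0) * η := hs
            _ = k * η + η := by push_cast; ring
        rw [← tsub_add_cancel_of_le h, hS.map_add]
        refine (ContinuousLinearMap.opNorm_comp_le _ _).trans (le_trans ?_ (le_max_right _ _))
        exact mul_le_mul (hM' _ hsub) (hM _ le_rfl) (norm_nonneg _)
          ((norm_nonneg _).trans (hM' _ hsub))
  obtain ⟨k, hk⟩ := exists_nat_ge (t / η)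
  obtain ⟨M', hM'⟩ := key k
  exact ⟨M', fun s hs => hM' s (hs.trans ((div_le_iff₀ hη).1 hk))⟩

theorem IsC0Semigroup.continuous [NormedSpace ℝ H] [CompleteSpace H]
    {S : ℝ≥0 → H →L[ℝ] H} (hS : IsC0Semigroup S) (x : H) : Continuous fun t => S t x := by
  rw [continuous_iff_continuousAt]
  intro t
  obtain ⟨M, hM⟩ := hS.exists_norm_le (t + 1)
  have hle : ∀ a b, a ≤ b → b ≤ t + 1 → ‖S a x - S b x‖ ≤ M * ‖S (b - a) x - x‖ := by
    intro a b hab hb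
    have : S b x = S a (S (b - a) x) := by
      rw [← ContinuousLinearMap.comp_apply, ← hS.map_add, add_tsub_cancel_of_le hab]
    rw [this, ← map_sub, norm_sub_rev (S (b - a) x)]
    exact (S a).le_of_opNorm_le (hM a (hab.trans hb)) _
  have hlim : Tendsto (fun s => M * ‖S (nndist s t) x - x‖) (𝓝 t) (𝓝 0) := by
    have h0 : Tendsto (fun s => nndist s t) (𝓝 t) (𝓝 0) := by
      simpa using (continuous_id.nndist (continuous_const (y := t))).tendsto t
    have := (((hS.tendsto_zero x).comp h0).sub_const x).norm.const_mul M
    simpa using! this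
  rw [ContinuousAt, tendsto_iff_norm_sub_tendsto_zero]
  refine squeeze_zero' (Eventually.of_forall fun _ => norm_nonneg _) ?_ hlim
  filter_upwards [Iic_mem_nhds (lt_add_of_pos_right t one_pos)] with s hs
  rcases le_total s t with h | h
  · convert hle s t h (by simp) using 4
    rw [nndist_comm, NNReal.nndist_eq, tsub_eq_zero_of_le h, max_eq_left zero_le]
  · rw [norm_sub_rev]
    convert hle t s h hs using 4
    rw [NNReal.nndist_eq, tsub_eq_zero_of_le h, max_eq_left zero_le]

theorem IsSemigroupGeneratedBy.apply_mem_graph [NormedSpace ℝ H]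
    {A : H →ₗ.[ℝ] H} {S : ℝ≥0 → H →L[ℝ] H} (hS : IsSemigroupGeneratedBy A S) {x y : H}
    (h : (x, y) ∈ A.graph) (t : ℝ≥0) : (S t x, S t y) ∈ A.graph := by
  rw [hS.mem_graph_iff] at h ⊢
  refine (((S t).continuous.tendsto y).comp h).congr fun s => ?_
  simp only [Function.comp_apply, map_smul, map_sub]
  rw [← ContinuousLinearMap.comp_apply, ← hS.map_add, add_comm, hS.map_add,
    ContinuousLinearMap.comp_apply]

theorem IsSemigroupGeneratedBy.hasDerivWithinAt [NormedSpace ℝ H]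
    {A : H →ₗ.[ℝ] H} {S : ℝ≥0 → H →L[ℝ] H} (hS : IsSemigroupGeneratedBy A S) {x y : H}
    (h : (x, y) ∈ A.graph) {t : ℝ} (ht : 0 ≤ t) :
    HasDerivWithinAt (fun r : ℝ => S r.toNNReal x) (S t.toNNReal y) (Ici t) t := by
  rw [← hasDerivWithinAt_Ioi_iff_Ici, hasDerivWithinAt_iff_tendsto_slope' (by simp)]
  have h1 := (hS.mem_graph_iff _ _).1 (hS.apply_mem_graph h t.toNNReal)
  have h2 : Tendsto (fun r : ℝ => (r - t).toNNReal) (𝓝[>] t) (𝓝[>] 0) := by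
    refine tendsto_nhdsWithin_iff.2 ⟨?_, ?_⟩
    · have : ContinuousAt (fun r : ℝ => (r - t).toNNReal) t := by fun_prop
      simpa [ContinuousAt] using this.tendsto.mono_left (nhdsWithin_le_nhds (s := Ioi t))
    · filter_upwards [self_mem_nhdsWithin] with r hr
      simpa using hr
  refine (h1.comp h2).congr' ?_
  filter_upwards [self_mem_nhdsWithin] with r hr
  have hr' : 0 ≤ r - t := sub_nonneg.2 (le_of_lt hr)
  have hadd : r.toNNReal = (r - t).toNNReal + t.toNNReal := by
    rw [← Real.toNNReal_add hr' ht, sub_add_cancel]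
  simp only [Function.comp_apply, slope_def_module]
  rw [hadd, hS.map_add, Real.coe_toNNReal _ hr', ContinuousLinearMap.comp_apply]

theorem IsSemigroupGeneratedBy.continuous_toNNReal [NormedSpace ℝ H] [CompleteSpace H]
    {A : H →ₗ.[ℝ] H} {S : ℝ≥0 → H →L[ℝ] H} (hS : IsSemigroupGeneratedBy A S) (x : H) :
    Continuous fun r : ℝ => S r.toNNReal x :=
  (hS.toIsC0Semigroup.continuous x).comp continuous_real_toNNReal

/-- The semigroup of a dissipative operator is contractive: on the domain, `‖S t x‖ ^ 2` has
nonpositive right derivative. -/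
theorem IsSemigroupGeneratedBy.norm_apply_le [InnerProductSpace ℝ H] [CompleteSpace H]
    {A : H →ₗ.[ℝ] H} {S : ℝ≥0 → H →L[ℝ] H} (hS : IsSemigroupGeneratedBy A S)
    (hdense : Dense (A.domain : Set H))
    (hA : ∀ x : A.domain, ⟪A x, (x : H)⟫_ℝ ≤ 0) (t : ℝ≥0) (x : H) : ‖S t x‖ ≤ ‖x‖ := by
  have hdom : ∀ x ∈ (A.domain : Set H), ‖S t x‖ ≤ ‖x‖ := by
    intro x hx
    have hgraph : ∀ z w : H, (z, w) ∈ A.graph → ⟪z, w⟫_ℝ ≤ 0 := by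
      intro z w hzw
      obtain ⟨y, rfl, rfl⟩ := (LinearPMap.mem_graph_iff A).1 hzw
      rw [real_inner_comm]; exact hA y
    have hmem : (x, A ⟨x, hx⟩) ∈ A.graph := LinearPMap.mem_graph A ⟨x, hx⟩
    have hder : ∀ r ∈ Ico (0 : ℝ) t, HasDerivWithinAt (fun r : ℝ => ‖S r.toNNReal x‖ ^ 2)
        (2 * ⟪S r.toNNReal x, S r.toNNReal (A ⟨x, hx⟩)⟫_ℝ) (Ici r) r :=
      fun r hr => (hS.hasDerivWithinAt hmem hr.1).norm_sq
    have h := image_le_of_deriv_right_le_deriv_boundary (a := 0) (b := t)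
      (f := fun r : ℝ => ‖S r.toNNReal x‖ ^ 2) (B := fun _ => ‖x‖ ^ 2) (B' := fun _ => 0)
      ((hS.continuous_toNNReal x).norm.pow 2).continuousOn hder (by simp [hS.map_zero])
      continuousOn_const (fun _ _ => hasDerivWithinAt_const _ _ _) (fun r _ => by
        have := hgraph _ _ (hS.apply_mem_graph hmem r.toNNReal)
        linarith) (right_mem_Icc.2 t.2)
    simp only [Real.toNNReal_coe] at h
    exact le_of_sq_le_sq h (norm_nonneg _)
  have hcl : IsClosed {x : H | ‖S t x‖ ≤ ‖x‖} := isClosed_le (S t).continuous.norm continuous_norm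
  exact (hcl.closure_subset_iff.2 hdom) (hdense x)

/-- On an eigenvector of the generator the semigroup is scalar: `e^{-λr} S r n` has vanishing right
derivative. -/
theorem IsSemigroupGeneratedBy.apply_eigenvector [NormedSpace ℝ H] [CompleteSpace H]
    {A : H →ₗ.[ℝ] H} {S : ℝ≥0 → H →L[ℝ] H} (hS : IsSemigroupGeneratedBy A S) {n : H} {lam : ℝ}
    (hn : (n, lam • n) ∈ A.graph) (t : ℝ≥0) : S t n = Real.exp (lam * t) • n := by
  have hder : ∀ r ∈ Ico (0 : ℝ) t, HasDerivWithinAt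
      (fun r : ℝ => Real.exp (-lam * r) • S r.toNNReal n) 0 (Ici r) r := by
    intro r hr
    have h1 : HasDerivWithinAt (fun r : ℝ => Real.exp (-lam * r))
        (Real.exp (-lam * r) * (-lam * 1)) (Ici r) r :=
      (((hasDerivAt_id r).const_mul (-lam)).exp).hasDerivWithinAt
    have h2 := h1.smul (hS.hasDerivWithinAt hn hr.1)
    refine h2.congr_deriv ?_
    rw [map_smul, smul_smul, ← add_smul]
    rw [show Real.exp (-lam * r) * lam + Real.exp (-lam * r) * (-lam * 1) = 0 by ring, zero_smul]
  have h := constant_of_has_deriv_right_zero (a := 0) (b := t)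
    (Continuous.continuousOn (by
      exact (by fun_prop : Continuous fun r : ℝ => Real.exp (-lam * r)).smul
        (hS.continuous_toNNReal n))) hder t (right_mem_Icc.2 t.2)
  simp only [Real.toNNReal_coe, mul_zero, Real.exp_zero, Real.toNNReal_zero, hS.map_zero,
    one_smul, ContinuousLinearMap.coe_id', id_eq] at h
  nth_rewrite 2 [← h]
  rw [smul_smul, ← Real.exp_add]
  simp

end Semigroup

end SingularControl

namespace SingularControl

/-! ### Second moments of the stochastic convolution -/

section Noise

/-- An orthonormal family in a separable space is countable. -/
theorem countable_of_orthonormal {H ι : Type*} [NormedAddCommGroup H] [InnerProductSpace ℝ H]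
    [SecondCountableTopology H] {e : ι → H}
    (he : Orthonormal ℝ e) : Countable ι := by
  have hdisj : (univ : Set ι).PairwiseDisjoint fun i => Metric.ball (e i) (1 / 2) := by
    intro i _ j _ hij
    refine Metric.ball_disjoint_ball ?_
    rw [dist_eq_norm]
    have h := norm_sub_sq_real (e i) (e j)
    rw [he.1 i, he.1 j, he.2 hij] at h
    nlinarith [norm_nonneg (e i - e j)]
  have := hdisj.countable_of_isOpen (fun _ _ => Metric.isOpen_ball)
    (fun i _ => ⟨e i, Metric.mem_ball_self (by norm_num)⟩)
  exact countable_univ_iff.1 this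

variable {Ω K H : Type*} {mΩ : MeasurableSpace Ω} {P : Measure Ω} {𝓕 : Filtration ℝ≥0 mΩ}
  [NormedAddCommGroup K] [InnerProductSpace ℝ K] {W : ℝ≥0 → K → Ω → ℝ}

theorem IsCylindricalWiener.increment_zero_ae (hW : IsCylindricalWiener P 𝓕 W) (s t : ℝ≥0) :
    (fun ω => W t 0 ω - W s 0 ω) =ᵐ[P] 0 := by
  filter_upwards [hW.linear t 0 0 0 0, hW.linear s 0 0 0 0] with ω h1 h2
  simp only [smul_zero, add_zero, zero_mul] at h1 h2
  simp [h1, h2]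

theorem IsCylindricalWiener.increment_ae (hW : IsCylindricalWiener P 𝓕 W) (s t : ℝ≥0) {k : K}
    (hk : k ≠ 0) : (fun ω => W t k ω - W s k ω) =ᵐ[P]
      fun ω => ‖k‖ * (W t (‖k‖⁻¹ • k) ω - W s (‖k‖⁻¹ • k) ω) := by
  have hk' : ‖k‖ • (‖k‖⁻¹ • k) + (0 : ℝ) • (0 : K) = k := by
    rw [smul_zero, add_zero, smul_smul, mul_inv_cancel₀ (norm_ne_zero_iff.2 hk), one_smul]
  have h1 := hW.linear t ‖k‖ 0 (‖k‖⁻¹ • k) 0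
  have h2 := hW.linear s ‖k‖ 0 (‖k‖⁻¹ • k) 0
  rw [hk'] at h1 h2
  filter_upwards [h1, h2] with ω h1 h2
  rw [h1, h2]
  ring

theorem IsCylindricalWiener.hasLaw_increment (hW : IsCylindricalWiener P 𝓕 W) {s t : ℝ≥0}
    (hst : s ≤ t) {k : K} (hk : ‖k‖ = 1) :
    HasLaw (fun ω => W t k ω - W s k ω) (gaussianReal 0 (t - s)) P := by
  have h := (hW.brownian k hk).toIsPreBrownianReal.hasLaw_sub t s
  have hd : nndist t.1 s.1 = t - s := by
    change nndist t s = t - s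
    rw [NNReal.nndist_eq, tsub_eq_zero_of_le hst, max_eq_left zero_le]
  rw [hd] at h
  exact h

theorem IsCylindricalWiener.memLp_increment (hW : IsCylindricalWiener P 𝓕 W) {s t : ℝ≥0}
    (hst : s ≤ t) (k : K) : MemLp (fun ω => W t k ω - W s k ω) 2 P := by
  by_cases hk : k = 0
  · subst hk
    exact (memLp_congr_ae (hW.increment_zero_ae s t)).2 MemLp.zero
  rw [memLp_congr_ae (hW.increment_ae s t hk)]
  refine MemLp.const_mul ?_ _
  have h := hW.hasLaw_increment hst (k := ‖k‖⁻¹ • k) (norm_smul_inv_norm hk)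
  have h2 : MemLp id 2 (P.map fun ω => W t (‖k‖⁻¹ • k) ω - W s (‖k‖⁻¹ • k) ω) := by
    rw [h.map_eq]; exact memLp_id_gaussianReal 2
  exact (memLp_map_measure_iff aestronglyMeasurable_id h.aemeasurable).1 h2

theorem IsCylindricalWiener.integral_increment (hW : IsCylindricalWiener P 𝓕 W) {s t : ℝ≥0}
    (hst : s ≤ t) (k : K) : ∫ ω, (W t k ω - W s k ω) ∂P = 0 := by
  by_cases hk : k = 0
  · subst hk
    rw [integral_congr_ae (hW.increment_zero_ae s t)]
    simp
  rw [integral_congr_ae (hW.increment_ae s t hk), integral_const_mul]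
  have h := hW.hasLaw_increment hst (k := ‖k‖⁻¹ • k) (norm_smul_inv_norm hk)
  rw [h.integral_eq, integral_id_gaussianReal, mul_zero]

theorem IsCylindricalWiener.integral_increment_sq (hW : IsCylindricalWiener P 𝓕 W) {s t : ℝ≥0}
    (hst : s ≤ t) (k : K) :
    ∫ ω, (W t k ω - W s k ω) ^ 2 ∂P = (t - s : ℝ≥0) * ‖k‖ ^ 2 := by
  by_cases hk : k = 0
  · subst hk
    have : (fun ω => (W t 0 ω - W s 0 ω) ^ 2) =ᵐ[P] 0 := by
      filter_upwards [hW.increment_zero_ae s t] with ω h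
      simp [h]
    rw [integral_congr_ae this]
    simp
  have hae : (fun ω => (W t k ω - W s k ω) ^ 2) =ᵐ[P]
      fun ω => ‖k‖ ^ 2 * (W t (‖k‖⁻¹ • k) ω - W s (‖k‖⁻¹ • k) ω) ^ 2 := by
    filter_upwards [hW.increment_ae s t hk] with ω h
    rw [h, mul_pow]
  have h := hW.hasLaw_increment hst (k := ‖k‖⁻¹ • k) (norm_smul_inv_norm hk)
  rw [integral_congr_ae hae, integral_const_mul, mul_comm]
  congr 1
  have h2 := h.integral_comp (f := fun x => x ^ 2) (by fun_prop)
  have h3 : ∫ x, x ^ 2 ∂(gaussianReal 0 (t - s)) = (t - s : ℝ≥0) := by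
    have h4 := variance_fun_id_gaussianReal (μ := 0) (v := t - s)
    rw [variance_of_integral_eq_zero (by fun_prop) integral_id_gaussianReal] at h4
    exact h4
  exact h2.trans h3

/-- Itô's isometry for step functions: the increments over successive intervals are orthogonal. -/
theorem IsCylindricalWiener.integral_sum_sq [IsProbabilityMeasure P]
    (hW : IsCylindricalWiener P 𝓕 W) {τ : ℕ → ℝ≥0} (hτ : Monotone τ) (φ : ℕ → K) (n : ℕ) :
    Measurable[𝓕 (τ n)] (fun ω =>
        ∑ i ∈ Finset.range n, (W (τ (i + 1)) (φ i) ω - W (τ i) (φ i) ω)) ∧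
      MemLp (fun ω => ∑ i ∈ Finset.range n, (W (τ (i + 1)) (φ i) ω - W (τ i) (φ i) ω)) 2 P ∧
      ∫ ω, (∑ i ∈ Finset.range n, (W (τ (i + 1)) (φ i) ω - W (τ i) (φ i) ω)) ^ 2 ∂P
        = ∑ i ∈ Finset.range n, (τ (i + 1) - τ i : ℝ≥0) * ‖φ i‖ ^ 2 := by
  induction n with
  | zero => simp
  | succ n ih =>
    obtain ⟨hm, hL, hI⟩ := ih
    have hstep := hτ n.le_succ
    have hD := hW.memLp_increment hstep (φ n)
    have hsq := hW.integral_increment_sq hstep (φ n)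
    have hzero := hW.integral_increment hstep (φ n)
    set X : Ω → ℝ := fun ω => ∑ i ∈ Finset.range n, (W (τ (i + 1)) (φ i) ω - W (τ i) (φ i) ω)
      with hX
    set Y : Ω → ℝ := fun ω => W (τ (n + 1)) (φ n) ω - W (τ n) (φ n) ω with hY
    have hsum : (fun ω => ∑ i ∈ Finset.range (n + 1), (W (τ (i + 1)) (φ i) ω - W (τ i) (φ i) ω))
        = fun ω => X ω + Y ω := by
      funext ω
      rw [Finset.sum_range_succ]
    have hind : IndepFun Y X P := by
      rw [IndepFun_iff_Indep]
      exact indep_of_indep_of_le_right (hW.indep _ _ (φ n) hstep) hm.comap_le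
    have hXY : ∫ ω, Y ω * X ω ∂P = 0 := by
      have h := hind.integral_mul_eq_mul_integral hD.1 hL.1
      simp only [Pi.mul_apply] at h
      rw [h, hzero, zero_mul]
    have hXYint : Integrable (fun ω => Y ω * X ω) P :=
      hind.integrable_mul (hD.integrable one_le_two) (hL.integrable one_le_two)
    rw [hsum]
    refine ⟨?_, hL.add hD, ?_⟩
    · exact (hm.mono (𝓕.mono hstep) le_rfl).add
        ((hW.adapted _ _).sub ((hW.adapted _ _).mono (𝓕.mono hstep) le_rfl))
    · have hexp : ∀ ω, (∑ i ∈ Finset.range (n + 1),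
          (W (τ (i + 1)) (φ i) ω - W (τ i) (φ i) ω)) ^ 2
          = X ω ^ 2 + (2 * (Y ω * X ω) + Y ω ^ 2) := fun ω => by
        rw [congrFun hsum ω]; ring
      simp_rw [hexp]
      have hYint : Integrable (fun ω => 2 * (Y ω * X ω) + Y ω ^ 2) P :=
        (hXYint.const_mul 2).add hD.integrable_sq
      rw [integral_add hL.integrable_sq hYint, integral_add (hXYint.const_mul 2) hD.integrable_sq,
        integral_const_mul, hXY, hI, hsq, Finset.sum_range_succ]
      simp

theorem tendsto_integral_sq_of_tendsto_eLpNorm {Y : Ω → ℝ} {R : ℕ → Ω → ℝ} (hY : MemLp Y 2 P)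
    (hR : ∀ k, MemLp (R k) 2 P)
    (h : Tendsto (fun k => eLpNorm (fun ω => Y ω - R k ω) 2 P) atTop (𝓝 0)) :
    Tendsto (fun k => ∫ ω, R k ω ^ 2 ∂P) atTop (𝓝 (∫ ω, Y ω ^ 2 ∂P)) := by
  have hnorm : ∀ {f : Ω → ℝ} (hf : MemLp f 2 P), ∫ ω, f ω ^ 2 ∂P = ‖hf.toLp f‖ ^ 2 := by
    intro f hf
    rw [← real_inner_self_eq_norm_sq, L2.inner_def]
    refine integral_congr_ae ?_
    filter_upwards [hf.coeFn_toLp] with ω hω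
    rw [hω, real_inner_self_eq_norm_sq, Real.norm_eq_abs, sq_abs]
  have hlim : Tendsto (fun k => (hR k).toLp (R k)) atTop (𝓝 (hY.toLp Y)) := by
    rw [Lp.tendsto_Lp_iff_tendsto_eLpNorm'']
    refine h.congr fun k => ?_
    rw [eLpNorm_sub_comm]
    rfl
  rw [hnorm hY]
  simp_rw [fun k => hnorm (hR k)]
  exact hlim.norm.pow 2

variable [CompleteSpace K] [NormedAddCommGroup H] [InnerProductSpace ℝ H] [CompleteSpace H]

/-- The adjoint of `T σ`, for a contraction `T`, is Hilbert-Schmidt with norm at most that of `σ`: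
Parseval in `K` and Bessel in `H`. -/
theorem sum_norm_adjoint_sq_le {ι w : Type*} (b : HilbertBasis w ℝ K) {σ : K →L[ℝ] H}
    (hb : Summable fun i => ‖σ (b i)‖ ^ 2) {T : H →L[ℝ] H} (hT : ∀ x, ‖T x‖ ≤ ‖x‖) {e : ι → H}
    (he : Orthonormal ℝ e) (J : Finset ι) :
    ∑ j ∈ J, ‖ContinuousLinearMap.adjoint σ (ContinuousLinearMap.adjoint T (e j))‖ ^ 2
      ≤ ∑' i, ‖σ (b i)‖ ^ 2 := by
  have hpars : ∀ j ∈ J, HasSum (fun i => ⟪e j, T (σ (b i))⟫_ℝ ^ 2)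
      (‖ContinuousLinearMap.adjoint σ (ContinuousLinearMap.adjoint T (e j))‖ ^ 2) := by
    intro j _
    have h := b.hasSum_inner_mul_inner
      (ContinuousLinearMap.adjoint σ (ContinuousLinearMap.adjoint T (e j)))
      (ContinuousLinearMap.adjoint σ (ContinuousLinearMap.adjoint T (e j)))
    rw [real_inner_self_eq_norm_sq] at h
    refine (congrArg (HasSum · _) (funext fun i => ?_)).mpr h
    rw [real_inner_comm _ (b i), ← sq, ContinuousLinearMap.adjoint_inner_left,
      ContinuousLinearMap.adjoint_inner_left]
  refine hasSum_le (fun i => ?_) (hasSum_sum hpars) hb.hasSum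
  have h := he.sum_inner_products_le (T (σ (b i))) (s := J)
  simp only [Real.norm_eq_abs, sq_abs] at h
  exact h.trans (pow_le_pow_left₀ (norm_nonneg _) (hT _) 2)

/-- Itô's isometry for finitely many components: the second moments of the approximating step
integrals are bounded uniformly in the step. -/
theorem IsStochasticConvolution.sum_integral_inner_sq_le [IsProbabilityMeasure P] {ι w : Type*}
    (hW : IsCylindricalWiener P 𝓕 W) {S : ℝ≥0 → H →L[ℝ] H} (hS : ∀ t x, ‖S t x‖ ≤ ‖x‖)
    (b : HilbertBasis w ℝ K) {σ : K →L[ℝ] H} (hb : Summable fun i => ‖σ (b i)‖ ^ 2)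
    {Z : ℝ≥0 → Ω → H} (hZ : IsStochasticConvolution P W S σ Z) (t : ℝ≥0) {e : ι → H}
    (he : Orthonormal ℝ e) (J : Finset ι) :
    ∑ j ∈ J, ∫ ω, ⟪Z t ω, e j⟫_ℝ ^ 2 ∂P ≤ t * ∑' i, ‖σ (b i)‖ ^ 2 := by
  set φ : H → ℝ≥0 → K := fun h s =>
    ContinuousLinearMap.adjoint σ (ContinuousLinearMap.adjoint (S (t - s)) h) with hφ
  have hmono : ∀ k : ℕ, Monotone fun i : ℕ => (i : ℝ≥0) * t / k := fun k i j hij => by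
    dsimp only
    gcongr
  have hcast : ∀ k i : ℕ, ((i : ℝ≥0) + 1) * t / k = ((i + 1 : ℕ) : ℝ≥0) * t / k := fun k i => by
    push_cast; rfl
  have hsum := fun (j : ι) (k : ℕ) => hW.integral_sum_sq (hmono k)
    (fun i => φ (e j) ((i : ℝ≥0) * t / k)) k
  have hlim : ∀ j ∈ J, Tendsto (fun k : ℕ => ∑ i ∈ Finset.range k,
      ((((i + 1 : ℕ) : ℝ≥0) * t / k - (i : ℝ≥0) * t / k : ℝ≥0) : ℝ)
        * ‖φ (e j) ((i : ℝ≥0) * t / k)‖ ^ 2) atTop (𝓝 (∫ ω, ⟪Z t ω, e j⟫_ℝ ^ 2 ∂P)) := by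
    intro j _
    obtain ⟨h1, h2⟩ := hZ.inner_eq t (e j)
    simp only [hcast] at h2
    exact (tendsto_integral_sq_of_tendsto_eLpNorm h1 (fun k => (hsum j k).2.1) h2).congr
      fun k => (hsum j k).2.2
  refine le_of_tendsto' (tendsto_finsetSum _ hlim) fun k => ?_
  rw [Finset.sum_comm]
  have hstep : ∀ i ∈ Finset.range k, ∑ j ∈ J,
      ((((i + 1 : ℕ) : ℝ≥0) * t / k - (i : ℝ≥0) * t / k : ℝ≥0) : ℝ)
        * ‖φ (e j) ((i : ℝ≥0) * t / k)‖ ^ 2 ≤ t / k * ∑' i, ‖σ (b i)‖ ^ 2 := by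
    intro i _
    rw [← Finset.mul_sum]
    have hd : ((i + 1 : ℕ) : ℝ≥0) * t / k - (i : ℝ≥0) * t / k = t / k := by
      refine tsub_eq_of_eq_add ?_
      push_cast
      ring
    rw [hd]
    push_cast
    refine mul_le_mul_of_nonneg_left ?_ (by positivity)
    exact sum_norm_adjoint_sq_le b hb (hS _) he J
  refine (Finset.sum_le_sum hstep).trans ?_
  rw [Finset.sum_const, Finset.card_range, nsmul_eq_mul, ← mul_assoc]
  rcases Nat.eq_zero_or_pos k with rfl | hk
  · simp only [Nat.cast_zero, zero_mul]
    exact mul_nonneg t.2 (tsum_nonneg fun _ => sq_nonneg _)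
  · rw [mul_div_cancel₀ _ (by positivity)]

/-- Weak measurability suffices for strong measurability in a separable Hilbert space. -/
theorem aestronglyMeasurable_of_inner [SecondCountableTopology H] {X : Ω → H}
    (hX : ∀ h, AEStronglyMeasurable (fun ω => ⟪X ω, h⟫_ℝ) P) : AEStronglyMeasurable X P := by
  obtain ⟨w, b, -⟩ := exists_hilbertBasis ℝ H
  have : Countable w := countable_of_orthonormal b.orthonormal
  refine aestronglyMeasurable_of_tendsto_ae (atTop : Filter (Finset w))
    (f := fun J ω => ∑ i ∈ J, ⟪X ω, b i⟫_ℝ • b i) (fun J => ?_) (ae_of_all _ fun ω => ?_)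
  · exact Finset.aestronglyMeasurable_fun_sum _ fun i _ => (hX (b i)).smul_const _
  · have h := b.hasSum_repr (X ω)
    simp only [b.repr_apply_apply] at h
    simpa only [real_inner_comm] using! h

/-- The second moment of the stochastic convolution grows at most linearly. -/
theorem IsStochasticConvolution.exists_lintegral_enorm_sq_le [IsProbabilityMeasure P]
    [SecondCountableTopology H]
    (hW : IsCylindricalWiener P 𝓕 W) {S : ℝ≥0 → H →L[ℝ] H} (hS : ∀ t x, ‖S t x‖ ≤ ‖x‖)
    {σ : K →L[ℝ] H} (hσ : IsHilbertSchmidt σ) {Z : ℝ≥0 → Ω → H}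
    (hZ : IsStochasticConvolution P W S σ Z) :
    ∃ C : ℝ, 0 ≤ C ∧ ∀ t, ∫⁻ ω, ENNReal.ofReal (‖Z t ω‖ ^ 2) ∂P ≤ ENNReal.ofReal (C * t) := by
  obtain ⟨w, b, hb⟩ := hσ
  refine ⟨∑' i, ‖σ (b i)‖ ^ 2, tsum_nonneg fun _ => sq_nonneg _, fun t => ?_⟩
  obtain ⟨v, e, -⟩ := exists_hilbertBasis ℝ H
  have : Countable v := countable_of_orthonormal e.orthonormal
  have hpars : ∀ ω, ENNReal.ofReal (‖Z t ω‖ ^ 2)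
      = ∑' i, ENNReal.ofReal (⟪Z t ω, e i⟫_ℝ ^ 2) := by
    intro ω
    have h := e.hasSum_inner_mul_inner (Z t ω) (Z t ω)
    rw [real_inner_self_eq_norm_sq] at h
    have h' : HasSum (fun i => ⟪Z t ω, e i⟫_ℝ ^ 2) (‖Z t ω‖ ^ 2) := by
      refine (congrArg (HasSum · _) (funext fun i => ?_)).mpr h
      rw [real_inner_comm _ (e i), ← sq]
    rw [← h'.tsum_eq, ENNReal.ofReal_tsum_of_nonneg (fun _ => sq_nonneg _) h'.summable]
  simp_rw [hpars]
  rw [lintegral_tsum fun i =>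
    ((hZ.inner_eq t (e i)).1.1.aemeasurable.pow_const 2).ennreal_ofReal]
  rw [ENNReal.tsum_eq_iSup_sum]
  refine iSup_le fun J => ?_
  have hint : ∀ i, ∫⁻ ω, ENNReal.ofReal (⟪Z t ω, e i⟫_ℝ ^ 2) ∂P
      = ENNReal.ofReal (∫ ω, ⟪Z t ω, e i⟫_ℝ ^ 2 ∂P) := fun i =>
    (ofReal_integral_eq_lintegral_ofReal (hZ.inner_eq t (e i)).1.integrable_sq
      (ae_of_all _ fun _ => sq_nonneg _)).symm
  simp_rw [hint]
  rw [← ENNReal.ofReal_sum_of_nonneg fun i _ => integral_nonneg fun _ => sq_nonneg _, mul_comm]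
  exact ENNReal.ofReal_le_ofReal (hZ.sum_integral_inner_sq_le hW hS b hb t e.orthonormal J)

end Noise

end SingularControl

namespace SingularControl

/-! ### The time axis and joint measurability -/

instance : SFinite timeMeasure := by unfold timeMeasure; infer_instance

theorem timeMeasure_restrict_Ici (s : ℝ≥0) :
    timeMeasure.restrict (Ici s) = ((volume : Measure ℝ).restrict (Ici (s : ℝ))).map
      Real.toNNReal := by
  rw [timeMeasure, Measure.restrict_map measurable_real_toNNReal measurableSet_Ici,
    Measure.restrict_restrict (measurable_real_toNNReal measurableSet_Ici)]
  congr 2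
  ext r
  simp only [mem_inter_iff, mem_preimage, mem_Ici]
  constructor
  · rintro ⟨h1, h2⟩
    calc (s : ℝ) ≤ (r.toNNReal : ℝ) := by exact_mod_cast h1
      _ = r := Real.coe_toNNReal _ h2
  · intro h
    exact ⟨NNReal.le_toNNReal_of_coe_le h, s.2.trans h⟩

theorem timeMeasure_Ioo (s t : ℝ≥0) : timeMeasure (Ioo s t) = ENNReal.ofReal (t - s) := by
  rw [timeMeasure, Measure.map_apply measurable_real_toNNReal measurableSet_Ioo,
    Measure.restrict_apply (measurable_real_toNNReal measurableSet_Ioo)]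
  have : Real.toNNReal ⁻¹' Ioo s t ∩ Ici 0 = Ioo (s : ℝ) t := by
    ext r
    simp only [mem_inter_iff, mem_preimage, mem_Ioo, mem_Ici]
    constructor
    · rintro ⟨⟨h1, h2⟩, h3⟩
      rw [← NNReal.coe_lt_coe, Real.coe_toNNReal _ h3] at h1 h2
      exact ⟨h1, h2⟩
    · rintro ⟨h1, h2⟩
      have h3 : 0 ≤ r := s.2.trans h1.le
      rw [← NNReal.coe_lt_coe, ← NNReal.coe_lt_coe, Real.coe_toNNReal _ h3]
      exact ⟨⟨h1, h2⟩, h3⟩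
  rw [this, Real.volume_Ioo]

instance : NullSingletonClass timeMeasure where
  measure_singleton s := by
    rw [timeMeasure, Measure.map_apply measurable_real_toNNReal (measurableSet_singleton s),
      Measure.restrict_apply (measurable_real_toNNReal (measurableSet_singleton s))]
    refine measure_mono_null ?_ (Real.volume_singleton (a := (s : ℝ)))
    rintro r ⟨h1, h2⟩
    rw [mem_preimage, mem_singleton_iff] at h1
    rw [mem_singleton_iff, ← h1, Real.coe_toNNReal _ h2]

/-- A property which holds at almost every time holds at times arbitrarily close to, and later than,
any given time. -/
theorem frequently_nhdsGT_of_ae_timeMeasure {p : ℝ≥0 → Prop} (h : ∀ᵐ t ∂timeMeasure, p t)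
    (s : ℝ≥0) : ∃ᶠ t in 𝓝[>] s, p t := by
  intro hcon
  obtain ⟨u, hu, hsub⟩ := mem_nhdsGT_iff_exists_Ioo_subset.1 hcon
  have hzero : timeMeasure (Ioo s u) = 0 := measure_mono_null hsub h
  rw [timeMeasure_Ioo, ENNReal.ofReal_eq_zero] at hzero
  have : (s : ℝ) < u := hu
  linarith

/-- The tail of the exponential density. -/
theorem lintegral_timeMeasure_exp {a : ℝ} (ha : 0 < a) (s : ℝ≥0) :
    ∫⁻ t in Ici s, ENNReal.ofReal (a * Real.exp (-a * t)) ∂timeMeasure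
      = ENNReal.ofReal (Real.exp (-a * s)) := by
  rw [timeMeasure_restrict_Ici, lintegral_map (by fun_prop) measurable_real_toNNReal]
  have h1 : ∫⁻ r in Ici (s : ℝ), ENNReal.ofReal (a * Real.exp (-a * r.toNNReal))
      = ∫⁻ r in Ici (s : ℝ), ENNReal.ofReal (a * Real.exp (-a * r)) := by
    refine setLIntegral_congr_fun measurableSet_Ici fun r hr => ?_
    rw [Real.coe_toNNReal _ (s.2.trans hr)]
  rw [h1, setLIntegral_congr Ioi_ae_eq_Ici.symm]
  have hint : IntegrableOn (fun r : ℝ => a * Real.exp (-a * r)) (Ioi (s : ℝ)) :=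
    (integrableOn_exp_mul_Ioi (neg_neg_of_pos ha) _).const_mul a
  rw [← ofReal_integral_eq_lintegral_ofReal hint (ae_of_all _ fun r => by positivity),
    integral_const_mul, integral_exp_mul_Ioi (neg_neg_of_pos ha)]
  congr 1
  field_simp

theorem lintegral_exp_timeMeasure_lt_top {a : ℝ} (ha : 0 < a) :
    ∫⁻ t : ℝ≥0, ENNReal.ofReal (Real.exp (-a * t)) ∂timeMeasure < ∞ := by
  have h := lintegral_timeMeasure_exp ha 0
  rw [show Ici (0 : ℝ≥0) = univ from Ici_bot, Measure.restrict_univ] at h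
  have h2 : ∀ t : ℝ≥0, ENNReal.ofReal (Real.exp (-a * t))
      = ENNReal.ofReal a⁻¹ * ENNReal.ofReal (a * Real.exp (-a * t)) := fun t => by
    rw [← ENNReal.ofReal_mul (by positivity), inv_mul_cancel_left₀ ha.ne']
  simp_rw [h2]
  rw [lintegral_const_mul _ (by fun_prop), h]
  exact ENNReal.mul_lt_top ENNReal.ofReal_lt_top ENNReal.ofReal_lt_top

variable {Ω : Type*} {mΩ : MeasurableSpace Ω} {P : Measure Ω}

theorem integrable_exp_prod [IsProbabilityMeasure P] {a : ℝ} (ha : 0 < a) :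
    Integrable (fun p : Ω × ℝ≥0 => Real.exp (-a * p.2)) (P.prod timeMeasure) := by
  have h : Integrable (fun t : ℝ≥0 => Real.exp (-a * t)) timeMeasure := by
    refine ⟨by fun_prop, ?_⟩
    rw [hasFiniteIntegral_iff_ofReal (ae_of_all _ fun _ => (Real.exp_pos _).le)]
    exact lintegral_exp_timeMeasure_lt_top ha
  exact h.comp_snd P

/-- The total mass of the exponential density on the product space. -/
theorem integral_exp_prod [IsProbabilityMeasure P] {a : ℝ} (ha : 0 < a) :
    ∫ p : Ω × ℝ≥0, a * Real.exp (-a * p.2) ∂(P.prod timeMeasure) = 1 := by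
  rw [integral_eq_lintegral_of_nonneg_ae (ae_of_all _ fun _ => by positivity) (by fun_prop),
    lintegral_prod _ (by fun_prop)]
  have h := lintegral_timeMeasure_exp ha 0
  rw [show Ici (0 : ℝ≥0) = univ from Ici_bot, Measure.restrict_univ] at h
  simp only [h, lintegral_const, measure_univ, NNReal.coe_zero, mul_zero, Real.exp_zero,
    ENNReal.ofReal_one, mul_one, ENNReal.toReal_one]

/-- The grid points `(⌊(k + 1) t⌋ + 1) / (k + 1)` approach `t` from the right. -/
theorem tendsto_grid (t : ℝ≥0) :
    Tendsto (fun k : ℕ => ((⌊((k : ℝ≥0) + 1) * t⌋₊ : ℝ≥0) + 1) / ((k : ℝ≥0) + 1)) atTop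
      (𝓝[≥] t) := by
  refine tendsto_nhdsWithin_iff.2 ⟨?_, Eventually.of_forall fun k => ?_⟩
  · have hup : Tendsto (fun k : ℕ => t + 1 / ((k : ℝ≥0) + 1)) atTop (𝓝 t) := by
      simpa using (tendsto_one_div_add_atTop_nhds_zero_nat (𝕜 := ℝ≥0)).const_add t
    refine tendsto_of_tendsto_of_tendsto_of_le_of_le tendsto_const_nhds hup (fun k => ?_)
      fun k => ?_
    · rw [le_div_iff₀ (by positivity), mul_comm]
      exact (Nat.lt_floor_add_one _).le
    · rw [div_le_iff₀ (by positivity), add_mul t, one_div, inv_mul_cancel₀ (by positivity),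
        mul_comm t]
      gcongr
      exact Nat.floor_le zero_le
  · rw [mem_Ici, le_div_iff₀ (by positivity), mul_comm]
    exact (Nat.lt_floor_add_one _).le

/-- A process with right-continuous paths is jointly measurable. -/
theorem aestronglyMeasurable_uncurry_of_rightCont {E : Type*} [NormedAddCommGroup E]
    [SecondCountableTopology E] {X : ℝ≥0 → Ω → E}
    (hX : ∀ t, AEStronglyMeasurable (X t) P)
    (hcont : ∀ᵐ ω ∂P, ∀ t, ContinuousWithinAt (fun s => X s ω) (Ici t) t) :
    AEStronglyMeasurable (fun p : Ω × ℝ≥0 => X p.2 p.1) (P.prod timeMeasure) := by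
  borelize E
  set g : ℕ → ℕ → ℝ≥0 := fun k m => ((m : ℝ≥0) + 1) / ((k : ℝ≥0) + 1) with hg
  refine aestronglyMeasurable_of_tendsto_ae atTop
    (f := fun (k : ℕ) (p : Ω × ℝ≥0) => (hX (g k ⌊((k : ℝ≥0) + 1) * p.2⌋₊)).mk _ p.1)
    (fun k => ?_) ?_
  · have h1 : Measurable fun z : Ω × ℕ => (hX (g k z.2)).mk _ z.1 :=
      measurable_from_prod_countable_left fun m => (hX (g k m)).stronglyMeasurable_mk.measurable
    have h2 : Measurable fun p : Ω × ℝ≥0 => (p.1, ⌊((k : ℝ≥0) + 1) * p.2⌋₊) :=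
      measurable_fst.prodMk (Nat.measurable_floor.comp (measurable_snd.const_mul _))
    exact (h1.comp h2).stronglyMeasurable.aestronglyMeasurable
  · have hae : ∀ᵐ ω ∂P, (∀ k m, X (g k m) ω = (hX (g k m)).mk _ ω) ∧
        ∀ t, ContinuousWithinAt (fun s => X s ω) (Ici t) t := by
      refine Filter.Eventually.and ?_ hcont
      rw [ae_all_iff]; intro k
      rw [ae_all_iff]; intro m
      exact (hX (g k m)).ae_eq_mk
    filter_upwards [Measure.quasiMeasurePreserving_fst.ae hae] with p hp
    simp_rw [← fun k m => hp.1 k m]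
    exact (hp.2 p.2).tendsto.comp (tendsto_grid p.2)

section FreeState

variable {K H : Type*} {𝓕 : Filtration ℝ≥0 mΩ} [NormedAddCommGroup K] [InnerProductSpace ℝ K]
  [CompleteSpace K] {W : ℝ≥0 → K → Ω → ℝ} [NormedAddCommGroup H] [InnerProductSpace ℝ H]
  [CompleteSpace H] [SecondCountableTopology H]

theorem IsStochasticConvolution.aestronglyMeasurable {S : ℝ≥0 → H →L[ℝ] H} {σ : K →L[ℝ] H}
    {Z : ℝ≥0 → Ω → H} (hZ : IsStochasticConvolution P W S σ Z) (t : ℝ≥0) :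
    AEStronglyMeasurable (Z t) P :=
  aestronglyMeasurable_of_inner fun h => (hZ.inner_eq t h).1.1

theorem IsStochasticConvolution.aestronglyMeasurable_freeState {S : ℝ≥0 → H →L[ℝ] H}
    (hS : IsC0Semigroup S) {σ : K →L[ℝ] H} {Z : ℝ≥0 → Ω → H}
    (hZ : IsStochasticConvolution P W S σ Z) (x : H) :
    AEStronglyMeasurable (fun p : Ω × ℝ≥0 => freeState S Z x p.2 p.1) (P.prod timeMeasure) := by
  refine aestronglyMeasurable_uncurry_of_rightCont
    (fun t => aestronglyMeasurable_const.add (hZ.aestronglyMeasurable t)) ?_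
  filter_upwards [hZ.continuous] with ω hω t
  exact ((hS.continuous x).add hω).continuousWithinAt

/-- The discounted second moment of the uncontrolled state is integrable. -/
theorem IsStochasticConvolution.integrable_freeState_sq [IsProbabilityMeasure P]
    (hW : IsCylindricalWiener P 𝓕 W) {S : ℝ≥0 → H →L[ℝ] H}
    (hS : IsC0Semigroup S) (hS1 : ∀ t x, ‖S t x‖ ≤ ‖x‖) {σ : K →L[ℝ] H} (hσ : IsHilbertSchmidt σ)
    {Z : ℝ≥0 → Ω → H} (hZ : IsStochasticConvolution P W S σ Z) {a : ℝ} (ha : 0 < a) (x : H) :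
    Integrable (fun p : Ω × ℝ≥0 => Real.exp (-a * p.2) * ‖freeState S Z x p.2 p.1‖ ^ 2)
      (P.prod timeMeasure) := by
  obtain ⟨C, hC0, hC⟩ := hZ.exists_lintegral_enorm_sq_le hW hS1 hσ
  have hZm : AEStronglyMeasurable (fun p : Ω × ℝ≥0 => Z p.2 p.1) (P.prod timeMeasure) := by
    refine aestronglyMeasurable_uncurry_of_rightCont hZ.aestronglyMeasurable ?_
    filter_upwards [hZ.continuous] with ω hω t
    exact hω.continuousWithinAt
  have hexp : AEStronglyMeasurable (fun p : Ω × ℝ≥0 => Real.exp (-a * p.2))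
      (P.prod timeMeasure) := (integrable_exp_prod ha).1
  -- integrability for the stochastic convolution alone
  have hZint : Integrable (fun p : Ω × ℝ≥0 => Real.exp (-a * p.2) * ‖Z p.2 p.1‖ ^ 2)
      (P.prod timeMeasure) := by
    refine ⟨hexp.mul (hZm.norm.pow 2), ?_⟩
    rw [hasFiniteIntegral_iff_ofReal (ae_of_all _ fun _ => by positivity),
      lintegral_prod_symm (fun p : Ω × ℝ≥0 => ENNReal.ofReal (Real.exp (-a * p.2) * ‖Z p.2 p.1‖ ^ 2))
        (hexp.mul (hZm.norm.pow 2)).aemeasurable.ennreal_ofReal]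
    refine lt_of_le_of_lt (b := ∫⁻ t : ℝ≥0, ENNReal.ofReal (C * (2 / a))
      * ENNReal.ofReal (Real.exp (-(a / 2) * t)) ∂timeMeasure) (lintegral_mono fun t => ?_) ?_
    · simp only
      simp_rw [ENNReal.ofReal_mul (Real.exp_pos (-a * (t : ℝ))).le]
      have hm : AEMeasurable (fun ω => ENNReal.ofReal (‖Z t ω‖ ^ 2)) P :=
        ((hZ.aestronglyMeasurable t).norm.pow 2).aemeasurable.ennreal_ofReal
      -- half of the exponential rate absorbs the linear growth of the second moment
      rw [lintegral_const_mul'' _ hm]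
      refine (mul_le_mul_right (hC t) _).trans ?_
      rw [← ENNReal.ofReal_mul (Real.exp_pos _).le, ← ENNReal.ofReal_mul (by positivity)]
      refine ENNReal.ofReal_le_ofReal ?_
      have h1 : a / 2 * t ≤ Real.exp (a / 2 * t) := by
        linarith [Real.add_one_le_exp (a / 2 * (t : ℝ))]
      have h2 : Real.exp (-a * t) = Real.exp (-(a / 2) * t) * Real.exp (-(a / 2 * t)) := by
        rw [← Real.exp_add]; ring_nf
      have h3 : Real.exp (-(a / 2 * t)) * (a / 2 * t) ≤ 1 := by
        rw [Real.exp_neg, inv_mul_le_iff₀ (Real.exp_pos _), mul_one]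
        exact h1
      calc Real.exp (-a * t) * (C * t)
          = C * (2 / a) * Real.exp (-(a / 2) * t) * (Real.exp (-(a / 2 * t)) * (a / 2 * t)) := by
            rw [h2]; field_simp
        _ ≤ C * (2 / a) * Real.exp (-(a / 2) * t) * 1 := by gcongr
        _ = _ := mul_one _
    · rw [lintegral_const_mul _ (by fun_prop)]
      exact ENNReal.mul_lt_top ENNReal.ofReal_lt_top (lintegral_exp_timeMeasure_lt_top (by positivity))
  have hdom : Integrable (fun p : Ω × ℝ≥0 =>
      2 * ‖x‖ ^ 2 * Real.exp (-a * p.2) + 2 * (Real.exp (-a * p.2) * ‖Z p.2 p.1‖ ^ 2))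
      (P.prod timeMeasure) := ((integrable_exp_prod ha).const_mul _).add (hZint.const_mul 2)
  refine hdom.mono' (hexp.mul ((hZ.aestronglyMeasurable_freeState hS x).norm.pow 2))
    (ae_of_all _ fun p => ?_)
  rw [Real.norm_of_nonneg (by positivity)]
  have h1 : ‖freeState S Z x p.2 p.1‖ ≤ ‖x‖ + ‖Z p.2 p.1‖ :=
    (norm_add_le _ _).trans (add_le_add_left (hS1 _ _) _)
  have h2 : ‖freeState S Z x p.2 p.1‖ ^ 2 ≤ 2 * ‖x‖ ^ 2 + 2 * ‖Z p.2 p.1‖ ^ 2 := by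
    nlinarith [norm_nonneg (freeState S Z x p.2 p.1), sq_nonneg (‖x‖ - ‖Z p.2 p.1‖),
      norm_nonneg x, norm_nonneg (Z p.2 p.1)]
  nlinarith [Real.exp_pos (-a * (p.2 : ℝ))]

end FreeState

end SingularControl

namespace SingularControl

/-! ### Intensities and their random measures -/

variable {Ω : Type*} {mΩ : MeasurableSpace Ω} {P : Measure Ω} {𝓕 : Filtration ℝ≥0 mΩ}

namespace Intensity

theorem measure_Iic (ν : Intensity 𝓕) (ω : Ω) (t : ℝ≥0) :
    ν.measure ω (Iic t) = ν.val t ω := by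
  have hpre : Real.toNNReal ⁻¹' Iic t = Iic (t : ℝ) := by
    ext r
    simp [Real.toNNReal_le_iff_le_coe]
  have hlim : Tendsto (ν.path ω) atBot (𝓝 0) := by
    refine tendsto_const_nhds.congr' ?_
    filter_upwards [Iio_mem_atBot (0 : ℝ)] with r hr
    change 0 = if r < 0 then 0 else (ν.val r.toNNReal ω : ℝ)
    rw [if_pos (mem_Iio.1 hr)]
  rw [measure, Measure.map_apply measurable_real_toNNReal measurableSet_Iic, hpre,
    StieltjesFunction.measure_Iic _ hlim, sub_zero]
  change ENNReal.ofReal (if (t : ℝ) < 0 then 0 else (ν.val (t : ℝ).toNNReal ω : ℝ)) = _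
  rw [if_neg (not_lt.2 (NNReal.coe_nonneg t)), Real.toNNReal_coe, ENNReal.ofReal_coe_nnreal]

instance (ν : Intensity 𝓕) (ω : Ω) : SFinite (ν.measure ω) := by
  unfold measure; infer_instance

instance (ν : Intensity 𝓕) (ω : Ω) (t : ℝ≥0) : IsFiniteMeasure ((ν.measure ω).restrict (Iic t)) :=
  ⟨by rw [Measure.restrict_apply_univ, measure_Iic]; exact ENNReal.coe_lt_top⟩

/-- The random measure of an intensity is determined by the masses of the intervals `[0, t]`. -/
theorem measure_eq_of_Iic (ν : Intensity 𝓕) (ω : Ω) {m : Measure ℝ≥0}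
    (h : ∀ t, m (Iic t) = ν.val t ω) : ν.measure ω = m := by
  have hcover : ⋃ k : ℕ, Iic (k : ℝ≥0) = univ := by
    refine eq_univ_of_forall fun t => ?_
    obtain ⟨k, hk⟩ := exists_nat_ge t
    exact mem_iUnion.2 ⟨k, hk⟩
  refine (Measure.ext_iff_of_iUnion_eq_univ hcover).2 fun k => ?_
  refine Measure.ext_of_Iic _ _ fun a => ?_
  rw [Measure.restrict_apply measurableSet_Iic, Measure.restrict_apply measurableSet_Iic,
    Iic_inter_Iic, measure_Iic, h]

theorem measurable_restrict_measure (ν : Intensity 𝓕) (t : ℝ≥0) :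
    Measurable[𝓕 t] fun ω => (ν.measure ω).restrict (Iic t) := by
  have hmeas : ∀ s, s ≤ t → Measurable[𝓕 t] fun ω => (ν.val s ω : ℝ≥0∞) := fun s hs =>
    ((ν.adapted s).mono (𝓕.mono hs) le_rfl).coe_nnreal_ennreal
  refine @Measurable.measure_of_isPiSystem Ω ℝ≥0 (𝓕 t) _ _ _ _
    (borel_eq_generateFrom_Iic ℝ≥0 ▸ BorelSpace.measurable_eq) isPiSystem_Iic ?_ ?_
  · rintro _ ⟨s, rfl⟩
    simp_rw [Measure.restrict_apply measurableSet_Iic, Iic_inter_Iic, measure_Iic]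
    exact hmeas _ inf_le_right
  · simp_rw [Measure.restrict_apply_univ, measure_Iic]
    exact hmeas t le_rfl

/-- The intensity `t ↦ m [0, t]` of an adapted, locally finite random measure `m`. -/
noncomputable def ofMeasure (m : Ω → Measure ℝ≥0) (hfin : ∀ ω t, m ω (Iic t) ≠ ∞)
    (hm : ∀ t, Measurable[𝓕 t] fun ω => m ω (Iic t)) : Intensity 𝓕 where
  val t ω := (m ω (Iic t)).toNNReal
  adapted t := (hm t).ennreal_toNNReal
  mono ω s t hst := ENNReal.toNNReal_mono (hfin ω t) (measure_mono (Iic_subset_Iic.2 hst))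
  rightCont ω t := by
    rw [← continuousWithinAt_Ioi_iff_Ici]
    have h := tendsto_measure_biInter_gt (μ := m ω) (s := fun s : ℝ≥0 => Iic s) (a := t)
      (fun _ _ => measurableSet_Iic.nullMeasurableSet) (fun _ _ _ hij => Iic_subset_Iic.2 hij)
      ⟨t + 1, lt_add_one t, hfin ω _⟩
    have hinter : ⋂ r > t, Iic r = Iic t := by
      ext s
      simp only [mem_iInter, mem_Iic]
      exact ⟨fun h => le_of_forall_gt_imp_ge_of_dense h, fun h r hr => h.trans (le_of_lt hr)⟩
    rw [hinter] at h
    exact (ENNReal.tendsto_toNNReal (hfin ω t)).comp h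

theorem coe_ofMeasure_val (m : Ω → Measure ℝ≥0) (hfin : ∀ ω t, m ω (Iic t) ≠ ∞)
    (hm : ∀ t, Measurable[𝓕 t] fun ω => m ω (Iic t)) (t : ℝ≥0) (ω : Ω) :
    ((ofMeasure m hfin hm).val t ω : ℝ≥0∞) = m ω (Iic t) :=
  ENNReal.coe_toNNReal (hfin ω t)

theorem measure_ofMeasure (m : Ω → Measure ℝ≥0) (hfin : ∀ ω t, m ω (Iic t) ≠ ∞)
    (hm : ∀ t, Measurable[𝓕 t] fun ω => m ω (Iic t)) (ω : Ω) :
    (ofMeasure m hfin hm).measure ω = m ω :=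
  measure_eq_of_Iic _ ω fun t => (coe_ofMeasure_val m hfin hm t ω).symm

/-- The intensity with random measure `e^{as} dν_s`. -/
noncomputable def reweight (a : ℝ) (ν : Intensity 𝓕) : Intensity 𝓕 :=
  ofMeasure (fun ω => (ν.measure ω).withDensity fun s => ENNReal.ofReal (Real.exp (a * s)))
    (fun ω t => by
      rw [withDensity_apply _ measurableSet_Iic]
      refine ne_of_lt (lt_of_le_of_lt (setLIntegral_mono' (g := fun _ =>
        ENNReal.ofReal (Real.exp (|a| * t))) measurableSet_Iic fun s hs => ?_) ?_)
      · refine ENNReal.ofReal_le_ofReal (Real.exp_le_exp.2 ?_)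
        have : (s : ℝ) ≤ t := hs
        calc a * s ≤ |a| * s := by gcongr; exact le_abs_self a
          _ ≤ |a| * t := by gcongr
      · rw [setLIntegral_const, measure_Iic]
        exact ENNReal.mul_lt_top ENNReal.ofReal_lt_top ENNReal.coe_lt_top)
    (fun t => by
      simp_rw [withDensity_apply _ measurableSet_Iic]
      exact (Measure.measurable_lintegral (by fun_prop)).comp (ν.measurable_restrict_measure t))

theorem measure_reweight (a : ℝ) (ν : Intensity 𝓕) (ω : Ω) : (ν.reweight a).measure ω
    = (ν.measure ω).withDensity fun s => ENNReal.ofReal (Real.exp (a * s)) :=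
  measure_ofMeasure _ _ _ ω

theorem coe_reweight_val (a : ℝ) (ν : Intensity 𝓕) (t : ℝ≥0) (ω : Ω) :
    ((ν.reweight a).val t ω : ℝ≥0∞)
      = ∫⁻ s in Iic t, ENNReal.ofReal (Real.exp (a * s)) ∂ν.measure ω := by
  rw [← measure_Iic, measure_reweight, withDensity_apply _ measurableSet_Iic]

theorem reweight_neg_reweight (a : ℝ) (ν : Intensity 𝓕) (t : ℝ≥0) (ω : Ω) :
    ((ν.reweight a).reweight (-a)).val t ω = ν.val t ω := by
  rw [← ENNReal.coe_inj, ← measure_Iic, ← measure_Iic, measure_reweight, measure_reweight,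
    ← withDensity_mul _ (by fun_prop) (by fun_prop)]
  have : ((fun s : ℝ≥0 => ENNReal.ofReal (Real.exp (a * s))) *
      fun s : ℝ≥0 => ENNReal.ofReal (Real.exp (-a * s))) = 1 := by
    funext s
    rw [Pi.mul_apply, ← ENNReal.ofReal_mul (Real.exp_pos _).le, ← Real.exp_add]
    simp
  rw [this, withDensity_one]

/-- Two intensities with the same paths have the same reweighted paths. -/
theorem reweight_val_congr (a : ℝ) {ν ν' : Intensity 𝓕} {ω : Ω}
    (h : ∀ t, ν.val t ω = ν'.val t ω) (t : ℝ≥0) :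
    (ν.reweight a).val t ω = (ν'.reweight a).val t ω := by
  have hm : ν.measure ω = ν'.measure ω := measure_eq_of_Iic _ ω fun s => by rw [measure_Iic, h]
  rw [← ENNReal.coe_inj, coe_reweight_val, coe_reweight_val, hm]

/-- With a nonpositive exponent, reweighting decreases the intensity. -/
theorem reweight_val_le {a : ℝ} (ha : a ≤ 0) (ν : Intensity 𝓕) (t : ℝ≥0) (ω : Ω) :
    (ν.reweight a).val t ω ≤ ν.val t ω := by
  rw [← ENNReal.coe_le_coe, coe_reweight_val, ← measure_Iic]
  calc ∫⁻ s in Iic t, ENNReal.ofReal (Real.exp (a * s)) ∂ν.measure ω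
      ≤ ∫⁻ _ in Iic t, 1 ∂ν.measure ω := lintegral_mono fun s => by
        rw [← ENNReal.ofReal_one]
        exact ENNReal.ofReal_le_ofReal (Real.exp_le_one_iff.2
          (mul_nonpos_of_nonpos_of_nonneg ha s.2))
    _ = _ := by simp

/-- Integration by parts for the discounted mass of an intensity. -/
theorem lintegral_exp_measure (ν : Intensity 𝓕) {r : ℝ} (hr : 0 < r) (ω : Ω) :
    ∫⁻ s, ENNReal.ofReal (Real.exp (-r * s)) ∂ν.measure ω
      = ∫⁻ t, ENNReal.ofReal (r * Real.exp (-r * t)) * ν.val t ω ∂timeMeasure := by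
  have h1 : ∀ s : ℝ≥0, ENNReal.ofReal (Real.exp (-r * s)) = ∫⁻ t,
      {p : ℝ≥0 × ℝ≥0 | p.1 ≤ p.2}.indicator
        (fun p => ENNReal.ofReal (r * Real.exp (-r * p.2))) (s, t) ∂timeMeasure := by
    intro s
    rw [← lintegral_timeMeasure_exp hr s, ← lintegral_indicator measurableSet_Ici]
    rfl
  simp_rw [h1]
  rw [lintegral_lintegral_swap]
  · refine lintegral_congr fun t => ?_
    rw [← measure_Iic, ← setLIntegral_const, ← lintegral_indicator measurableSet_Iic]
    rfl
  · refine Measurable.aemeasurable ?_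
    exact Measurable.indicator (by fun_prop) (measurableSet_le measurable_fst measurable_snd)

theorem measurable_val (ν : Intensity 𝓕) (t : ℝ≥0) : Measurable (ν.val t) :=
  (ν.adapted t).mono (𝓕.le t) le_rfl

theorem aestronglyMeasurable (ν : Intensity 𝓕) :
    AEStronglyMeasurable (fun p : Ω × ℝ≥0 => (ν.val p.2 p.1 : ℝ)) (P.prod timeMeasure) :=
  aestronglyMeasurable_uncurry_of_rightCont
    (X := fun t ω => (ν.val t ω : ℝ))
    (fun t => (ν.measurable_val t).coe_nnreal_real.aestronglyMeasurable)
    (ae_of_all _ fun ω t => NNReal.continuous_coe.continuousAt.comp_continuousWithinAt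
      (ν.rightCont ω t))

/-! ### Operations on intensities -/

/-- The intensity `a ν + b ν'`. -/
noncomputable def linComb (a b : ℝ≥0) (ν ν' : Intensity 𝓕) : Intensity 𝓕 where
  val t ω := a * ν.val t ω + b * ν'.val t ω
  adapted t := ((ν.adapted t).const_mul a).add ((ν'.adapted t).const_mul b)
  mono ω _ _ hst :=
    add_le_add (mul_le_mul_right (ν.mono ω hst) a) (mul_le_mul_right (ν'.mono ω hst) b)
  rightCont ω t := ((ν.rightCont ω t).const_mul a).add ((ν'.rightCont ω t).const_mul b)

/-- The intensity which never acts. -/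
noncomputable def zero (𝓕 : Filtration ℝ≥0 mΩ) : Intensity 𝓕 where
  val _ _ := 0
  adapted _ := measurable_const
  mono _ := monotone_const
  rightCont _ _ := continuousWithinAt_const

/-- The intensity `(ν - ε)⁺`. -/
noncomputable def truncSub (ν : Intensity 𝓕) (ε : ℝ≥0) : Intensity 𝓕 where
  val t ω := ν.val t ω - ε
  adapted t := (ν.adapted t).sub_const ε
  mono ω _ _ hst := tsub_le_tsub_right (ν.mono ω hst) ε
  rightCont ω t := (continuous_id.sub continuous_const).continuousAt.comp_continuousWithinAt
    (ν.rightCont ω t)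

open Classical in
/-- The intensity `ν`, with an additional jump of size `ε` at the stopping time `τ`. -/
noncomputable def addJump (ν : Intensity 𝓕) (ε : ℝ≥0) {τ : Ω → WithTop ℝ≥0}
    (hτ : IsStoppingTime 𝓕 τ) : Intensity 𝓕 where
  val t ω := ν.val t ω + if τ ω ≤ t then ε else 0
  adapted t := (ν.adapted t).add (Measurable.ite (hτ t) measurable_const measurable_const)
  mono ω s t hst := by
    refine add_le_add (ν.mono ω hst) ?_
    have : τ ω ≤ s → τ ω ≤ t := fun h => h.trans (WithTop.coe_le_coe.2 hst)
    split_ifs with h1 h2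
    · exact le_rfl
    · exact absurd (this h1) h2
    · exact zero_le
    · exact le_rfl
  rightCont ω t := by
    refine (ν.rightCont ω t).add ?_
    by_cases h : τ ω ≤ t
    · refine (continuousWithinAt_const (b := ε)).congr (fun s hs => ?_) (if_pos h)
      exact if_pos (h.trans (WithTop.coe_le_coe.2 hs))
    · have hnhds : ∀ᶠ s : ℝ≥0 in 𝓝[≥] t, ¬ τ ω ≤ s := by
        refine eventually_nhdsWithin_of_eventually_nhds ?_
        cases hω : τ ω with
        | top => exact Eventually.of_forall fun s => not_le.2 (WithTop.coe_lt_top s)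
        | coe r =>
          rw [hω, WithTop.coe_le_coe, not_le] at h
          filter_upwards [Iio_mem_nhds h] with s hs
          rw [WithTop.coe_le_coe]
          exact not_le.2 hs
      refine (continuousWithinAt_const (b := (0 : ℝ≥0))).congr_of_eventuallyEq ?_ (if_neg h)
      filter_upwards [hnhds] with s hs using if_neg hs

/-- The first time at which the intensity is positive, `⊤` if it never is. -/
noncomputable def firstAction (ν : Intensity 𝓕) (ω : Ω) : WithTop ℝ≥0 :=
  ⨅ t : {t : ℝ≥0 // 0 < ν.val t ω}, ((t : ℝ≥0) : WithTop ℝ≥0)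

theorem firstAction_lt_iff (ν : Intensity 𝓕) (ω : Ω) (t : ℝ≥0) :
    ν.firstAction ω < t ↔ ∃ s < t, 0 < ν.val s ω := by
  rw [firstAction, iInf_lt_iff]
  constructor
  · rintro ⟨⟨s, hs⟩, hst⟩
    exact ⟨s, WithTop.coe_lt_coe.1 hst, hs⟩
  · rintro ⟨s, hst, hs⟩
    exact ⟨⟨s, hs⟩, WithTop.coe_lt_coe.2 hst⟩

/-- Under the usual conditions, the first time of action is a stopping time, although the event
`{τ ≤ t}` depends on the path immediately after `t`. -/
theorem isStoppingTime_firstAction (h𝓕 : UsualConditions P 𝓕) (ν : Intensity 𝓕) :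
    IsStoppingTime 𝓕 ν.firstAction := by
  intro t
  rw [← h𝓕.rightCont t, MeasurableSpace.measurableSet_iInf]
  intro u
  rw [MeasurableSpace.measurableSet_iInf]
  intro hu
  obtain ⟨v, hv0, hvt, hv⟩ := exists_seq_strictAnti_tendsto' (show t < u from hu)
  have hset : {ω | ν.firstAction ω ≤ t} = ⋂ k, {ω | 0 < ν.val (v k) ω} := by
    ext ω
    simp only [mem_ofPred_eq, mem_iInter]
    constructor
    · intro h k
      obtain ⟨s, hs, hpos⟩ := (ν.firstAction_lt_iff ω (v k)).1
        (h.trans_lt (WithTop.coe_lt_coe.2 (hvt k).1))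
      exact hpos.trans_le (ν.mono ω hs.le)
    · intro h
      by_contra! hcon
      obtain ⟨s, hs1, hs2⟩ := exists_between hcon
      obtain ⟨s, rfl⟩ := WithTop.ne_top_iff_exists.1 (hs2.trans_le le_top).ne
      obtain ⟨k, hk⟩ := (hv.eventually_lt_const (WithTop.coe_lt_coe.1 hs1)).exists
      exact absurd ((ν.firstAction_lt_iff ω s).2 ⟨v k, hk, h k⟩) (not_lt.2 hs2.le)
  rw [hset]
  exact MeasurableSet.iInter fun k =>
    ((ν.adapted (v k)).mono (𝓕.mono (hvt k).2.le) le_rfl) measurableSet_Ioi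

end Intensity

/-! ### Limits of intensities -/

theorem ae_prod_eq_of_ae_ae [SFinite P] {f g : Ω × ℝ≥0 → ℝ}
    (hf : AEStronglyMeasurable f (P.prod timeMeasure))
    (hg : AEStronglyMeasurable g (P.prod timeMeasure))
    (h : ∀ᵐ ω ∂P, ∀ᵐ t ∂timeMeasure, f (ω, t) = g (ω, t)) : f =ᵐ[P.prod timeMeasure] g := by
  have hm : AEMeasurable (fun p => ‖f p - g p‖ₑ) (P.prod timeMeasure) := (hf.sub hg).enorm
  have h0 : ∫⁻ p, ‖f p - g p‖ₑ ∂P.prod timeMeasure = 0 := by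
    rw [lintegral_prod _ hm, lintegral_eq_zero_iff' hm.lintegral_prod_right']
    filter_upwards [h] with ω hω
    rw [Pi.zero_apply, lintegral_eq_zero_of_ae_eq_zero]
    filter_upwards [hω] with t ht
    simp [ht]
  filter_upwards [(lintegral_eq_zero_iff' hm).1 h0] with p hp
  simpa [sub_eq_zero] using hp

/-- Intensities which agree almost everywhere are indistinguishable, by right-continuity. -/
theorem Intensity.indistinguishable_of_ae_eq [SFinite P] {u v : Intensity 𝓕}
    (h : ∀ᵐ p ∂P.prod timeMeasure, u.val p.2 p.1 = v.val p.2 p.1) :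
    ∀ᵐ ω ∂P, ∀ t, u.val t ω = v.val t ω := by
  filter_upwards [Measure.ae_ae_of_ae_prod h] with ω hω t
  exact tendsto_nhds_unique_of_frequently_eq
    ((u.rightCont ω t).mono Ioi_subset_Ici_self).tendsto
    ((v.rightCont ω t).mono Ioi_subset_Ici_self).tendsto
    (frequently_nhdsGT_of_ae_timeMeasure hω t)

/-- The regularisation `s ↦ L (s+)` of a nondecreasing function is right-continuous. -/
theorem continuousWithinAt_iInf_add {L : ℝ≥0 → ℝ≥0∞} (hL : Monotone L) (t : ℝ≥0) :
    ContinuousWithinAt (fun s => ⨅ k : ℕ, L (s + 1 / ((k : ℝ≥0) + 1))) (Ici t) t := by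
  have hmono : Monotone fun s => ⨅ k : ℕ, L (s + 1 / ((k : ℝ≥0) + 1)) := fun a b hab =>
    iInf_mono fun k => hL (by gcongr)
  rw [ContinuousWithinAt, tendsto_order]
  refine ⟨fun c hc => ?_, fun c hc => ?_⟩
  · filter_upwards [self_mem_nhdsWithin] with s hs using hc.trans_le (hmono hs)
  · obtain ⟨k, hk⟩ := iInf_lt_iff.1 hc
    have hlt : t < t + 1 / ((k : ℝ≥0) + 1) := lt_add_of_pos_right _ (by positivity)
    filter_upwards [mem_nhdsWithin_of_mem_nhds (Iio_mem_nhds hlt)] with s hs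
    have hlim : Tendsto (fun j : ℕ => s + 1 / ((j : ℝ≥0) + 1)) atTop (𝓝 s) := by
      simpa using (tendsto_one_div_add_atTop_nhds_zero_nat (𝕜 := ℝ≥0)).const_add s
    obtain ⟨j, hj⟩ := (hlim.eventually_lt_const hs).exists
    exact (iInf_le _ j).trans_lt ((hL hj.le).trans_lt hk)

/-- An almost everywhere limit of intensities has a version which is an intensity: the lower limit
of the paths is nondecreasing and adapted, and its right-continuous regularisation differs from it
at countably many times only. -/
theorem exists_intensity_of_tendsto [IsProbabilityMeasure P] (h𝓕 : UsualConditions P 𝓕)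
    {u : ℕ → Intensity 𝓕} {f : Ω × ℝ≥0 → ℝ}
    (hf : ∀ᵐ p ∂P.prod timeMeasure, Tendsto (fun k => ((u k).val p.2 p.1 : ℝ)) atTop (𝓝 (f p))) :
    ∃ v : Intensity 𝓕, ∀ᵐ p ∂P.prod timeMeasure, (v.val p.2 p.1 : ℝ) = f p := by
  classical
  set L : Ω → ℝ≥0 → ℝ≥0∞ := fun ω t => liminf (fun k => ((u k).val t ω : ℝ≥0∞)) atTop with hLdef
  have hLmono : ∀ ω, Monotone (L ω) := fun ω s t hst =>
    liminf_le_liminf (Eventually.of_forall fun k => ENNReal.coe_le_coe.2 ((u k).mono ω hst))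
  have hLmeas : ∀ s t, s ≤ t → Measurable[𝓕 t] fun ω => L ω s := fun s t hst =>
    Measurable.liminf fun k =>
      ((((u k).adapted s).mono (𝓕.mono hst) le_rfl).coe_nnreal_ennreal)
  set R : Ω → ℝ≥0 → ℝ≥0∞ := fun ω t => ⨅ k : ℕ, L ω (t + 1 / ((k : ℝ≥0) + 1)) with hRdef
  have hRmono : ∀ ω, Monotone (R ω) := fun ω s t hst => iInf_mono fun k => hLmono ω (by gcongr)
  have hRle : ∀ ω s t, s < t → R ω s ≤ L ω t := fun ω s t hst => by
    have hlim : Tendsto (fun j : ℕ => s + 1 / ((j : ℝ≥0) + 1)) atTop (𝓝 s) := by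
      simpa using (tendsto_one_div_add_atTop_nhds_zero_nat (𝕜 := ℝ≥0)).const_add s
    obtain ⟨j, hj⟩ := (hlim.eventually_lt_const hst).exists
    exact (iInf_le _ j).trans (hLmono ω hj.le)
  have hLR : ∀ ω t, L ω t ≤ R ω t := fun ω t => le_iInf fun k => hLmono ω le_self_add
  have hRmeas : ∀ t, Measurable[𝓕 t] fun ω => R ω t := by
    intro t B hB
    rw [← h𝓕.rightCont t, MeasurableSpace.measurableSet_iInf]
    intro s
    rw [MeasurableSpace.measurableSet_iInf]
    intro hs
    have hlim : Tendsto (fun j : ℕ => t + 1 / ((j : ℝ≥0) + 1)) atTop (𝓝 t) := by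
      simpa using (tendsto_one_div_add_atTop_nhds_zero_nat (𝕜 := ℝ≥0)).const_add t
    obtain ⟨j, hj⟩ := (hlim.eventually_lt_const (show t < s from hs)).exists
    have hanti : ∀ ω, Antitone fun k : ℕ => L ω (t + 1 / ((k : ℝ≥0) + 1)) := fun ω a b hab =>
      hLmono ω (by gcongr)
    have heq : (fun ω => R ω t) = fun ω => ⨅ k : ℕ, L ω (t + 1 / (((k + j : ℕ) : ℝ≥0) + 1)) :=
      funext fun ω => ((hanti ω).iInf_nat_add j).symm
    rw [heq]
    refine (Measurable.iInf fun k => hLmeas _ _ ?_) hB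
    refine le_trans ?_ hj.le
    gcongr
    exact Nat.le_add_left j k
  have hfin : ∀ᵐ ω ∂P, (∀ t, R ω t ≠ ∞) ∧ ∀ᵐ t ∂timeMeasure, (R ω t).toReal = f (ω, t) := by
    filter_upwards [Measure.ae_ae_of_ae_prod hf] with ω hω
    have hL : ∀ᵐ t ∂timeMeasure, L ω t = ENNReal.ofReal (f (ω, t)) ∧ 0 ≤ f (ω, t) := by
      filter_upwards [hω] with t ht
      refine ⟨?_, ge_of_tendsto' ht fun k => NNReal.coe_nonneg _⟩
      refine Tendsto.liminf_eq ?_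
      simpa only [Function.comp_def, ENNReal.ofReal_coe_nnreal] using
        (ENNReal.continuous_ofReal.tendsto _).comp ht
    refine ⟨fun t => ?_, ?_⟩
    · obtain ⟨s, hs, hts⟩ := ((frequently_nhdsGT_of_ae_timeMeasure hL t).and_eventually
        self_mem_nhdsWithin).exists
      refine ne_top_of_le_ne_top ?_ (hRle ω t s hts)
      rw [hs.1]
      exact ENNReal.ofReal_ne_top
    · filter_upwards [hL, ((hLmono ω).countable_not_continuousAt).ae_notMem timeMeasure]
        with t ht hcont
      have hcont' : ContinuousAt (L ω) t := by simpa using hcont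
      have hRL : R ω t ≤ L ω t := ge_of_tendsto
        (hcont'.tendsto.mono_left (nhdsWithin_le_nhds (s := Ioi t)))
        (by filter_upwards [self_mem_nhdsWithin] with s hs using hRle ω t s hs)
      rw [le_antisymm hRL (hLR ω t), ht.1, ENNReal.toReal_ofReal ht.2]
  -- the null set where the limit is infinite belongs to `𝓕 0`, and the paths are set to `0` on it
  set N : Set Ω := {ω | ¬ ∀ t, R ω t ≠ ∞} with hN
  have hN0 : MeasurableSet[𝓕 0] N := h𝓕.null_mem N (by
    have := hfin.mono fun ω h => h.1
    exact ae_iff.1 this)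
  let v : Intensity 𝓕 :=
    { val := fun t ω => if ω ∈ N then 0 else (R ω t).toNNReal
      adapted := fun t => Measurable.ite (𝓕.mono zero_le _ hN0) measurable_const
        (hRmeas t).ennreal_toNNReal
      mono := fun ω s t hst => by
        by_cases h : ω ∈ N
        · simp [h]
        · have h' : ∀ t, R ω t ≠ ∞ := not_not.1 h
          simpa [h] using ENNReal.toNNReal_mono (h' t) (hRmono ω hst)
      rightCont := fun ω t => by
        by_cases h : ω ∈ N
        · simpa [h] using continuousWithinAt_const
        · have h' : ∀ t, R ω t ≠ ∞ := not_not.1 h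
          simp only [h, if_false]
          exact (ENNReal.tendsto_toNNReal (h' t)).comp (continuousWithinAt_iInf_add (hLmono ω) t) }
  refine ⟨v, ?_⟩
  have hfm : AEStronglyMeasurable f (P.prod timeMeasure) :=
    aestronglyMeasurable_of_tendsto_ae atTop (fun k => (u k).aestronglyMeasurable) hf
  refine ae_prod_eq_of_ae_ae v.aestronglyMeasurable hfm ?_
  filter_upwards [hfin] with ω hω
  filter_upwards [hω.2] with t ht
  have hωN : ω ∉ N := not_not.2 hω.1
  rw [← ht]
  change ((if ω ∈ N then 0 else (R ω t).toNNReal : ℝ≥0) : ℝ) = _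
  rw [if_neg hωN]
  rfl

end SingularControl

namespace SingularControl

/-! ### The reduced control problem -/

variable {Ω H : Type*} {mΩ : MeasurableSpace Ω} [NormedAddCommGroup H] [InnerProductSpace ℝ H]

/-- What the reduced problem uses of the data: `n` is an eigenvector of the contractions `S t`, the
uncontrolled state has integrable discounted second moments, and the running cost `G` is convex,
semiconcave and of quadratic growth, with explicit constants. -/
structure IsReducedProblem (P : Measure Ω) (S : ℝ≥0 → H →L[ℝ] H) (Z : ℝ≥0 → Ω → H) (G : H → ℝ)
    (ρ lam : ℝ) (n : H) (c κ₁ κ₂ C : ℝ) : Prop where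
  norm_le : ∀ t x, ‖S t x‖ ≤ ‖x‖
  eigen : ∀ t, S t n = Real.exp (lam * t) • n
  ne_zero : n ≠ 0
  rho_pos : 0 < ρ
  lam_neg : lam < 0
  meas : ∀ x, AEStronglyMeasurable (fun p : Ω × ℝ≥0 => freeState S Z x p.2 p.1)
    (P.prod timeMeasure)
  int_sq : ∀ a : ℝ, 0 < a → ∀ x, Integrable (fun p : Ω × ℝ≥0 =>
    Real.exp (-a * p.2) * ‖freeState S Z x p.2 p.1‖ ^ 2) (P.prod timeMeasure)
  convex : ConvexOn ℝ univ G
  c_pos : 0 < c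
  k1_pos : 0 < κ₁
  k2_pos : 0 < κ₂
  C_pos : 0 < C
  lower : ∀ x, κ₁ * ‖x‖ ^ 2 - κ₂ ≤ G x
  upper : ∀ x, G x ≤ c * (1 + ‖x‖ ^ 2)
  semiconcave : ∀ x h, G (x + h) + G (x - h) - 2 * G x ≤ C * ‖h‖ ^ 2

/-- The integrand of the reduced cost, for the value `u` of the reduced control: the singular cost
is rewritten as an integral over time, and `κ₂` is added to `G` to make the integrand
nonnegative. -/
noncomputable def runCost (S : ℝ≥0 → H →L[ℝ] H) (Z : ℝ≥0 → Ω → H) (G : H → ℝ) (ρ lam : ℝ) (n : H)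
    (κ₂ : ℝ) (x : H) (u : ℝ) (p : Ω × ℝ≥0) : ℝ :=
  Real.exp (-ρ * p.2) * (G (freeState S Z x p.2 p.1 + (Real.exp (lam * p.2) * u) • n) + κ₂)
    + (ρ - lam) * Real.exp (-(ρ - lam) * p.2) * u

/-- The reduced cost of the control `u`, as an extended nonnegative number. -/
noncomputable def redCost (P : Measure Ω) {𝓕 : Filtration ℝ≥0 mΩ} (S : ℝ≥0 → H →L[ℝ] H)
    (Z : ℝ≥0 → Ω → H) (G : H → ℝ) (ρ lam : ℝ) (n : H) (κ₂ : ℝ) (x : H) (u : Intensity 𝓕) : ℝ≥0∞ :=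
  ∫⁻ p, ENNReal.ofReal (runCost S Z G ρ lam n κ₂ x (u.val p.2 p.1) p) ∂(P.prod timeMeasure)

/-- The reduced cost of the control `u`, as a real number. -/
noncomputable def redCostReal (P : Measure Ω) {𝓕 : Filtration ℝ≥0 mΩ} (S : ℝ≥0 → H →L[ℝ] H)
    (Z : ℝ≥0 → Ω → H) (G : H → ℝ) (ρ lam : ℝ) (n : H) (κ₂ : ℝ) (x : H) (u : Intensity 𝓕) : ℝ :=
  ∫ p, runCost S Z G ρ lam n κ₂ x (u.val p.2 p.1) p ∂(P.prod timeMeasure)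

/-- Square integrability of `e^{-(ρ/2 - λ)t} u_t`; it characterises the controls of finite reduced
cost, whatever the initial state. -/
def Intensity.SqIntegrable {𝓕 : Filtration ℝ≥0 mΩ} (P : Measure Ω) (ρ lam : ℝ)
    (u : Intensity 𝓕) : Prop :=
  MemLp (fun p : Ω × ℝ≥0 => Real.exp (-(ρ / 2 - lam) * p.2) * (u.val p.2 p.1 : ℝ)) 2
    (P.prod timeMeasure)

namespace IsReducedProblem

variable {P : Measure Ω} {𝓕 : Filtration ℝ≥0 mΩ} {S : ℝ≥0 → H →L[ℝ] H} {Z : ℝ≥0 → Ω → H}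
  {G : H → ℝ} {ρ lam : ℝ} {n : H} {c κ₁ κ₂ C : ℝ}

theorem continuous (h : IsReducedProblem P S Z G ρ lam n c κ₁ κ₂ C) : Continuous G :=
  continuous_of_convexOn_of_le h.convex h.upper

theorem differentiable (h : IsReducedProblem P S Z G ρ lam n c κ₁ κ₂ C) : Differentiable ℝ G :=
  differentiable_of_convexOn_of_semiconcave h.convex h.upper h.semiconcave

theorem rate_pos (h : IsReducedProblem P S Z G ρ lam n c κ₁ κ₂ C) : 0 < ρ - lam := by
  linarith [h.rho_pos, h.lam_neg]

theorem lower_nonneg (h : IsReducedProblem P S Z G ρ lam n c κ₁ κ₂ C) (x : H) : 0 ≤ G x + κ₂ := by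
  have := h.lower x
  have := h.k1_pos
  nlinarith [sq_nonneg ‖x‖]

theorem runCost_nonneg (h : IsReducedProblem P S Z G ρ lam n c κ₁ κ₂ C) (x : H) {u : ℝ}
    (hu : 0 ≤ u) (p : Ω × ℝ≥0) : 0 ≤ runCost S Z G ρ lam n κ₂ x u p := by
  have h1 := h.lower_nonneg (freeState S Z x p.2 p.1 + (Real.exp (lam * p.2) * u) • n)
  have h2 := h.rate_pos
  unfold runCost
  positivity

theorem exp_sq_mul (ρ lam u : ℝ) (t : ℝ≥0) :
    (Real.exp (-(ρ / 2 - lam) * t) * u) ^ 2 = Real.exp (-ρ * t) * (Real.exp (lam * t) * u) ^ 2 := by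
  have h1 : Real.exp (-(ρ / 2 - lam) * t) ^ 2 = Real.exp (-ρ * t) * Real.exp (lam * t) ^ 2 := by
    rw [← Real.exp_nat_mul, ← Real.exp_nat_mul, ← Real.exp_add]
    push_cast
    ring_nf
  rw [mul_pow, h1, mul_pow, mul_assoc]

theorem exp_rate (ρ lam : ℝ) (t : ℝ≥0) :
    Real.exp (-(ρ - lam) * t) = Real.exp (-ρ * t) * Real.exp (lam * t) := by
  rw [← Real.exp_add]; ring_nf

theorem runCost_le (h : IsReducedProblem P S Z G ρ lam n c κ₁ κ₂ C) (x : H) (u : ℝ)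
    (p : Ω × ℝ≥0) : runCost S Z G ρ lam n κ₂ x u p ≤
      (c + κ₂ + (ρ - lam)) * Real.exp (-ρ * p.2)
      + 2 * c * (Real.exp (-ρ * p.2) * ‖freeState S Z x p.2 p.1‖ ^ 2)
      + (2 * c * ‖n‖ ^ 2 + (ρ - lam)) * (Real.exp (-(ρ / 2 - lam) * p.2) * u) ^ 2 := by
  set y := freeState S Z x p.2 p.1
  set e := Real.exp (-ρ * p.2) with he
  set w := Real.exp (lam * p.2) * u with hw
  have he0 : 0 < e := Real.exp_pos _
  have hr := h.rate_pos
  have hc := h.c_pos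
  rw [exp_sq_mul, runCost, exp_rate]
  have h1 : ‖y + w • n‖ ^ 2 ≤ 2 * ‖y‖ ^ 2 + 2 * (w ^ 2 * ‖n‖ ^ 2) := by
    have := norm_add_le y (w • n)
    rw [norm_smul, Real.norm_eq_abs] at this
    have h2 : w ^ 2 * ‖n‖ ^ 2 = (|w| * ‖n‖) ^ 2 := by rw [mul_pow |w|, sq_abs]
    rw [h2]
    nlinarith [norm_nonneg (y + w • n), sq_nonneg (‖y‖ - |w| * ‖n‖)]
  have h3 := h.upper (y + w • n)
  have h4 : G (y + w • n) ≤ c * (1 + (2 * ‖y‖ ^ 2 + 2 * (w ^ 2 * ‖n‖ ^ 2))) :=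
    h3.trans (by gcongr)
  have h5 : w ≤ 1 + w ^ 2 := by nlinarith [sq_nonneg (w - 1 / 2)]
  have h6 : (ρ - lam) * (e * Real.exp (lam * p.2)) * u = (ρ - lam) * e * w := by
    rw [hw]; ring
  rw [← he, h6]
  have h7 := mul_le_mul_of_nonneg_left h4 he0.le
  have h8 := mul_le_mul_of_nonneg_left h5 (mul_pos hr he0).le
  change e * (G (y + w • n) + κ₂) + (ρ - lam) * e * w ≤ _
  nlinarith

/-- Coercivity: the integrand controls the square of the weighted control. -/
theorem sq_le_runCost (h : IsReducedProblem P S Z G ρ lam n c κ₁ κ₂ C) (x : H) {u : ℝ}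
    (hu : 0 ≤ u) (p : Ω × ℝ≥0) : (Real.exp (-(ρ / 2 - lam) * p.2) * u) ^ 2 ≤
      2 / (κ₁ * ‖n‖ ^ 2) * runCost S Z G ρ lam n κ₂ x u p
      + 2 / ‖n‖ ^ 2 * (Real.exp (-ρ * p.2) * ‖freeState S Z x p.2 p.1‖ ^ 2) := by
  have hn : ‖n‖ ≠ 0 := norm_ne_zero_iff.2 h.ne_zero
  set y := freeState S Z x p.2 p.1
  set e := Real.exp (-ρ * p.2) with he
  set w := Real.exp (lam * p.2) * u with hw
  have he0 : 0 < e := Real.exp_pos _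
  have hκ := h.k1_pos
  have hr := h.rate_pos
  rw [exp_sq_mul, ← he]
  have h1 : w ^ 2 * ‖n‖ ^ 2 ≤ 2 * ‖y + w • n‖ ^ 2 + 2 * ‖y‖ ^ 2 := by
    have h2 := norm_sub_le (y + w • n) y
    rw [add_sub_cancel_left, norm_smul, Real.norm_eq_abs] at h2
    have h3 : w ^ 2 * ‖n‖ ^ 2 = (|w| * ‖n‖) ^ 2 := by rw [mul_pow |w|, sq_abs]
    rw [h3]
    nlinarith [norm_nonneg y, norm_nonneg (y + w • n), abs_nonneg w, norm_nonneg n,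
      sq_nonneg (‖y + w • n‖ - ‖y‖), mul_nonneg (abs_nonneg w) (norm_nonneg n)]
  have h4 : e * (κ₁ * ‖y + w • n‖ ^ 2) ≤ runCost S Z G ρ lam n κ₂ x u p := by
    have h5 := mul_le_mul_of_nonneg_left (h.lower (y + w • n)) he0.le
    have h6 : 0 ≤ (ρ - lam) * Real.exp (-(ρ - lam) * p.2) * u := by positivity
    have h7 : runCost S Z G ρ lam n κ₂ x u p
      = e * (G (y + w • n) + κ₂) + (ρ - lam) * Real.exp (-(ρ - lam) * p.2) * u := rfl
    rw [h7]
    nlinarith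
  have h8 : e * w ^ 2 = 1 / ‖n‖ ^ 2 * (e * (w ^ 2 * ‖n‖ ^ 2)) := by field_simp
  rw [h8]
  calc 1 / ‖n‖ ^ 2 * (e * (w ^ 2 * ‖n‖ ^ 2))
      ≤ 1 / ‖n‖ ^ 2 * (e * (2 * ‖y + w • n‖ ^ 2 + 2 * ‖y‖ ^ 2)) := by gcongr
    _ = 2 / (κ₁ * ‖n‖ ^ 2) * (e * (κ₁ * ‖y + w • n‖ ^ 2)) + 2 / ‖n‖ ^ 2 * (e * ‖y‖ ^ 2) := by
        field_simp
    _ ≤ _ := by gcongr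

theorem aestronglyMeasurable_runCost (h : IsReducedProblem P S Z G ρ lam n c κ₁ κ₂ C) (x : H)
    (u : Intensity 𝓕) :
    AEStronglyMeasurable (fun p => runCost S Z G ρ lam n κ₂ x (u.val p.2 p.1) p)
      (P.prod timeMeasure) := by
  have hu := u.aestronglyMeasurable (P := P)
  have hexp : ∀ a : ℝ, AEStronglyMeasurable (fun p : Ω × ℝ≥0 => Real.exp (a * p.2))
      (P.prod timeMeasure) := fun a => Measurable.aestronglyMeasurable (by fun_prop)
  refine ((hexp _).mul (AEStronglyMeasurable.add ?_ aestronglyMeasurable_const)).add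
    (((hexp _).const_mul _).mul hu)
  exact h.continuous.comp_aestronglyMeasurable
    ((h.meas x).add (((hexp lam).mul hu).smul_const n))

theorem integrable_runCost [IsProbabilityMeasure P]
    (h : IsReducedProblem P S Z G ρ lam n c κ₁ κ₂ C) (x : H) {u : Intensity 𝓕}
    (hu : u.SqIntegrable P ρ lam) :
    Integrable (fun p => runCost S Z G ρ lam n κ₂ x (u.val p.2 p.1) p) (P.prod timeMeasure) := by
  have hdom := (((integrable_exp_prod (P := P) h.rho_pos).const_mul (c + κ₂ + (ρ - lam))).add
    ((h.int_sq ρ h.rho_pos x).const_mul (2 * c))).add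
    ((MemLp.integrable_sq hu).const_mul (2 * c * ‖n‖ ^ 2 + (ρ - lam)))
  refine hdom.mono' (h.aestronglyMeasurable_runCost x u) (ae_of_all _ fun p => ?_)
  rw [Real.norm_of_nonneg (h.runCost_nonneg x (NNReal.coe_nonneg _) p)]
  exact h.runCost_le x _ p

theorem redCost_eq_ofReal [IsProbabilityMeasure P]
    (h : IsReducedProblem P S Z G ρ lam n c κ₁ κ₂ C) (x : H) {u : Intensity 𝓕}
    (hu : u.SqIntegrable P ρ lam) : redCost P S Z G ρ lam n κ₂ x u
      = ENNReal.ofReal (redCostReal P S Z G ρ lam n κ₂ x u) :=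
  (ofReal_integral_eq_lintegral_ofReal (h.integrable_runCost x hu)
    (ae_of_all _ fun p => h.runCost_nonneg x (NNReal.coe_nonneg _) p)).symm

theorem redCostReal_nonneg (h : IsReducedProblem P S Z G ρ lam n c κ₁ κ₂ C) (x : H)
    (u : Intensity 𝓕) : 0 ≤ redCostReal P S Z G ρ lam n κ₂ x u :=
  integral_nonneg fun p => h.runCost_nonneg x (NNReal.coe_nonneg _) p

theorem sqIntegrable_of_redCost_ne_top
    (h : IsReducedProblem P S Z G ρ lam n c κ₁ κ₂ C) (x : H) {u : Intensity 𝓕}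
    (hu : redCost P S Z G ρ lam n κ₂ x u ≠ ∞) : u.SqIntegrable P ρ lam := by
  have hm : AEStronglyMeasurable (fun p : Ω × ℝ≥0 =>
      Real.exp (-(ρ / 2 - lam) * p.2) * (u.val p.2 p.1 : ℝ)) (P.prod timeMeasure) :=
    (Measurable.aestronglyMeasurable (by fun_prop)).mul u.aestronglyMeasurable
  have hint : Integrable (fun p => runCost S Z G ρ lam n κ₂ x (u.val p.2 p.1) p)
      (P.prod timeMeasure) := by
    refine ⟨h.aestronglyMeasurable_runCost x u, ?_⟩
    rw [hasFiniteIntegral_iff_ofReal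
      (ae_of_all _ fun p => h.runCost_nonneg x (NNReal.coe_nonneg _) p)]
    exact hu.lt_top
  refine (memLp_two_iff_integrable_sq hm).2 ?_
  refine ((hint.const_mul (2 / (κ₁ * ‖n‖ ^ 2))).add
    ((h.int_sq ρ h.rho_pos x).const_mul (2 / ‖n‖ ^ 2))).mono' (hm.pow 2)
    (ae_of_all _ fun p => ?_)
  rw [Real.norm_of_nonneg (sq_nonneg _)]
  exact h.sq_le_runCost x (NNReal.coe_nonneg _) p

theorem integral_sq_le [IsProbabilityMeasure P]
    (h : IsReducedProblem P S Z G ρ lam n c κ₁ κ₂ C) (x : H) {u : Intensity 𝓕}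
    (hu : u.SqIntegrable P ρ lam) :
    ∫ p : Ω × ℝ≥0, (Real.exp (-(ρ / 2 - lam) * p.2) * (u.val p.2 p.1 : ℝ)) ^ 2 ∂P.prod timeMeasure
      ≤ 2 / (κ₁ * ‖n‖ ^ 2) * redCostReal P S Z G ρ lam n κ₂ x u
        + 2 / ‖n‖ ^ 2 * ∫ p : Ω × ℝ≥0, Real.exp (-ρ * p.2) * ‖freeState S Z x p.2 p.1‖ ^ 2
          ∂P.prod timeMeasure := by
  rw [redCostReal, ← integral_const_mul, ← integral_const_mul,
    ← integral_add ((h.integrable_runCost x hu).const_mul _)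
      ((h.int_sq ρ h.rho_pos x).const_mul _)]
  exact integral_mono (MemLp.integrable_sq hu) (((h.integrable_runCost x hu).const_mul _).add
    ((h.int_sq ρ h.rho_pos x).const_mul _)) fun p => h.sq_le_runCost x (NNReal.coe_nonneg _) p

theorem freeState_combo (S : ℝ≥0 → H →L[ℝ] H) (Z : ℝ≥0 → Ω → H) (x y : H) {a b : ℝ}
    (hab : a + b = 1) (t : ℝ≥0) (ω : Ω) : freeState S Z (a • x + b • y) t ω
      = a • freeState S Z x t ω + b • freeState S Z y t ω := by
  have hZ : Z t ω = a • Z t ω + b • Z t ω := by rw [← add_smul, hab, one_smul]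
  simp only [freeState, map_add, map_smul, smul_add]
  nth_rewrite 1 [hZ]
  abel

theorem state_combo (S : ℝ≥0 → H →L[ℝ] H) (Z : ℝ≥0 → Ω → H) (n x y : H) {a b : ℝ}
    (hab : a + b = 1) (e u v : ℝ) (t : ℝ≥0) (ω : Ω) :
    freeState S Z (a • x + b • y) t ω + (e * (a * u + b * v)) • n
      = a • (freeState S Z x t ω + (e * u) • n) + b • (freeState S Z y t ω + (e * v) • n) := by
  rw [freeState_combo S Z x y hab]
  module

/-- The integrand is jointly convex in the initial state and the control. -/
theorem runCost_combo_le (h : IsReducedProblem P S Z G ρ lam n c κ₁ κ₂ C) (x y : H) {a b : ℝ}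
    (ha : 0 ≤ a) (hb : 0 ≤ b) (hab : a + b = 1) (u v : ℝ) (p : Ω × ℝ≥0) :
    runCost S Z G ρ lam n κ₂ (a • x + b • y) (a * u + b * v) p
      ≤ a * runCost S Z G ρ lam n κ₂ x u p + b * runCost S Z G ρ lam n κ₂ y v p := by
  unfold runCost
  rw [state_combo S Z n x y hab]
  have h1 := h.convex.2 (mem_univ (freeState S Z x p.2 p.1 + (Real.exp (lam * p.2) * u) • n))
    (mem_univ (freeState S Z y p.2 p.1 + (Real.exp (lam * p.2) * v) • n)) ha hb hab
  simp only [smul_eq_mul] at h1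
  have h2 := mul_le_mul_of_nonneg_left h1 (Real.exp_pos (-ρ * (p.2 : ℝ))).le
  have h3 : κ₂ = a * κ₂ + b * κ₂ := by rw [← add_mul, hab, one_mul]
  have h4 : Real.exp (-ρ * (p.2 : ℝ)) * κ₂ = Real.exp (-ρ * (p.2 : ℝ)) * (a * κ₂ + b * κ₂) :=
    congrArg _ h3
  nlinarith

end IsReducedProblem

namespace Intensity

variable {P : Measure Ω} {𝓕 : Filtration ℝ≥0 mΩ} {ρ lam : ℝ}

theorem SqIntegrable.linComb {u v : Intensity 𝓕} (hu : u.SqIntegrable P ρ lam)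
    (hv : v.SqIntegrable P ρ lam) (a b : ℝ≥0) : (u.linComb a b v).SqIntegrable P ρ lam := by
  refine (MemLp.add (MemLp.const_mul hu (a : ℝ)) (MemLp.const_mul hv (b : ℝ))).ae_eq
    (ae_of_all _ fun p => ?_)
  change (a : ℝ) * (_ * _) + b * (_ * _) = _ * ((a * u.val p.2 p.1 + b * v.val p.2 p.1 : ℝ≥0) : ℝ)
  push_cast
  ring

theorem sqIntegrable_zero : (Intensity.zero 𝓕).SqIntegrable P ρ lam := by
  refine MemLp.zero.ae_eq (ae_of_all _ fun p => ?_)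
  change (0 : ℝ) = _ * ((0 : ℝ≥0) : ℝ)
  simp

theorem SqIntegrable.mono {u v : Intensity 𝓕} (hu : u.SqIntegrable P ρ lam)
    (h : ∀ t ω, v.val t ω ≤ u.val t ω) : v.SqIntegrable P ρ lam := by
  refine MemLp.mono hu ((Measurable.aestronglyMeasurable (by fun_prop)).mul v.aestronglyMeasurable)
    (ae_of_all _ fun p => ?_)
  rw [Real.norm_of_nonneg (by positivity), Real.norm_of_nonneg (by positivity)]
  gcongr
  exact h _ _

end Intensity

end SingularControl

namespace SingularControl

/-! ### Existence and uniqueness of minimisers -/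

variable {Ω H : Type*} {mΩ : MeasurableSpace Ω} [NormedAddCommGroup H] [InnerProductSpace ℝ H]

namespace IsReducedProblem

variable {P : Measure Ω} {𝓕 : Filtration ℝ≥0 mΩ} {S : ℝ≥0 → H →L[ℝ] H} {Z : ℝ≥0 → Ω → H}
  {G : H → ℝ} {ρ lam : ℝ} {n : H} {c κ₁ κ₂ C : ℝ}

theorem redCostReal_le_iff [IsProbabilityMeasure P]
    (h : IsReducedProblem P S Z G ρ lam n c κ₁ κ₂ C) (x : H) {u v : Intensity 𝓕}
    (hu : u.SqIntegrable P ρ lam) (hv : v.SqIntegrable P ρ lam) :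
    redCost P S Z G ρ lam n κ₂ x u ≤ redCost P S Z G ρ lam n κ₂ x v ↔
      redCostReal P S Z G ρ lam n κ₂ x u ≤ redCostReal P S Z G ρ lam n κ₂ x v := by
  rw [h.redCost_eq_ofReal x hu, h.redCost_eq_ofReal x hv,
    ENNReal.ofReal_le_ofReal_iff (h.redCostReal_nonneg x v)]

theorem redCostReal_combo_le [IsProbabilityMeasure P]
    (h : IsReducedProblem P S Z G ρ lam n c κ₁ κ₂ C) (x y : H) {a b : ℝ≥0} (hab : a + b = 1)
    {u v : Intensity 𝓕} (hu : u.SqIntegrable P ρ lam) (hv : v.SqIntegrable P ρ lam) :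
    redCostReal P S Z G ρ lam n κ₂ ((a : ℝ) • x + (b : ℝ) • y) (u.linComb a b v)
      ≤ a * redCostReal P S Z G ρ lam n κ₂ x u + b * redCostReal P S Z G ρ lam n κ₂ y v := by
  have hab' : (a : ℝ) + b = 1 := by exact_mod_cast hab
  unfold redCostReal
  rw [← integral_const_mul, ← integral_const_mul,
    ← integral_add ((h.integrable_runCost x hu).const_mul _)
      ((h.integrable_runCost y hv).const_mul _)]
  refine integral_mono (h.integrable_runCost _ (hu.linComb hv a b))
    (((h.integrable_runCost x hu).const_mul _).add ((h.integrable_runCost y hv).const_mul _))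
    fun p => ?_
  have := h.runCost_combo_le x y a.2 b.2 hab' (u.val p.2 p.1) (v.val p.2 p.1) p
  change runCost S Z G ρ lam n κ₂ _ ((a * u.val p.2 p.1 + b * v.val p.2 p.1 : ℝ≥0) : ℝ) p ≤ _
  push_cast
  exact this

/-- The cost is lower semicontinuous for almost everywhere convergence, by Fatou's lemma. -/
theorem redCost_le_of_tendsto (h : IsReducedProblem P S Z G ρ lam n c κ₁ κ₂ C) (x : H)
    {u : ℕ → Intensity 𝓕} {v : Intensity 𝓕}
    (huv : ∀ᵐ p ∂P.prod timeMeasure,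
      Tendsto (fun k => ((u k).val p.2 p.1 : ℝ)) atTop (𝓝 (v.val p.2 p.1)))
    {m : ℕ → ℝ≥0∞} {M : ℝ≥0∞} (hm : Tendsto m atTop (𝓝 M))
    (hle : ∀ k, redCost P S Z G ρ lam n κ₂ x (u k) ≤ m k) :
    redCost P S Z G ρ lam n κ₂ x v ≤ M := by
  have hcont : ∀ p : Ω × ℝ≥0, Continuous fun r : ℝ =>
      ENNReal.ofReal (runCost S Z G ρ lam n κ₂ x r p) := fun p => by
    have := h.continuous
    unfold runCost
    exact ENNReal.continuous_ofReal.comp (by fun_prop)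
  calc redCost P S Z G ρ lam n κ₂ x v
      = ∫⁻ p, liminf (fun k => ENNReal.ofReal
          (runCost S Z G ρ lam n κ₂ x ((u k).val p.2 p.1) p)) atTop ∂P.prod timeMeasure := by
        refine lintegral_congr_ae ?_
        filter_upwards [huv] with p hp
        exact ((((hcont p).tendsto _).comp hp).liminf_eq).symm
    _ ≤ liminf (fun k => redCost P S Z G ρ lam n κ₂ x (u k)) atTop :=
        lintegral_liminf_le' fun k =>
          (h.aestronglyMeasurable_runCost x (u k)).aemeasurable.ennreal_ofReal
    _ ≤ liminf m atTop := liminf_le_liminf (Eventually.of_forall hle)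
    _ = M := hm.liminf_eq

/-- The reduced cost attains its minimum. Almost minimal elements of minimal norm in a weighted
`L²` space form a Cauchy sequence, whose limit is again an intensity. -/
theorem exists_minimizer [IsProbabilityMeasure P]
    (h : IsReducedProblem P S Z G ρ lam n c κ₁ κ₂ C) (h𝓕 : UsualConditions P 𝓕) (x : H) :
    ∃ u : Intensity 𝓕, u.SqIntegrable P ρ lam ∧
      ∀ v : Intensity 𝓕, redCost P S Z G ρ lam n κ₂ x u ≤ redCost P S Z G ρ lam n κ₂ x v := by
  set J : Intensity 𝓕 → ℝ≥0∞ := redCost P S Z G ρ lam n κ₂ x with hJ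
  set m : ℝ≥0∞ := ⨅ u, J u with hm
  have hmtop : m ≠ ∞ := ne_top_of_le_ne_top (b := J (Intensity.zero 𝓕))
    (by rw [hJ, h.redCost_eq_ofReal x Intensity.sqIntegrable_zero]; exact ENNReal.ofReal_ne_top)
    (iInf_le _ _)
  set ε : ℕ → ℝ≥0∞ := fun k => ENNReal.ofReal (1 / ((k : ℝ) + 1)) with hε
  have hε0 : ∀ k, ε k ≠ 0 := fun k => by
    rw [hε, Ne, ENNReal.ofReal_eq_zero, not_le]; positivity
  have hεtop : ∀ k, ε k ≠ ∞ := fun k => ENNReal.ofReal_ne_top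
  have hεanti : Antitone ε := fun a b hab => ENNReal.ofReal_le_ofReal (by gcongr)
  have hfin : ∀ {k} {u : Intensity 𝓕}, J u ≤ m + ε k → u.SqIntegrable P ρ lam := fun {k u} hu =>
    h.sqIntegrable_of_redCost_ne_top x
      (ne_top_of_le_ne_top (ENNReal.add_ne_top.2 ⟨hmtop, hεtop k⟩) hu)
  -- the weighted controls of cost at most `m + ε k`, as convex subsets of `L²`
  let D : ℕ → Set (Lp ℝ 2 (P.prod timeMeasure)) := fun k =>
    {f | ∃ (u : Intensity 𝓕) (hu : u.SqIntegrable P ρ lam), J u ≤ m + ε k ∧ MemLp.toLp _ hu = f}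
  have hanti : Antitone D := by
    rintro a b hab f ⟨u, hu, hle, rfl⟩
    exact ⟨u, hu, hle.trans (add_le_add_right (hεanti hab) m), rfl⟩
  have hconv : ∀ k, Convex ℝ (D k) := by
    rintro k f ⟨u, hu, hul, rfl⟩ g ⟨v, hv, hvl, rfl⟩ a b ha hb hab
    lift a to ℝ≥0 using ha
    lift b to ℝ≥0 using hb
    have hab' : a + b = 1 := by exact_mod_cast hab
    refine ⟨u.linComb a b v, hu.linComb hv a b, ?_, ?_⟩
    · have h1 := h.redCostReal_combo_le x x hab' hu hv
      rw [← add_smul, hab, one_smul] at h1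
      have h2 : J (u.linComb a b v) ≤ a * J u + b * J v := by
        rw [hJ, h.redCost_eq_ofReal x (hu.linComb hv a b), h.redCost_eq_ofReal x hu,
          h.redCost_eq_ofReal x hv, ← ENNReal.ofReal_coe_nnreal, ← ENNReal.ofReal_coe_nnreal,
          ← ENNReal.ofReal_mul a.coe_nonneg, ← ENNReal.ofReal_mul b.coe_nonneg,
          ← ENNReal.ofReal_add (mul_nonneg a.coe_nonneg (h.redCostReal_nonneg x u))
            (mul_nonneg b.coe_nonneg (h.redCostReal_nonneg x v))]
        exact ENNReal.ofReal_le_ofReal h1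
      calc J (u.linComb a b v) ≤ a * J u + b * J v := h2
        _ ≤ a * (m + ε k) + b * (m + ε k) := by gcongr
        _ = m + ε k := by
          rw [← add_mul, ← ENNReal.coe_add, hab', ENNReal.coe_one, one_mul]
    · refine Lp.ext ?_
      filter_upwards [MemLp.coeFn_toLp (hu.linComb hv a b), MemLp.coeFn_toLp hu,
        MemLp.coeFn_toLp hv, Lp.coeFn_add ((a : ℝ) • MemLp.toLp _ hu) ((b : ℝ) • MemLp.toLp _ hv),
        Lp.coeFn_smul (a : ℝ) (MemLp.toLp _ hu), Lp.coeFn_smul (b : ℝ) (MemLp.toLp _ hv)]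
        with p h1 h2 h3 h4 h5 h6
      rw [h4, Pi.add_apply, h5, h6, Pi.smul_apply, Pi.smul_apply, h2, h3]
      refine h1.trans ?_
      change _ * ((a * u.val p.2 p.1 + b * v.val p.2 p.1 : ℝ≥0) : ℝ)
        = (a : ℝ) * (_ * _) + b * (_ * _)
      push_cast
      ring
  have hne : ∀ k, (D k).Nonempty := fun k => by
    obtain ⟨u, hu⟩ := iInf_lt_iff.1 (ENNReal.lt_add_right hmtop (hε0 k))
    exact ⟨_, u, hfin hu.le, hu.le, rfl⟩
  have hbd : ∃ R : ℝ, ∀ f ∈ D 0, ‖f‖ ≤ R := by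
    refine ⟨√(2 / (κ₁ * ‖n‖ ^ 2) * (m + ε 0).toReal
        + 2 / ‖n‖ ^ 2 * ∫ p : Ω × ℝ≥0, Real.exp (-ρ * p.2) * ‖freeState S Z x p.2 p.1‖ ^ 2
          ∂P.prod timeMeasure), ?_⟩
    rintro f ⟨u, hu, hul, rfl⟩
    refine Real.le_sqrt_of_sq_le ?_
    have hnorm : ‖MemLp.toLp _ hu‖ ^ 2 = ∫ p : Ω × ℝ≥0,
        (Real.exp (-(ρ / 2 - lam) * p.2) * (u.val p.2 p.1 : ℝ)) ^ 2 ∂P.prod timeMeasure := by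
      rw [← real_inner_self_eq_norm_sq, L2.inner_def]
      refine integral_congr_ae ?_
      filter_upwards [MemLp.coeFn_toLp hu] with ω hω
      rw [hω, real_inner_self_eq_norm_sq, Real.norm_eq_abs, sq_abs]
    rw [hnorm]
    refine (h.integral_sq_le x hu).trans ?_
    have hle : redCostReal P S Z G ρ lam n κ₂ x u ≤ (m + ε 0).toReal := by
      rw [← ENNReal.ofReal_le_iff_le_toReal (ENNReal.add_ne_top.2 ⟨hmtop, hεtop 0⟩),
        ← h.redCost_eq_ofReal x hu]
      exact hul
    have hk := h.k1_pos
    gcongr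
  obtain ⟨R, hR⟩ := hbd
  obtain ⟨f, hfD, hcauchy⟩ := exists_cauchySeq_of_antitone_convex hanti hconv hne hR
  choose u hu hul huf using hfD
  obtain ⟨g, hg⟩ := cauchySeq_tendsto_of_complete hcauchy
  have hmeas : TendstoInMeasure (P.prod timeMeasure) (fun k => ⇑(f k)) atTop g := by
    refine tendstoInMeasure_of_tendsto_eLpNorm two_ne_zero
      (fun k => (Lp.aestronglyMeasurable (f k))) (Lp.aestronglyMeasurable g) ?_
    exact (Lp.tendsto_Lp_iff_tendsto_eLpNorm' f g).1 hg
  obtain ⟨ns, hns, hae⟩ := hmeas.exists_seq_tendsto_ae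
  have hcoe : ∀ᵐ p ∂P.prod timeMeasure, ∀ k, f k p
      = Real.exp (-(ρ / 2 - lam) * p.2) * ((u k).val p.2 p.1 : ℝ) := by
    rw [ae_all_iff]; intro k
    rw [← huf k]
    exact MemLp.coeFn_toLp (hu k)
  have hlim : ∀ᵐ p ∂P.prod timeMeasure, Tendsto (fun k => ((u (ns k)).val p.2 p.1 : ℝ)) atTop
      (𝓝 (Real.exp ((ρ / 2 - lam) * p.2) * g p)) := by
    filter_upwards [hae, hcoe] with p h1 h2
    refine (h1.const_mul (Real.exp ((ρ / 2 - lam) * p.2))).congr fun k => ?_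
    rw [h2, ← mul_assoc, ← Real.exp_add, neg_mul, add_neg_cancel, Real.exp_zero, one_mul]
  obtain ⟨v, hv⟩ := exists_intensity_of_tendsto h𝓕 hlim
  have hεlim : Tendsto (fun k => m + ε (ns k)) atTop (𝓝 m) := by
    have h1 : Tendsto ε atTop (𝓝 0) := by
      have := (ENNReal.continuous_ofReal.tendsto 0).comp
        (tendsto_one_div_add_atTop_nhds_zero_nat (𝕜 := ℝ))
      rwa [ENNReal.ofReal_zero] at this
    simpa using (h1.comp hns.tendsto_atTop).const_add m
  have hvle : J v ≤ m := by
    refine h.redCost_le_of_tendsto x (u := fun k => u (ns k)) ?_ hεlim fun k => hul (ns k)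
    filter_upwards [hlim, hv] with p h1 h2
    rw [h2]; exact h1
  exact ⟨v, h.sqIntegrable_of_redCost_ne_top x (ne_top_of_le_ne_top hmtop hvle),
    fun w => hvle.trans (iInf_le _ w)⟩

/-- If `G` is strictly convex, minimisers of the reduced cost are indistinguishable: the midpoint of
two minimisers would have a smaller cost. -/
theorem minimizer_unique [IsProbabilityMeasure P]
    (h : IsReducedProblem P S Z G ρ lam n c κ₁ κ₂ C) (hG : StrictConvexOn ℝ univ G) (x : H)
    {u v : Intensity 𝓕} (hu : u.SqIntegrable P ρ lam) (hv : v.SqIntegrable P ρ lam)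
    (humin : ∀ w : Intensity 𝓕, w.SqIntegrable P ρ lam →
      redCostReal P S Z G ρ lam n κ₂ x u ≤ redCostReal P S Z G ρ lam n κ₂ x w)
    (huv : redCostReal P S Z G ρ lam n κ₂ x u = redCostReal P S Z G ρ lam n κ₂ x v) :
    ∀ᵐ ω ∂P, ∀ t, u.val t ω = v.val t ω := by
  set w : Intensity 𝓕 := u.linComb (1 / 2) (1 / 2) v with hw
  have hwI : w.SqIntegrable P ρ lam := hu.linComb hv _ _
  have hval : ∀ p : Ω × ℝ≥0,
      (w.val p.2 p.1 : ℝ) = 1 / 2 * u.val p.2 p.1 + 1 / 2 * v.val p.2 p.1 := fun p => by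
    change ((1 / 2 * u.val p.2 p.1 + 1 / 2 * v.val p.2 p.1 : ℝ≥0) : ℝ) = _
    push_cast
    rfl
  have hx : (1 / 2 : ℝ) • x + (1 / 2 : ℝ) • x = x := by rw [← add_smul]; norm_num
  have hle : ∀ p : Ω × ℝ≥0, runCost S Z G ρ lam n κ₂ x (w.val p.2 p.1) p
      ≤ 1 / 2 * runCost S Z G ρ lam n κ₂ x (u.val p.2 p.1) p
        + 1 / 2 * runCost S Z G ρ lam n κ₂ x (v.val p.2 p.1) p := fun p => by
    have := h.runCost_combo_le x x (a := 1 / 2) (b := 1 / 2) (by norm_num) (by norm_num)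
      (by norm_num) (u.val p.2 p.1) (v.val p.2 p.1) p
    rwa [hx, ← hval] at this
  have hI1 := h.integrable_runCost x hu
  have hI2 := h.integrable_runCost x hv
  have hI3 := h.integrable_runCost x hwI
  have hIg : Integrable (fun p => 1 / 2 * runCost S Z G ρ lam n κ₂ x (u.val p.2 p.1) p
      + 1 / 2 * runCost S Z G ρ lam n κ₂ x (v.val p.2 p.1) p) (P.prod timeMeasure) :=
    (hI1.const_mul _).add (hI2.const_mul _)
  have hint : ∫ p, ((1 / 2 * runCost S Z G ρ lam n κ₂ x (u.val p.2 p.1) p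
      + 1 / 2 * runCost S Z G ρ lam n κ₂ x (v.val p.2 p.1) p)
      - runCost S Z G ρ lam n κ₂ x (w.val p.2 p.1) p) ∂P.prod timeMeasure = 0 := by
    refine le_antisymm ?_ (integral_nonneg fun p => sub_nonneg.2 (hle p))
    rw [integral_sub hIg hI3, integral_add (hI1.const_mul _) (hI2.const_mul _),
      integral_const_mul, integral_const_mul]
    have h1 := humin w hwI
    unfold redCostReal at h1 huv
    linarith
  have hae := (integral_eq_zero_iff_of_nonneg (fun p => sub_nonneg.2 (hle p)) (hIg.sub hI3)).1 hint
  refine Intensity.indistinguishable_of_ae_eq ?_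
  filter_upwards [hae] with p hp
  by_contra hne
  have hne' : freeState S Z x p.2 p.1 + (Real.exp (lam * p.2) * (u.val p.2 p.1 : ℝ)) • n
      ≠ freeState S Z x p.2 p.1 + (Real.exp (lam * p.2) * (v.val p.2 p.1 : ℝ)) • n := by
    intro heq
    have h1 := smul_left_injective ℝ h.ne_zero (add_left_cancel heq)
    exact hne (NNReal.coe_injective (mul_left_cancel₀ (Real.exp_pos _).ne' h1))
  have h1 := hG.2 (mem_univ _) (mem_univ _) hne' (by norm_num : (0 : ℝ) < 1 / 2)
    (by norm_num : (0 : ℝ) < 1 / 2) (by norm_num)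
  have h2 := state_combo S Z n x x (a := 1 / 2) (b := 1 / 2) (by norm_num)
    (Real.exp (lam * p.2)) (u.val p.2 p.1) (v.val p.2 p.1) p.2 p.1
  rw [hx, ← hval] at h2
  rw [← h2] at h1
  have h3 := mul_lt_mul_of_pos_left h1 (Real.exp_pos (-ρ * (p.2 : ℝ)))
  simp only [Pi.zero_apply, runCost, smul_eq_mul] at hp h3
  have h4 := hval p
  have h5 : (ρ - lam) * Real.exp (-(ρ - lam) * p.2) * (w.val p.2 p.1 : ℝ)
      = (ρ - lam) * Real.exp (-(ρ - lam) * p.2)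
        * (1 / 2 * u.val p.2 p.1 + 1 / 2 * v.val p.2 p.1) := by rw [h4]
  nlinarith

end IsReducedProblem

end SingularControl

namespace SingularControl

/-! ### Directional derivatives of convex functions -/

section DirDeriv

variable {H : Type*} [NormedAddCommGroup H] [InnerProductSpace ℝ H]

/-- The derivative of a differentiable convex function is a subgradient. -/
theorem fderiv_le_sub_of_convexOn {G : H → ℝ} (hG : ConvexOn ℝ univ G) (hd : Differentiable ℝ G)
    (x y : H) : fderiv ℝ G x (y - x) ≤ G y - G x := by
  obtain ⟨p, hp⟩ := exists_subgradient hG hd.continuous x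
  have hmin : IsLocalMin (fun z => G z - p z) x := Eventually.of_forall fun z => by
    have := hp z
    rw [map_sub] at this
    linarith
  have h0 := hmin.hasFDerivAt_eq_zero ((hd x).hasFDerivAt.sub p.hasFDerivAt)
  rw [sub_eq_zero.1 h0]
  linarith [hp y]

variable [CompleteSpace H]

theorem dirDeriv_eq_fderiv (F : H → ℝ) (n x : H) :
    dirDeriv F n x = fderiv ℝ F x n := by
  rw [dirDeriv, gradient, InnerProductSpace.toDual_symm_apply]

theorem smul_dirDeriv_le {G : H → ℝ} (hG : ConvexOn ℝ univ G) (hd : Differentiable ℝ G)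
    (n x : H) (a : ℝ) : a * dirDeriv G n x ≤ G (x + a • n) - G x := by
  have := fderiv_le_sub_of_convexOn hG hd x (x + a • n)
  rw [add_sub_cancel_left, map_smul, smul_eq_mul, ← dirDeriv_eq_fderiv] at this
  exact this

theorem dirDeriv_le_dirDeriv_add {G : H → ℝ} (hG : ConvexOn ℝ univ G) (hd : Differentiable ℝ G)
    (n x : H) {a : ℝ} (ha : 0 ≤ a) : dirDeriv G n x ≤ dirDeriv G n (x + a • n) := by
  rcases ha.eq_or_lt with rfl | ha
  · simp
  · have h1 := smul_dirDeriv_le hG hd n x a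
    have h2 := smul_dirDeriv_le hG hd n (x + a • n) (-a)
    rw [neg_smul, add_neg_cancel_right] at h2
    exact le_of_mul_le_mul_left (by linarith) ha

theorem tendsto_dirDeriv {F : H → ℝ} (hF : Differentiable ℝ F) (n x : H) {a : ℕ → ℝ}
    (ha0 : ∀ k, a k ≠ 0) (ha : Tendsto a atTop (𝓝 0)) :
    Tendsto (fun k => (F (x + a k • n) - F x) / a k) atTop (𝓝 (dirDeriv F n x)) := by
  have h1 : HasDerivAt (fun s : ℝ => F (x + s • n)) (fderiv ℝ F x n) 0 := by
    have h2 : HasDerivAt (fun s : ℝ => x + s • n) n 0 := by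
      simpa using ((hasDerivAt_id (0 : ℝ)).smul_const n).const_add x
    have h3 : HasFDerivAt F (fderiv ℝ F x) (x + (0 : ℝ) • n) := by
      simpa using (hF x).hasFDerivAt
    exact h3.comp_hasDerivAt 0 h2
  rw [dirDeriv_eq_fderiv]
  have h4 := (hasDerivAt_iff_tendsto_slope_zero.1 h1).comp
    (tendsto_nhdsWithin_iff.2 ⟨ha, Eventually.of_forall ha0⟩)
  refine h4.congr fun k => ?_
  simp [div_eq_inv_mul]

end DirDeriv

/-! ### The value function and the optimal stopping problem -/

variable {Ω H : Type*} {mΩ : MeasurableSpace Ω} [NormedAddCommGroup H] [InnerProductSpace ℝ H]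

/-- `F` is the minimum of the reduced cost, as a function of the initial state. -/
def IsReducedValue (P : Measure Ω) (𝓕 : Filtration ℝ≥0 mΩ) (S : ℝ≥0 → H →L[ℝ] H)
    (Z : ℝ≥0 → Ω → H) (G : H → ℝ) (ρ lam : ℝ) (n : H) (κ₂ : ℝ) (F : H → ℝ) : Prop :=
  ∀ x, (∃ u : Intensity 𝓕, u.SqIntegrable P ρ lam ∧ F x = redCostReal P S Z G ρ lam n κ₂ x u) ∧
    ∀ u : Intensity 𝓕, u.SqIntegrable P ρ lam → F x ≤ redCostReal P S Z G ρ lam n κ₂ x u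

/-- The derivative, at the uncontrolled state, of the integrand of the reduced cost with respect to
the control. -/
noncomputable def marginalRate [CompleteSpace H] (S : ℝ≥0 → H →L[ℝ] H) (Z : ℝ≥0 → Ω → H)
    (G : H → ℝ) (ρ lam : ℝ) (n x : H) (p : Ω × ℝ≥0) : ℝ :=
  Real.exp (-(ρ - lam) * p.2) * dirDeriv G n (freeState S Z x p.2 p.1)
    + (ρ - lam) * Real.exp (-(ρ - lam) * p.2)

namespace IsReducedProblem

variable {P : Measure Ω} {𝓕 : Filtration ℝ≥0 mΩ} {S : ℝ≥0 → H →L[ℝ] H} {Z : ℝ≥0 → Ω → H}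
  {G : H → ℝ} {ρ lam : ℝ} {n : H} {c κ₁ κ₂ C : ℝ} {F : H → ℝ}

theorem convexOn_value [IsProbabilityMeasure P]
    (h : IsReducedProblem P S Z G ρ lam n c κ₁ κ₂ C)
    (hF : IsReducedValue P 𝓕 S Z G ρ lam n κ₂ F) : ConvexOn ℝ univ F := by
  refine ⟨convex_univ, fun x _ y _ a b ha hb hab => ?_⟩
  lift a to ℝ≥0 using ha
  lift b to ℝ≥0 using hb
  obtain ⟨u, hu, hxu⟩ := (hF x).1
  obtain ⟨v, hv, hyv⟩ := (hF y).1
  rw [hxu, hyv]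
  exact ((hF _).2 _ (hu.linComb hv a b)).trans
    (h.redCostReal_combo_le x y (by exact_mod_cast hab) hu hv)

/-- Quadratic growth of the value, by comparison with the control which never acts. -/
theorem exists_value_le [IsProbabilityMeasure P]
    (h : IsReducedProblem P S Z G ρ lam n c κ₁ κ₂ C)
    (hF : IsReducedValue P 𝓕 S Z G ρ lam n κ₂ F) : ∃ M, ∀ x, F x ≤ M * (1 + ‖x‖ ^ 2) := by
  set I₁ : ℝ := ∫ p : Ω × ℝ≥0, Real.exp (-ρ * p.2) ∂P.prod timeMeasure with hI₁
  set I₂ : ℝ := ∫ p : Ω × ℝ≥0, Real.exp (-ρ * p.2) * ‖freeState S Z 0 p.2 p.1‖ ^ 2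
    ∂P.prod timeMeasure with hI₂
  have h1 : 0 ≤ I₁ := integral_nonneg fun _ => (Real.exp_pos _).le
  have h2 : 0 ≤ I₂ := integral_nonneg fun _ => by positivity
  have hc := h.c_pos
  have hκ := h.k2_pos
  refine ⟨(c + κ₂ + 2 * c) * I₁ + 2 * c * I₂, fun x => ?_⟩
  have hle : F x ≤ (c + κ₂ + 2 * c * ‖x‖ ^ 2) * I₁ + 2 * c * I₂ := by
    refine ((hF x).2 _ Intensity.sqIntegrable_zero).trans ?_
    have hi1 := (integrable_exp_prod (P := P) h.rho_pos).const_mul (c + κ₂ + 2 * c * ‖x‖ ^ 2)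
    have hi2 := (h.int_sq ρ h.rho_pos 0).const_mul (2 * c)
    rw [hI₁, hI₂, ← integral_const_mul, ← integral_const_mul, ← integral_add hi1 hi2]
    refine integral_mono (h.integrable_runCost x Intensity.sqIntegrable_zero) (hi1.add hi2)
      fun p => ?_
    change Real.exp (-ρ * p.2) * (G (freeState S Z x p.2 p.1
      + (Real.exp (lam * p.2) * ((0 : ℝ≥0) : ℝ)) • n) + κ₂)
      + (ρ - lam) * Real.exp (-(ρ - lam) * p.2) * ((0 : ℝ≥0) : ℝ) ≤
      (c + κ₂ + 2 * c * ‖x‖ ^ 2) * Real.exp (-ρ * p.2)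
        + 2 * c * (Real.exp (-ρ * p.2) * ‖freeState S Z 0 p.2 p.1‖ ^ 2)
    rw [NNReal.coe_zero, mul_zero, mul_zero, zero_smul, add_zero, add_zero]
    have h3 : freeState S Z x p.2 p.1 = S p.2 x + freeState S Z 0 p.2 p.1 := by
      simp [freeState]
    have h4 : ‖freeState S Z x p.2 p.1‖ ≤ ‖x‖ + ‖freeState S Z 0 p.2 p.1‖ := by
      rw [h3]
      exact (norm_add_le _ _).trans (add_le_add_left (h.norm_le _ _) _)
    have h5 : ‖freeState S Z x p.2 p.1‖ ^ 2
        ≤ 2 * ‖x‖ ^ 2 + 2 * ‖freeState S Z 0 p.2 p.1‖ ^ 2 := by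
      nlinarith [norm_nonneg (freeState S Z x p.2 p.1),
        sq_nonneg (‖x‖ - ‖freeState S Z 0 p.2 p.1‖)]
    have h6 : G (freeState S Z x p.2 p.1)
        ≤ c * (1 + (2 * ‖x‖ ^ 2 + 2 * ‖freeState S Z 0 p.2 p.1‖ ^ 2)) :=
      (h.upper _).trans (by gcongr)
    nlinarith [mul_le_mul_of_nonneg_left h6 (Real.exp_pos (-ρ * (p.2 : ℝ))).le]
  refine hle.trans ?_
  have h7 : 0 ≤ ((c + κ₂) * I₁ + 2 * c * I₂) * ‖x‖ ^ 2 := by positivity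
  have h8 : 0 ≤ 2 * c * I₁ := by positivity
  linarith

/-- Semiconcavity of the value: the optimal control for `x` is used from `x + z` and `x - z`. -/
theorem exists_value_semiconcave [IsProbabilityMeasure P]
    (h : IsReducedProblem P S Z G ρ lam n c κ₁ κ₂ C)
    (hF : IsReducedValue P 𝓕 S Z G ρ lam n κ₂ F) :
    ∃ M, ∀ x z, F (x + z) + F (x - z) - 2 * F x ≤ M * ‖z‖ ^ 2 := by
  refine ⟨C * ∫ p : Ω × ℝ≥0, Real.exp (-ρ * p.2) ∂P.prod timeMeasure, fun x z => ?_⟩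
  obtain ⟨u, hu, hxu⟩ := (hF x).1
  have h1 := (hF (x + z)).2 u hu
  have h2 := (hF (x - z)).2 u hu
  have hi0 := h.integrable_runCost x hu
  have hi1 := h.integrable_runCost (x + z) hu
  have hi2 := h.integrable_runCost (x - z) hu
  have hi12 : Integrable (fun p => runCost S Z G ρ lam n κ₂ (x + z) (u.val p.2 p.1) p
    + runCost S Z G ρ lam n κ₂ (x - z) (u.val p.2 p.1) p) (P.prod timeMeasure) := hi1.add hi2
  have key : ∫ p, (runCost S Z G ρ lam n κ₂ (x + z) (u.val p.2 p.1) p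
      + runCost S Z G ρ lam n κ₂ (x - z) (u.val p.2 p.1) p
      - 2 * runCost S Z G ρ lam n κ₂ x (u.val p.2 p.1) p) ∂P.prod timeMeasure
      ≤ ∫ p : Ω × ℝ≥0, C * ‖z‖ ^ 2 * Real.exp (-ρ * p.2) ∂P.prod timeMeasure := by
    refine integral_mono (hi12.sub (hi0.const_mul 2))
      ((integrable_exp_prod h.rho_pos).const_mul _) fun p => ?_
    unfold runCost
    set w := (Real.exp (lam * p.2) * (u.val p.2 p.1 : ℝ)) • n
    have e1 : freeState S Z (x + z) p.2 p.1 + w = freeState S Z x p.2 p.1 + w + S p.2 z := by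
      simp only [freeState, map_add]; abel
    have e2 : freeState S Z (x - z) p.2 p.1 + w = freeState S Z x p.2 p.1 + w - S p.2 z := by
      simp only [freeState, map_sub]; abel
    rw [e1, e2]
    have h3 := h.semiconcave (freeState S Z x p.2 p.1 + w) (S p.2 z)
    have h4 : ‖S p.2 z‖ ^ 2 ≤ ‖z‖ ^ 2 := pow_le_pow_left₀ (norm_nonneg _) (h.norm_le _ _) 2
    have h5 := h3.trans (mul_le_mul_of_nonneg_left h4 h.C_pos.le)
    nlinarith [mul_le_mul_of_nonneg_left h5 (Real.exp_pos (-ρ * (p.2 : ℝ))).le]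
  rw [integral_sub hi12 (hi0.const_mul 2), integral_add hi1 hi2, integral_const_mul,
    integral_const_mul] at key
  unfold redCostReal at hxu h1 h2
  rw [hxu]
  linarith

theorem differentiable_value [IsProbabilityMeasure P]
    (h : IsReducedProblem P S Z G ρ lam n c κ₁ κ₂ C)
    (hF : IsReducedValue P 𝓕 S Z G ρ lam n κ₂ F) : Differentiable ℝ F := by
  obtain ⟨M, hM⟩ := h.exists_value_le hF
  obtain ⟨M', hM'⟩ := h.exists_value_semiconcave hF
  exact differentiable_of_convexOn_of_semiconcave (h.convexOn_value hF) hM hM'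

variable [CompleteSpace H]

theorem abs_dirDeriv_le (h : IsReducedProblem P S Z G ρ lam n c κ₁ κ₂ C) (x : H) :
    |dirDeriv G n x| ≤ 2 * c * (1 + 2 * ‖x‖ ^ 2 + 2 * ‖n‖ ^ 2) + 2 * κ₂ := by
  have hc := h.c_pos
  have hκ := h.k2_pos
  have h1 := smul_dirDeriv_le h.convex h.differentiable n x 1
  have h2 := smul_dirDeriv_le h.convex h.differentiable n x (-1)
  rw [one_smul, one_mul] at h1
  rw [neg_one_smul, neg_one_mul] at h2
  have h3 : ‖x + n‖ ^ 2 ≤ 2 * ‖x‖ ^ 2 + 2 * ‖n‖ ^ 2 := by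
    nlinarith [norm_add_le x n, norm_nonneg (x + n), sq_nonneg (‖x‖ - ‖n‖)]
  have h4 : ‖x + -n‖ ^ 2 ≤ 2 * ‖x‖ ^ 2 + 2 * ‖n‖ ^ 2 := by
    have := norm_add_le x (-n)
    rw [norm_neg] at this
    nlinarith [norm_nonneg (x + -n), sq_nonneg (‖x‖ - ‖n‖)]
  have h5 := (h.upper (x + n)).trans (mul_le_mul_of_nonneg_left (add_le_add_right h3 1) hc.le)
  have h6 := (h.upper (x + -n)).trans (mul_le_mul_of_nonneg_left (add_le_add_right h4 1) hc.le)
  have h7 := h.lower_nonneg x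
  have h8 : 0 ≤ c * (1 + (2 * ‖x‖ ^ 2 + 2 * ‖n‖ ^ 2)) := by positivity
  rw [abs_le]
  constructor <;> linarith

/-- The derivative is a limit of difference quotients along a fixed sequence. -/
theorem aestronglyMeasurable_dirDeriv (h : IsReducedProblem P S Z G ρ lam n c κ₁ κ₂ C) (x : H) :
    AEStronglyMeasurable (fun p : Ω × ℝ≥0 => dirDeriv G n (freeState S Z x p.2 p.1))
      (P.prod timeMeasure) := by
  have hlim : ∀ y, Tendsto (fun k : ℕ => (G (y + (1 / ((k : ℝ) + 1)) • n) - G y)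
      / (1 / ((k : ℝ) + 1))) atTop (𝓝 (dirDeriv G n y)) := fun y =>
    tendsto_dirDeriv h.differentiable n y (fun k => by positivity)
      tendsto_one_div_add_atTop_nhds_zero_nat
  refine aestronglyMeasurable_of_tendsto_ae atTop (f := fun (k : ℕ) (p : Ω × ℝ≥0) =>
    (G (freeState S Z x p.2 p.1 + (1 / ((k : ℝ) + 1)) • n) - G (freeState S Z x p.2 p.1))
      / (1 / ((k : ℝ) + 1))) (fun k => ?_) (ae_of_all _ fun p => hlim _)
  have hc := h.continuous
  have : Continuous fun y => (G (y + (1 / ((k : ℝ) + 1)) • n) - G y) / (1 / ((k : ℝ) + 1)) := by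
    fun_prop
  exact this.comp_aestronglyMeasurable (h.meas x)

/-- The running payoff of the stopping problem is integrable. -/
theorem integrable_dirDeriv [IsProbabilityMeasure P]
    (h : IsReducedProblem P S Z G ρ lam n c κ₁ κ₂ C) (x : H) :
    Integrable (fun p : Ω × ℝ≥0 => Real.exp (-(ρ - lam) * p.2)
      * dirDeriv G n (freeState S Z x p.2 p.1)) (P.prod timeMeasure) := by
  have hr := h.rate_pos
  refine (((integrable_exp_prod hr).const_mul (2 * c * (1 + 2 * ‖n‖ ^ 2) + 2 * κ₂)).add
    ((h.int_sq _ hr x).const_mul (4 * c))).mono'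
    ((integrable_exp_prod hr).1.mul (h.aestronglyMeasurable_dirDeriv x)) (ae_of_all _ fun p => ?_)
  rw [norm_mul, Real.norm_of_nonneg (Real.exp_pos _).le, Real.norm_eq_abs]
  refine (mul_le_mul_of_nonneg_left (h.abs_dirDeriv_le _) (Real.exp_pos _).le).trans (le_of_eq ?_)
  simp only [Pi.add_apply]
  ring

/-- The region strictly before a stopping time is jointly measurable. -/
theorem _root_.SingularControl.measurableSet_lt_stoppingTime {τ : Ω → WithTop ℝ≥0}
    (hτ : IsStoppingTime 𝓕 τ) : MeasurableSet {p : Ω × ℝ≥0 | (p.2 : WithTop ℝ≥0) < τ p.1} := by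
  obtain ⟨D, hDc, hD⟩ := TopologicalSpace.exists_countable_dense ℝ≥0
  have hset : {p : Ω × ℝ≥0 | (p.2 : WithTop ℝ≥0) < τ p.1}
      = ⋃ q ∈ D, {ω | τ ω ≤ q}ᶜ ×ˢ Iic q := by
    ext ⟨ω, t⟩
    simp only [mem_iUnion, mem_prod, mem_compl_iff, mem_Iic, exists_prop]
    constructor
    · intro hlt
      obtain ⟨s, hs1, hs2⟩ := exists_between (show (t : WithTop ℝ≥0) < τ ω from hlt)
      obtain ⟨s, rfl⟩ := WithTop.ne_top_iff_exists.1 (hs2.trans_le le_top).ne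
      obtain ⟨q, hq, hq1, hq2⟩ := hD.exists_between (WithTop.coe_lt_coe.1 hs1)
      exact ⟨q, hq, fun hle => absurd (hs2.trans_le hle)
        (not_lt.2 (WithTop.coe_le_coe.2 hq2.le)), hq1.le⟩
    · rintro ⟨q, -, h1, h2⟩
      exact lt_of_le_of_lt (WithTop.coe_le_coe.2 h2) (not_le.1 h1)
  rw [hset]
  exact MeasurableSet.biUnion hDc fun q _ => ((𝓕.le q _ (hτ q)).compl).prod measurableSet_Iic

/-- The discounted mass of `[0, τ)` is `1 - e^{-rτ}`. -/
theorem _root_.SingularControl.setIntegral_exp_lt {r : ℝ} (hr : 0 < r) (τ : WithTop ℝ≥0) :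
    ∫ t in {t : ℝ≥0 | (t : WithTop ℝ≥0) < τ}, r * Real.exp (-r * t) ∂timeMeasure
      = 1 - discount r τ := by
  have htail : ∀ s : ℝ≥0, ∫ t in Ici s, r * Real.exp (-r * t) ∂timeMeasure
      = Real.exp (-r * s) := fun s => by
    rw [integral_eq_lintegral_of_nonneg_ae (ae_of_all _ fun _ => by positivity)
      (Measurable.aestronglyMeasurable (by fun_prop)), lintegral_timeMeasure_exp hr,
      ENNReal.toReal_ofReal (Real.exp_pos _).le]
  have htot : ∫ t : ℝ≥0, r * Real.exp (-r * t) ∂timeMeasure = 1 := by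
    have := htail 0
    rwa [show Ici (0 : ℝ≥0) = univ from Ici_bot, Measure.restrict_univ, NNReal.coe_zero, mul_zero,
      Real.exp_zero] at this
  cases τ with
  | top =>
    have : {t : ℝ≥0 | (t : WithTop ℝ≥0) < ⊤} = univ :=
      eq_univ_of_forall fun t => WithTop.coe_lt_top t
    rw [this, Measure.restrict_univ, htot]
    simp [discount]
  | coe s =>
    have hset : {t : ℝ≥0 | (t : WithTop ℝ≥0) < s} = (Ici s)ᶜ := by
      ext t
      rw [mem_compl_iff, mem_Ici, not_le]
      exact WithTop.coe_lt_coe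
    have hint : Integrable (fun t : ℝ≥0 => r * Real.exp (-r * t)) timeMeasure := by
      by_contra hcon
      rw [integral_undef hcon] at htot
      exact zero_ne_one htot
    have := integral_add_compl (measurableSet_Ici (a := s)) hint
    rw [hset, eq_sub_iff_add_eq, add_comm]
    rw [htail, htot] at this
    exact this

/-- The payoff of the stopping problem as a pure running payoff, integrated over time and chance. -/
theorem integrable_stoppingPayoff [IsProbabilityMeasure P]
    (h : IsReducedProblem P S Z G ρ lam n c κ₁ κ₂ C) (x : H) {τ : Ω → WithTop ℝ≥0}
    (hτ : IsStoppingTime 𝓕 τ) :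
    Integrable (stoppingPayoff (ρ - lam) (dirDeriv G n) (freeState S Z x) τ) P ∧
    ∫ ω, stoppingPayoff (ρ - lam) (dirDeriv G n) (freeState S Z x) τ ω ∂P
      = ∫ p, {p : Ω × ℝ≥0 | (p.2 : WithTop ℝ≥0) < τ p.1}.indicator
          (marginalRate S Z G ρ lam n x) p ∂P.prod timeMeasure - 1 := by
  have hr := h.rate_pos
  have hms := measurableSet_lt_stoppingTime hτ
  have hint := h.integrable_dirDeriv x
  have hexp := (integrable_exp_prod (P := P) hr).const_mul (ρ - lam)
  have hind : Integrable ({p : Ω × ℝ≥0 | (p.2 : WithTop ℝ≥0) < τ p.1}.indicator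
      (marginalRate S Z G ρ lam n x)) (P.prod timeMeasure) := (hint.add hexp).indicator hms
  have hae : (fun ω => stoppingPayoff (ρ - lam) (dirDeriv G n) (freeState S Z x) τ ω)
      =ᵐ[P] fun ω => ∫ t, {p : Ω × ℝ≥0 | (p.2 : WithTop ℝ≥0) < τ p.1}.indicator
          (marginalRate S Z G ρ lam n x) (ω, t) ∂timeMeasure - 1 := by
    filter_upwards [hint.prod_right_ae, hexp.prod_right_ae] with ω h1 h2
    have hsω : MeasurableSet {t : ℝ≥0 | (t : WithTop ℝ≥0) < τ ω} := measurable_prodMk_left hms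
    have h3 : ∫ t, {p : Ω × ℝ≥0 | (p.2 : WithTop ℝ≥0) < τ p.1}.indicator
          (marginalRate S Z G ρ lam n x) (ω, t) ∂timeMeasure
        = ∫ t in {t : ℝ≥0 | (t : WithTop ℝ≥0) < τ ω},
          (Real.exp (-(ρ - lam) * t) * dirDeriv G n (freeState S Z x t ω)
          + (ρ - lam) * Real.exp (-(ρ - lam) * t)) ∂timeMeasure := by
      rw [← integral_indicator hsω]
      rfl
    rw [h3, integral_add h1.integrableOn h2.integrableOn, setIntegral_exp_lt hr, stoppingPayoff]
    ring
  have hinner := hind.integral_prod_left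
  refine ⟨(integrable_congr hae).2 (hinner.sub (integrable_const 1)), ?_⟩
  rw [integral_congr_ae hae, integral_sub hinner (integrable_const 1), integral_prod _ hind]
  simp

end IsReducedProblem

end SingularControl

namespace SingularControl

variable {Ω H : Type*} {mΩ : MeasurableSpace Ω} [NormedAddCommGroup H] [InnerProductSpace ℝ H]

namespace Intensity

variable {P : Measure Ω} {𝓕 : Filtration ℝ≥0 mΩ} {ρ lam : ℝ}

theorem addJump_val_of_le (u : Intensity 𝓕) (ε : ℝ≥0) {τ : Ω → WithTop ℝ≥0}
    (hτ : IsStoppingTime 𝓕 τ) {t : ℝ≥0} {ω : Ω} (h : τ ω ≤ t) :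
    (u.addJump ε hτ).val t ω = u.val t ω + ε :=
  congrArg (u.val t ω + ·) (if_pos h)

theorem addJump_val_of_lt (u : Intensity 𝓕) (ε : ℝ≥0) {τ : Ω → WithTop ℝ≥0}
    (hτ : IsStoppingTime 𝓕 τ) {t : ℝ≥0} {ω : Ω} (h : t < τ ω) :
    (u.addJump ε hτ).val t ω = u.val t ω :=
  (congrArg (u.val t ω + ·) (if_neg (not_le.2 h))).trans (add_zero _)

theorem SqIntegrable.addJump [IsProbabilityMeasure P] (hρ : 0 < ρ) (hlam : lam < 0)
    {u : Intensity 𝓕} (hu : u.SqIntegrable P ρ lam) (ε : ℝ≥0) {τ : Ω → WithTop ℝ≥0}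
    (hτ : IsStoppingTime 𝓕 τ) : (u.addJump ε hτ).SqIntegrable P ρ lam := by
  have hexp : MemLp (fun p : Ω × ℝ≥0 => Real.exp (-(ρ / 2 - lam) * p.2)) 2
      (P.prod timeMeasure) := by
    rw [memLp_two_iff_integrable_sq (Measurable.aestronglyMeasurable (by fun_prop))]
    refine (integrable_exp_prod (a := 2 * (ρ / 2 - lam)) (by linarith)).congr
      (ae_of_all _ fun p => ?_)
    change Real.exp (-(2 * (ρ / 2 - lam)) * p.2) = Real.exp (-(ρ / 2 - lam) * p.2) ^ 2
    rw [← Real.exp_nat_mul]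
    push_cast
    ring_nf
  have hsum : MemLp (fun p : Ω × ℝ≥0 => Real.exp (-(ρ / 2 - lam) * p.2) * (u.val p.2 p.1 : ℝ)
      + Real.exp (-(ρ / 2 - lam) * p.2) * (ε : ℝ)) 2 (P.prod timeMeasure) :=
    MemLp.add (f := fun p : Ω × ℝ≥0 => Real.exp (-(ρ / 2 - lam) * p.2) * (u.val p.2 p.1 : ℝ))
      (g := fun p : Ω × ℝ≥0 => Real.exp (-(ρ / 2 - lam) * p.2) * (ε : ℝ)) hu (hexp.mul_const _)
  have hmeas : AEStronglyMeasurable (fun p : Ω × ℝ≥0 => Real.exp (-(ρ / 2 - lam) * p.2)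
      * ((u.addJump ε hτ).val p.2 p.1 : ℝ)) (P.prod timeMeasure) :=
    (Measurable.aestronglyMeasurable (by fun_prop)).mul (u.addJump ε hτ).aestronglyMeasurable
  refine MemLp.mono hsum hmeas (ae_of_all _ fun p => ?_)
  have hle : (u.addJump ε hτ).val p.2 p.1 ≤ u.val p.2 p.1 + ε := by
    rcases le_or_gt (τ p.1) p.2 with h | h
    · rw [addJump_val_of_le u ε hτ h]
    · rw [addJump_val_of_lt u ε hτ h]; exact le_self_add
  rw [← mul_add, Real.norm_of_nonneg (by positivity), Real.norm_of_nonneg (by positivity)]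
  exact mul_le_mul_of_nonneg_left (by exact_mod_cast hle) (Real.exp_pos _).le

end Intensity

namespace IsReducedProblem

variable {P : Measure Ω} {𝓕 : Filtration ℝ≥0 mΩ} {S : ℝ≥0 → H →L[ℝ] H} {Z : ℝ≥0 → Ω → H}
  {G : H → ℝ} {ρ lam : ℝ} {n : H} {c κ₁ κ₂ C : ℝ} {F : H → ℝ}

/-- Moving the initial state along `n` amounts to shifting the reduced control by a constant. -/
theorem freeState_add_smul (h : IsReducedProblem P S Z G ρ lam n c κ₁ κ₂ C) (x : H) (ε : ℝ)
    (t : ℝ≥0) (ω : Ω) : freeState S Z (x + ε • n) t ω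
      = freeState S Z x t ω + (Real.exp (lam * t) * ε) • n := by
  simp only [freeState, map_add, map_smul, h.eigen]
  module

theorem runCost_add_smul (h : IsReducedProblem P S Z G ρ lam n c κ₁ κ₂ C) (x : H) (ε u : ℝ)
    (p : Ω × ℝ≥0) : runCost S Z G ρ lam n κ₂ (x + ε • n) u p
      = runCost S Z G ρ lam n κ₂ x (u + ε) p
        - (ρ - lam) * Real.exp (-(ρ - lam) * p.2) * ε := by
  unfold runCost
  rw [h.freeState_add_smul, add_assoc (freeState S Z x p.2 p.1), ← add_smul, ← mul_add, add_comm ε]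
  ring

variable [CompleteSpace H]

/-- Stopping payoffs bound the increments of the value function along `n` from below: a control for
the state `x + ε n`, with an additional jump at `τ`, is a control for the state `x`. -/
theorem payoff_le_dirDeriv [IsProbabilityMeasure P]
    (h : IsReducedProblem P S Z G ρ lam n c κ₁ κ₂ C)
    (hF : IsReducedValue P 𝓕 S Z G ρ lam n κ₂ F) (x : H) {τ : Ω → WithTop ℝ≥0}
    (hτ : IsStoppingTime 𝓕 τ) :
    ∫ ω, stoppingPayoff (ρ - lam) (dirDeriv G n) (freeState S Z x) τ ω ∂P ≤ dirDeriv F n x := by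
  have hr := h.rate_pos
  rw [(h.integrable_stoppingPayoff x hτ).2]
  set A : Set (Ω × ℝ≥0) := {p | (p.2 : WithTop ℝ≥0) < τ p.1} with hA
  have hind : Integrable (A.indicator (marginalRate S Z G ρ lam n x)) (P.prod timeMeasure) :=
    ((h.integrable_dirDeriv x).add ((integrable_exp_prod hr).const_mul _)).indicator
      (measurableSet_lt_stoppingTime hτ)
  have hexp := (integrable_exp_prod (P := P) hr).const_mul (ρ - lam)
  have key : ∀ ε : ℝ≥0, 0 < ε →
      ε * (∫ p, A.indicator (marginalRate S Z G ρ lam n x) p ∂P.prod timeMeasure - 1)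
        ≤ F (x + (ε : ℝ) • n) - F x := by
    intro ε hε
    obtain ⟨u, hu, hxu⟩ := (hF (x + (ε : ℝ) • n)).1
    have hu' := hu.addJump h.rho_pos h.lam_neg ε hτ
    have h1 := (hF x).2 _ hu'
    have hi1 := h.integrable_runCost (x + (ε : ℝ) • n) hu
    have hi2 := h.integrable_runCost x hu'
    have h2 : ε * (∫ p, A.indicator (marginalRate S Z G ρ lam n x) p ∂P.prod timeMeasure - 1)
        = ∫ p, ε * (A.indicator (marginalRate S Z G ρ lam n x) p
          - (ρ - lam) * Real.exp (-(ρ - lam) * p.2)) ∂P.prod timeMeasure := by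
      rw [integral_const_mul, integral_sub hind hexp, integral_exp_prod hr]
    have h3 : ∫ p, ε * (A.indicator (marginalRate S Z G ρ lam n x) p
          - (ρ - lam) * Real.exp (-(ρ - lam) * p.2)) ∂P.prod timeMeasure
        ≤ ∫ p, (runCost S Z G ρ lam n κ₂ (x + (ε : ℝ) • n) (u.val p.2 p.1) p
          - runCost S Z G ρ lam n κ₂ x ((u.addJump ε hτ).val p.2 p.1) p) ∂P.prod timeMeasure := by
      refine integral_mono ((hind.sub hexp).const_mul _) (hi1.sub hi2) fun p => ?_
      simp only
      rw [h.runCost_add_smul]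
      rcases le_or_gt (τ p.1) p.2 with hp | hp
      · rw [indicator_of_notMem (by rw [hA]; exact not_lt.2 hp),
          Intensity.addJump_val_of_le u ε hτ hp]
        push_cast
        linarith
      · rw [indicator_of_mem (by rw [hA]; exact hp), Intensity.addJump_val_of_lt u ε hτ hp,
          marginalRate, runCost, runCost, exp_rate]
        set y := freeState S Z x p.2 p.1
        set E := Real.exp (lam * p.2)
        have hE : 0 < E := Real.exp_pos _
        have h4 := smul_dirDeriv_le h.convex h.differentiable n
          (y + (E * (u.val p.2 p.1 : ℝ)) • n) (E * ε)
        rw [add_assoc y, ← add_smul, ← mul_add] at h4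
        have h5 := dirDeriv_le_dirDeriv_add h.convex h.differentiable n y
          (mul_nonneg hE.le (u.val p.2 p.1).coe_nonneg)
        have h6 : E * ε * dirDeriv G n y
            ≤ G (y + (E * ((u.val p.2 p.1 : ℝ) + ε)) • n) - G (y + (E * (u.val p.2 p.1 : ℝ)) • n) :=
          le_trans (mul_le_mul_of_nonneg_left h5 (by positivity)) h4
        nlinarith [mul_le_mul_of_nonneg_left h6 (Real.exp_pos (-ρ * (p.2 : ℝ))).le]
    rw [h2]
    refine h3.trans ?_
    rw [integral_sub hi1 hi2]
    unfold redCostReal at hxu h1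
    linarith
  refine ge_of_tendsto' (tendsto_dirDeriv (h.differentiable_value hF) n x
    (a := fun k : ℕ => 1 / ((k : ℝ) + 1)) (fun k => by positivity)
    tendsto_one_div_add_atTop_nhds_zero_nat) fun k => ?_
  have hk := key (1 / ((k : ℝ≥0) + 1)) (by positivity)
  push_cast at hk
  rw [le_div_iff₀ (by positivity), mul_comm]
  exact hk

/-- A Lipschitz bound for `G` along `n`, of quadratic growth in the base point. -/
theorem abs_sub_le (h : IsReducedProblem P S Z G ρ lam n c κ₁ κ₂ C) (y : H) {a b : ℝ}
    (ha : 0 ≤ a) (hab : a ≤ b) (hb : b ≤ 1) : |G (y + b • n) - G (y + a • n)|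
      ≤ (b - a) * (4 * c * (2 * ‖y‖ ^ 2) + (2 * c * (1 + 6 * ‖n‖ ^ 2) + 2 * κ₂)) := by
  have hc := h.c_pos
  have hbound : ∀ s : ℝ, 0 ≤ s → s ≤ 1 → |dirDeriv G n (y + s • n)|
      ≤ 4 * c * (2 * ‖y‖ ^ 2) + (2 * c * (1 + 6 * ‖n‖ ^ 2) + 2 * κ₂) := by
    intro s hs0 hs1
    have h1 : ‖y + s • n‖ ≤ ‖y‖ + ‖n‖ := by
      refine (norm_add_le _ _).trans (add_le_add_right ?_ _)
      rw [norm_smul, Real.norm_of_nonneg hs0]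
      exact mul_le_of_le_one_left (norm_nonneg _) hs1
    have h2 : ‖y + s • n‖ ^ 2 ≤ 2 * ‖y‖ ^ 2 + 2 * ‖n‖ ^ 2 := by
      nlinarith [norm_nonneg (y + s • n), sq_nonneg (‖y‖ - ‖n‖)]
    refine (h.abs_dirDeriv_le _).trans ?_
    nlinarith
  have h1 := smul_dirDeriv_le h.convex h.differentiable n (y + a • n) (b - a)
  have h2 := smul_dirDeriv_le h.convex h.differentiable n (y + b • n) (-(b - a))
  rw [add_assoc, ← add_smul] at h1 h2
  rw [add_sub_cancel] at h1
  rw [show b + -(b - a) = a by ring] at h2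
  have h3 := abs_le.1 (hbound a ha (hab.trans hb))
  have h4 := abs_le.1 (hbound b (ha.trans hab) hb)
  have h5 : 0 ≤ b - a := sub_nonneg.2 hab
  rw [abs_le]
  constructor
  · nlinarith [mul_le_mul_of_nonneg_left h3.1 h5]
  · nlinarith [mul_le_mul_of_nonneg_left h4.2 h5]

/-- Up to a null set, the control vanishes exactly before its first time of action. -/
theorem indicator_firstAction_ae_eq [IsProbabilityMeasure P]
    (h : IsReducedProblem P S Z G ρ lam n c κ₁ κ₂ C) (h𝓕 : UsualConditions P 𝓕) (x : H)
    (u : Intensity 𝓕) :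
    {p : Ω × ℝ≥0 | u.val p.2 p.1 = 0}.indicator (marginalRate S Z G ρ lam n x)
      =ᵐ[P.prod timeMeasure] {p : Ω × ℝ≥0 | (p.2 : WithTop ℝ≥0) < u.firstAction p.1}.indicator
        (marginalRate S Z G ρ lam n x) := by
  have hm : AEStronglyMeasurable (marginalRate S Z G ρ lam n x) (P.prod timeMeasure) :=
    ((h.integrable_dirDeriv x).add ((integrable_exp_prod h.rate_pos).const_mul _)).1
  have hset : NullMeasurableSet {p : Ω × ℝ≥0 | u.val p.2 p.1 = 0} (P.prod timeMeasure) := by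
    have h1 := u.aestronglyMeasurable (P := P).nullMeasurableSet_eq_fun
      (aestronglyMeasurable_const (b := (0 : ℝ)))
    simpa only [NNReal.coe_eq_zero] using h1
  refine ae_prod_eq_of_ae_ae (hm.indicator₀ hset)
    (hm.indicator (measurableSet_lt_stoppingTime (u.isStoppingTime_firstAction h𝓕)))
    (ae_of_all _ fun ω => ?_)
  have hcount : {t : ℝ≥0 | (t : WithTop ℝ≥0) = u.firstAction ω}.Countable := by
    refine Set.Subsingleton.countable fun s hs t ht => ?_
    exact WithTop.coe_injective ((show (s : WithTop ℝ≥0) = _ from hs).trans ht.symm)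
  filter_upwards [hcount.ae_notMem timeMeasure] with t ht
  have hiff : u.val t ω = 0 ↔ (t : WithTop ℝ≥0) < u.firstAction ω := by
    constructor
    · intro h0
      by_contra hcon
      have hlt : u.firstAction ω < t := lt_of_le_of_ne (not_lt.1 hcon) (fun heq => ht heq.symm)
      obtain ⟨s, hs, hpos⟩ := (u.firstAction_lt_iff ω t).1 hlt
      exact absurd h0 (hpos.trans_le (u.mono ω hs.le)).ne'
    · intro hlt
      by_contra hne
      exact absurd (iInf_le (fun s : {s : ℝ≥0 // 0 < u.val s ω} => ((s : ℝ≥0) : WithTop ℝ≥0))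
        ⟨t, pos_iff_ne_zero.2 hne⟩) (not_le.2 hlt)
  by_cases h0 : u.val t ω = 0
  · rw [indicator_of_mem (by exact h0), indicator_of_mem (by exact hiff.1 h0)]
  · rw [indicator_of_notMem (by exact h0), indicator_of_notMem (by exact fun hc => h0 (hiff.2 hc))]

/-- The first time at which an optimal control acts is optimal for the stopping problem: the control
`(u - ε)⁺` for the state `x + ε n` changes the cost only before `u` exceeds `ε`. -/
theorem dirDeriv_le_payoff [IsProbabilityMeasure P]
    (h : IsReducedProblem P S Z G ρ lam n c κ₁ κ₂ C) (h𝓕 : UsualConditions P 𝓕)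
    (hF : IsReducedValue P 𝓕 S Z G ρ lam n κ₂ F) (x : H) {u : Intensity 𝓕}
    (hu : u.SqIntegrable P ρ lam) (hxu : F x = redCostReal P S Z G ρ lam n κ₂ x u) :
    dirDeriv F n x
      ≤ ∫ ω, stoppingPayoff (ρ - lam) (dirDeriv G n) (freeState S Z x) u.firstAction ω ∂P := by
  have hr := h.rate_pos
  have hc := h.c_pos
  have hκ := h.k2_pos
  have hind : Integrable ({p : Ω × ℝ≥0 | (p.2 : WithTop ℝ≥0) < u.firstAction p.1}.indicator
      (marginalRate S Z G ρ lam n x)) (P.prod timeMeasure) :=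
    ((h.integrable_dirDeriv x).add ((integrable_exp_prod hr).const_mul _)).indicator
      (measurableSet_lt_stoppingTime (u.isStoppingTime_firstAction h𝓕))
  have hexp := (integrable_exp_prod (P := P) hr).const_mul (ρ - lam)
  have hae := h.indicator_firstAction_ae_eq h𝓕 x u
  set B : Set (Ω × ℝ≥0) := {p | u.val p.2 p.1 = 0} with hB
  have hpay : ∫ ω, stoppingPayoff (ρ - lam) (dirDeriv G n) (freeState S Z x) u.firstAction ω ∂P
      = ∫ p, (B.indicator (marginalRate S Z G ρ lam n x) p
        - (ρ - lam) * Real.exp (-(ρ - lam) * p.2)) ∂P.prod timeMeasure := by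
    rw [(h.integrable_stoppingPayoff x (u.isStoppingTime_firstAction h𝓕)).2,
      integral_sub (hind.congr hae.symm) hexp, integral_exp_prod hr, integral_congr_ae hae]
  set ε : ℕ → ℝ≥0 := fun k => 1 / ((k : ℝ≥0) + 1) with hε
  have hεcoe : ∀ k, (ε k : ℝ) = 1 / ((k : ℝ) + 1) := fun k => by simp [hε]
  have hε0 : ∀ k, (0 : ℝ) < ε k := fun k => by rw [hεcoe]; positivity
  have hε1 : ∀ k, (ε k : ℝ) ≤ 1 := fun k => by
    rw [hεcoe, div_le_one (by positivity)]
    linarith [Nat.cast_nonneg (α := ℝ) k]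
  have hεlim : Tendsto (fun k => (ε k : ℝ)) atTop (𝓝 0) := by
    simp_rw [hεcoe]
    exact tendsto_one_div_add_atTop_nhds_zero_nat
  have hsub : ∀ k, (u.truncSub (ε k)).SqIntegrable P ρ lam := fun k =>
    hu.mono fun t ω => tsub_le_self
  have hi0 := h.integrable_runCost x hu
  have hi1 := fun k => h.integrable_runCost (x + (ε k : ℝ) • n) (hsub k)
  -- the difference quotient of the integrands, when `ε ≤ u` and when `u < ε`
  set D : ℕ → Ω × ℝ≥0 → ℝ := fun k p =>
    (runCost S Z G ρ lam n κ₂ (x + (ε k : ℝ) • n) ((u.truncSub (ε k)).val p.2 p.1) p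
      - runCost S Z G ρ lam n κ₂ x (u.val p.2 p.1) p) / ε k with hD
  have hDge : ∀ k p, ε k ≤ u.val p.2 p.1 →
      D k p = -((ρ - lam) * Real.exp (-(ρ - lam) * p.2)) := by
    intro k p hle
    have hv : ((u.truncSub (ε k)).val p.2 p.1 : ℝ) + ε k = u.val p.2 p.1 := by
      change ((u.val p.2 p.1 - ε k : ℝ≥0) : ℝ) + ε k = _
      rw [NNReal.coe_sub hle]; ring
    simp only [hD]
    rw [h.runCost_add_smul, hv]
    field_simp [(hε0 k).ne']
    ring
  have hDlt : ∀ k p, u.val p.2 p.1 < ε k →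
      D k p = Real.exp (-ρ * p.2) * ((G (freeState S Z x p.2 p.1
          + (Real.exp (lam * p.2) * ε k) • n)
        - G (freeState S Z x p.2 p.1 + (Real.exp (lam * p.2) * (u.val p.2 p.1 : ℝ)) • n)) / ε k)
        - (ρ - lam) * Real.exp (-(ρ - lam) * p.2) * (u.val p.2 p.1 / ε k) := by
    intro k p hlt
    have hv : ((u.truncSub (ε k)).val p.2 p.1 : ℝ) + ε k = ε k := by
      change ((u.val p.2 p.1 - ε k : ℝ≥0) : ℝ) + ε k = _
      rw [tsub_eq_zero_of_le hlt.le]; simp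
    simp only [hD]
    rw [h.runCost_add_smul, hv, runCost, runCost]
    field_simp [(hε0 k).ne']
    ring
  have hlim : Tendsto (fun k => ∫ p, D k p ∂P.prod timeMeasure) atTop
      (𝓝 (∫ p, (B.indicator (marginalRate S Z G ρ lam n x) p
        - (ρ - lam) * Real.exp (-(ρ - lam) * p.2)) ∂P.prod timeMeasure)) := by
    refine tendsto_integral_of_dominated_convergence (fun p => 8 * c * (Real.exp (-ρ * p.2)
      * ‖freeState S Z x p.2 p.1‖ ^ 2)
      + (2 * c * (1 + 6 * ‖n‖ ^ 2) + 2 * κ₂) * Real.exp (-ρ * p.2)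
      + (ρ - lam) * Real.exp (-(ρ - lam) * p.2)) (fun k => (((hi1 k).sub hi0).div_const _).1)
      ((((h.int_sq ρ h.rho_pos x).const_mul _).add
        ((integrable_exp_prod h.rho_pos).const_mul _)).add hexp)
      (fun k => ae_of_all _ fun p => ?_) (ae_of_all _ fun p => ?_)
    · have hr1 : 0 ≤ (ρ - lam) * Real.exp (-(ρ - lam) * p.2) := by positivity
      have hr2 : 0 ≤ 8 * c * (Real.exp (-ρ * p.2) * ‖freeState S Z x p.2 p.1‖ ^ 2)
          + (2 * c * (1 + 6 * ‖n‖ ^ 2) + 2 * κ₂) * Real.exp (-ρ * p.2) := by positivity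
      rcases le_or_gt (ε k) (u.val p.2 p.1) with hle | hlt
      · rw [hDge k p hle, norm_neg, Real.norm_of_nonneg hr1]
        linarith
      · rw [hDlt k p hlt]
        refine (norm_sub_le _ _).trans (add_le_add ?_ ?_)
        · have hE0 : 0 < Real.exp (lam * p.2) := Real.exp_pos _
          have hE1 : Real.exp (lam * p.2) ≤ 1 := Real.exp_le_one_iff.2
            (mul_nonpos_of_nonpos_of_nonneg h.lam_neg.le p.2.coe_nonneg)
          have hlt' : (u.val p.2 p.1 : ℝ) < ε k := hlt
          have hu0 : (0 : ℝ) ≤ u.val p.2 p.1 := (u.val p.2 p.1).coe_nonneg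
          have h1 := h.abs_sub_le (freeState S Z x p.2 p.1)
            (a := Real.exp (lam * p.2) * (u.val p.2 p.1 : ℝ)) (b := Real.exp (lam * p.2) * ε k)
            (by positivity) (by gcongr) (by nlinarith [hε1 k, hε0 k])
          rw [norm_mul, Real.norm_of_nonneg (Real.exp_pos _).le, norm_div,
            Real.norm_of_nonneg (hε0 k).le, Real.norm_eq_abs]
          have h2 : Real.exp (lam * p.2) * ε k - Real.exp (lam * p.2) * (u.val p.2 p.1 : ℝ)
              ≤ ε k := by nlinarith [hε0 k, mul_nonneg hE0.le hu0]
          have h3 : |G (freeState S Z x p.2 p.1 + (Real.exp (lam * p.2) * ε k) • n)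
              - G (freeState S Z x p.2 p.1 + (Real.exp (lam * p.2) * (u.val p.2 p.1 : ℝ)) • n)|
                / ε k ≤ 4 * c * (2 * ‖freeState S Z x p.2 p.1‖ ^ 2)
                  + (2 * c * (1 + 6 * ‖n‖ ^ 2) + 2 * κ₂) := by
            rw [div_le_iff₀ (hε0 k)]
            exact (h1.trans (mul_le_mul_of_nonneg_right h2 (by positivity))).trans
              (le_of_eq (mul_comm _ _))
          refine (mul_le_mul_of_nonneg_left h3 (Real.exp_pos _).le).trans (le_of_eq ?_)
          ring
        · rw [norm_mul, Real.norm_of_nonneg hr1,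
            Real.norm_of_nonneg (div_nonneg (u.val p.2 p.1).coe_nonneg (hε0 k).le)]
          refine mul_le_of_le_one_right hr1 ((div_le_one (hε0 k)).2 ?_)
          exact_mod_cast hlt.le
    · by_cases h0 : u.val p.2 p.1 = 0
      · rw [indicator_of_mem (by exact h0), marginalRate, add_sub_cancel_right]
        have h1 := (tendsto_dirDeriv h.differentiable n (freeState S Z x p.2 p.1)
          (a := fun k => Real.exp (lam * p.2) * ε k)
          (fun k => (mul_pos (Real.exp_pos _) (hε0 k)).ne')
          (by simpa using hεlim.const_mul (Real.exp (lam * p.2)))).const_mul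
            (Real.exp (-(ρ - lam) * p.2))
        refine h1.congr fun k => ?_
        rw [hDlt k p (by rw [h0]; exact_mod_cast hε0 k), h0, exp_rate]
        have hE : Real.exp (lam * p.2) ≠ 0 := (Real.exp_pos _).ne'
        have hk := (hε0 k).ne'
        simp only [NNReal.coe_zero, mul_zero, zero_smul, add_zero, zero_div, sub_zero]
        field_simp
      · rw [indicator_of_notMem (by exact h0), zero_sub]
        refine tendsto_const_nhds.congr' ?_
        have hpos : (0 : ℝ) < u.val p.2 p.1 := by
          exact_mod_cast pos_iff_ne_zero.2 h0
        filter_upwards [hεlim.eventually_lt_const hpos] with k hk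
        exact (hDge k p (by exact_mod_cast hk.le)).symm
  rw [hpay]
  refine le_of_tendsto_of_tendsto' (tendsto_dirDeriv (h.differentiable_value hF) n x
    (fun k => (hε0 k).ne') hεlim) hlim fun k => ?_
  rw [integral_div, integral_sub (hi1 k) hi0, hxu]
  exact div_le_div_of_nonneg_right (sub_le_sub_right ((hF _).2 _ (hsub k)) _) (hε0 k).le

end IsReducedProblem

end SingularControl

namespace SingularControl

/-! ### Controls along a ray and the reduced problem -/

variable {Ω H : Type*} {mΩ : MeasurableSpace Ω} [NormedAddCommGroup H] [InnerProductSpace ℝ H]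

theorem directions_ray {q n : H} (hqn : ⟪q, n⟫_ℝ = 1) : directions q (ray n) = {n} := by
  ext y
  constructor
  · rintro ⟨⟨a, -, rfl⟩, hy⟩
    rw [inner_smul_right, hqn, mul_one] at hy
    rw [hy, one_smul, mem_singleton_iff]
  · rintro rfl
    exact ⟨⟨1, zero_le_one, (one_smul _ _).symm⟩, hqn⟩

/-- Transfer of an additive constant between two differences of extended nonnegative numbers. -/
theorem coe_sub_coe_eq {a b d : ℝ≥0∞} {k : ℝ} (hk : 0 ≤ k) (hb : b ≠ ∞)
    (h : a + ENNReal.ofReal k = d + b) : (a : EReal) - (b : EReal) = (d : EReal) - (k : EReal) := by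
  lift b to ℝ≥0 using hb
  have e := congrArg (fun z : ℝ≥0∞ => (z : EReal) - (k : EReal) - ((b : ℝ) : EReal)) h
  simp only [EReal.coe_ennreal_add, EReal.coe_ennreal_ofReal, max_eq_left hk,
    EReal.add_sub_cancel_right] at e
  have hb' : ((b : ℝ≥0∞) : EReal) = ((b : ℝ) : EReal) := rfl
  rw [hb'] at e ⊢
  rw [e, sub_eq_add_neg, sub_eq_add_neg, add_right_comm, ← sub_eq_add_neg, ← sub_eq_add_neg,
    EReal.add_sub_cancel_right]

variable {P : Measure Ω} {𝓕 : Filtration ℝ≥0 mΩ} {S : ℝ≥0 → H →L[ℝ] H} {Z : ℝ≥0 → Ω → H}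
  {G : H → ℝ} {ρ lam : ℝ} {q n : H} {c κ₁ κ₂ C : ℝ}

theorem Control.dir_eq (hqn : ⟪q, n⟫_ℝ = 1) (I : Control P 𝓕 q (ray n)) (t : ℝ≥0) (ω : Ω) :
    I.dir t ω = n := by
  have h := I.dir_mem t ω
  rwa [directions_ray hqn] at h

/-- By monotonicity, `u_T` is dominated by the weighted norm of `u` over `[T, ∞)`. -/
theorem Intensity.SqIntegrable.lintegral_sq_lt_top (hρ : 0 < ρ) (hlam : lam < 0)
    [SFinite P] {u : Intensity 𝓕} (hu : u.SqIntegrable P ρ lam) (T : ℝ≥0) :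
    ∫⁻ ω, (u.val T ω : ℝ≥0∞) ^ 2 ∂P < ∞ := by
  have hb : 0 < ρ - 2 * lam := by linarith
  have hint := (MemLp.integrable_sq hu).2
  rw [hasFiniteIntegral_iff_ofReal (ae_of_all _ fun _ => sq_nonneg _), lintegral_prod _
    (MemLp.integrable_sq hu).1.aemeasurable.ennreal_ofReal] at hint
  have hle : ENNReal.ofReal (Real.exp (-(ρ - 2 * lam) * T)) * ∫⁻ ω, (u.val T ω : ℝ≥0∞) ^ 2 ∂P
      ≤ ENNReal.ofReal (ρ - 2 * lam) * ∫⁻ ω, ∫⁻ t : ℝ≥0, ENNReal.ofReal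
        ((Real.exp (-(ρ / 2 - lam) * t) * (u.val t ω : ℝ)) ^ 2) ∂timeMeasure ∂P := by
    rw [← lintegral_const_mul' _ _ ENNReal.ofReal_ne_top,
      ← lintegral_const_mul' _ _ ENNReal.ofReal_ne_top]
    refine lintegral_mono fun ω => ?_
    rw [← lintegral_timeMeasure_exp hb T, ← lintegral_mul_const _ (by fun_prop),
      ← lintegral_const_mul' _ _ ENNReal.ofReal_ne_top]
    refine le_trans (setLIntegral_mono' measurableSet_Ici fun t ht => ?_)
      (setLIntegral_le_lintegral (Ici T) _)
    have h1 : (Real.exp (-(ρ / 2 - lam) * t)) ^ 2 = Real.exp (-(ρ - 2 * lam) * t) := by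
      rw [← Real.exp_nat_mul]
      push_cast
      ring_nf
    have h2 : (u.val T ω : ℝ≥0∞) ^ 2 ≤ ENNReal.ofReal ((u.val t ω : ℝ) ^ 2) := by
      rw [ENNReal.ofReal_pow (NNReal.coe_nonneg _), ENNReal.ofReal_coe_nnreal]
      gcongr
      exact u.mono ω ht
    rw [mul_pow, h1, ← ENNReal.ofReal_mul hb.le, ← mul_assoc,
      ENNReal.ofReal_mul (p := (ρ - 2 * lam) * Real.exp (-(ρ - 2 * lam) * t)) (by positivity)]
    exact mul_le_mul_right h2 _
  have hpos : ENNReal.ofReal (Real.exp (-(ρ - 2 * lam) * T)) ≠ 0 :=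
    (ENNReal.ofReal_pos.2 (Real.exp_pos _)).ne'
  have hfin := hle.trans_lt (ENNReal.mul_lt_top ENNReal.ofReal_lt_top hint)
  by_contra hcon
  rw [not_lt, top_le_iff] at hcon
  rw [hcon, ENNReal.mul_top hpos] at hfin
  exact lt_irrefl _ hfin

/-- The control in the direction `n` whose reduced control is `u`: the intensity is
`e^{λt} du_t`. -/
noncomputable def Control.ofReduced [IsProbabilityMeasure P] (hρ : 0 < ρ) (hlam : lam < 0)
    (hqn : ⟪q, n⟫_ℝ = 1) (u : Intensity 𝓕) (hu : u.SqIntegrable P ρ lam) :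
    Control P 𝓕 q (ray n) where
  dir _ _ := n
  intensity := u.reweight lam
  dir_mem _ _ := by rw [directions_ray hqn]; exact mem_singleton n
  dir_adapted _ := stronglyMeasurable_const
  sq_integrable T := by
    simp_rw [setLIntegral_const, Intensity.measure_Iic, mul_pow]
    rw [lintegral_const_mul' _ _ (ENNReal.pow_ne_top enorm_ne_top)]
    refine ENNReal.mul_lt_top (ENNReal.pow_lt_top enorm_lt_top)
      (lt_of_le_of_lt (lintegral_mono fun ω => ?_) (hu.lintegral_sq_lt_top hρ hlam T))
    gcongr
    exact u.reweight_val_le hlam.le T ω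
  integrable_sq T := by
    simp_rw [setLIntegral_const, Intensity.measure_Iic]
    rw [lintegral_const_mul' _ _ (ENNReal.pow_ne_top enorm_ne_top)]
    refine ENNReal.mul_lt_top (ENNReal.pow_lt_top enorm_lt_top)
      (lt_of_le_of_lt (lintegral_mono (g := fun ω => 1 + (u.val T ω : ℝ≥0∞) ^ 2) fun ω => ?_) ?_)
    · have h1 := u.reweight_val_le hlam.le T ω
      have h2 : u.val T ω ≤ 1 + u.val T ω ^ 2 := by
        rw [← NNReal.coe_le_coe]
        push_cast
        nlinarith [sq_nonneg ((u.val T ω : ℝ) - 1 / 2)]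
      change _ ≤ 1 + (u.val T ω : ℝ≥0∞) ^ 2
      exact_mod_cast h1.trans h2
    · rw [lintegral_add_left measurable_const, lintegral_const, measure_univ, mul_one]
      exact ENNReal.add_lt_top.2 ⟨ENNReal.one_lt_top, hu.lintegral_sq_lt_top hρ hlam T⟩

namespace IsReducedProblem

/-- Only the multiple `∫ e^{-λs} dν_s` of `e^{λt} n` enters the controlled state. -/
theorem state_eq [CompleteSpace H] (h : IsReducedProblem P S Z G ρ lam n c κ₁ κ₂ C)
    (hqn : ⟪q, n⟫_ℝ = 1) (x : H) (I : Control P 𝓕 q (ray n)) (t : ℝ≥0) (ω : Ω) :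
    state S Z x I t ω = freeState S Z x t ω
      + (Real.exp (lam * t) * ((I.intensity.reweight (-lam)).val t ω : ℝ)) • n := by
  have h1 : ∫ s in Iic t, S (t - s) (I.dir s ω) ∂I.intensity.measure ω
      = ∫ s in Iic t, (Real.exp (lam * t) * Real.exp (-lam * s)) • n ∂I.intensity.measure ω := by
    refine setIntegral_congr_fun measurableSet_Iic fun s hs => ?_
    simp only [I.dir_eq hqn, h.eigen, NNReal.coe_sub (mem_Iic.1 hs), ← Real.exp_add]
    ring_nf
  have h2 : ∫ s in Iic t, Real.exp (-lam * s) ∂I.intensity.measure ω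
      = ((I.intensity.reweight (-lam)).val t ω : ℝ) := by
    rw [integral_eq_lintegral_of_nonneg_ae (ae_of_all _ fun _ => (Real.exp_pos _).le)
      (by fun_prop), ← Intensity.coe_reweight_val, ENNReal.coe_toReal]
  rw [state, freeState, h1, integral_smul_const, integral_const_mul, h2]

/-- Passing from `ν` to the reduced control and integrating by parts, the cost of acting becomes an
integral over time. -/
theorem lintegral_action_eq [SFinite P] (h : IsReducedProblem P S Z G ρ lam n c κ₁ κ₂ C)
    (hqn : ⟪q, n⟫_ℝ = 1) (I : Control P 𝓕 q (ray n)) :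
    ∫⁻ ω, ∫⁻ t, ENNReal.ofReal (Real.exp (-ρ * t) * ⟪q, I.dir t ω⟫_ℝ)
        ∂(I.intensity.measure ω) ∂P
      = ∫⁻ p, ENNReal.ofReal ((ρ - lam) * Real.exp (-(ρ - lam) * p.2)
          * ((I.intensity.reweight (-lam)).val p.2 p.1 : ℝ)) ∂(P.prod timeMeasure) := by
  set u := I.intensity.reweight (-lam) with hu
  have hr := h.rate_pos
  have hm : ∀ ω, I.intensity.measure ω
      = (u.measure ω).withDensity fun s => ENNReal.ofReal (Real.exp (lam * s)) := fun ω => by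
    rw [← Intensity.measure_reweight]
    refine Intensity.measure_eq_of_Iic _ ω fun t => ?_
    rw [Intensity.measure_Iic, hu]
    have := I.intensity.reweight_neg_reweight (-lam) t ω
    rw [neg_neg] at this
    rw [this]
  have hmeas : AEMeasurable (fun p : Ω × ℝ≥0 => ENNReal.ofReal ((ρ - lam)
      * Real.exp (-(ρ - lam) * p.2) * (u.val p.2 p.1 : ℝ))) (P.prod timeMeasure) := by
    refine AEMeasurable.ennreal_ofReal (AEMeasurable.mul (Measurable.aemeasurable (by fun_prop))
      u.aestronglyMeasurable.aemeasurable)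
  rw [lintegral_prod _ hmeas]
  refine lintegral_congr fun ω => ?_
  simp_rw [I.dir_eq hqn, hqn, mul_one]
  rw [hm ω, lintegral_withDensity_eq_lintegral_mul _ (by fun_prop) (by fun_prop)]
  calc ∫⁻ s, ((fun s : ℝ≥0 => ENNReal.ofReal (Real.exp (lam * s)))
        * fun s : ℝ≥0 => ENNReal.ofReal (Real.exp (-ρ * s))) s ∂u.measure ω
      = ∫⁻ s, ENNReal.ofReal (Real.exp (-(ρ - lam) * s)) ∂u.measure ω := by
        refine lintegral_congr fun s => ?_
        rw [Pi.mul_apply, ← ENNReal.ofReal_mul (Real.exp_pos _).le, mul_comm, ← exp_rate]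
    _ = ∫⁻ t, ENNReal.ofReal ((ρ - lam) * Real.exp (-(ρ - lam) * t)) * u.val t ω
          ∂timeMeasure := u.lintegral_exp_measure hr ω
    _ = _ := by
        refine lintegral_congr fun t => ?_
        rw [ENNReal.ofReal_mul (p := (ρ - lam) * Real.exp (-(ρ - lam) * t)) (by positivity),
          ENNReal.ofReal_coe_nnreal]

/-- The cost of a control is the reduced cost, up to the constant `κ₂ / ρ = ∫ e^{-ρt} κ₂ dt`. -/
theorem cost_eq [CompleteSpace H] [IsProbabilityMeasure P]
    (h : IsReducedProblem P S Z G ρ lam n c κ₁ κ₂ C)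
    (hqn : ⟪q, n⟫_ℝ = 1) (x : H) (I : Control P 𝓕 q (ray n)) :
    cost S Z G ρ x I = (redCost P S Z G ρ lam n κ₂ x (I.intensity.reweight (-lam)) : EReal)
      - ((κ₂ / ρ : ℝ) : EReal) := by
  have hρ := h.rho_pos
  have hκ := h.k2_pos
  set u := I.intensity.reweight (-lam) with hu
  have hum := u.aestronglyMeasurable (P := P)
  set f : Ω × ℝ≥0 → ℝ := fun p => Real.exp (-ρ * p.2)
    * G (freeState S Z x p.2 p.1 + (Real.exp (lam * p.2) * (u.val p.2 p.1 : ℝ)) • n) with hf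
  have hexp : ∀ a : ℝ, AEStronglyMeasurable (fun p : Ω × ℝ≥0 => Real.exp (a * p.2))
      (P.prod timeMeasure) := fun a => Measurable.aestronglyMeasurable (by fun_prop)
  have hfm : AEMeasurable f (P.prod timeMeasure) :=
    ((hexp _).mul (h.continuous.comp_aestronglyMeasurable
      ((h.meas x).add (((hexp _).mul hum).smul_const n)))).aemeasurable
  have hfnm : AEMeasurable (fun p => ENNReal.ofReal (-f p)) (P.prod timeMeasure) :=
    hfm.neg.ennreal_ofReal
  have hfκm : AEMeasurable (fun p => ENNReal.ofReal (f p + Real.exp (-ρ * p.2) * κ₂))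
      (P.prod timeMeasure) := (hfm.add ((hexp (-ρ)).aemeasurable.mul_const κ₂)).ennreal_ofReal
  have hK : ∫⁻ p : Ω × ℝ≥0, ENNReal.ofReal (Real.exp (-ρ * p.2) * κ₂) ∂(P.prod timeMeasure)
      = ENNReal.ofReal (κ₂ / ρ) := by
    have h1 : ∀ t : ℝ≥0, ENNReal.ofReal (Real.exp (-ρ * t) * κ₂)
        = ENNReal.ofReal (κ₂ / ρ) * ENNReal.ofReal (ρ * Real.exp (-ρ * t)) := fun t => by
      rw [← ENNReal.ofReal_mul (by positivity)]
      congr 1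
      field_simp
    have h2 := lintegral_timeMeasure_exp hρ 0
    rw [show Ici (0 : ℝ≥0) = univ from Ici_bot, Measure.restrict_univ] at h2
    rw [lintegral_prod _ (Measurable.aemeasurable (by fun_prop))]
    simp_rw [h1]
    rw [lintegral_const_mul' _ _ ENNReal.ofReal_ne_top, h2]
    simp
  set A := ∫⁻ p, ENNReal.ofReal (f p) ∂(P.prod timeMeasure) with hA
  set B := ∫⁻ p, ENNReal.ofReal (-f p) ∂(P.prod timeMeasure) with hB
  set A' := ∫⁻ p : Ω × ℝ≥0, ENNReal.ofReal (f p + Real.exp (-ρ * p.2) * κ₂)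
    ∂(P.prod timeMeasure) with hA'
  set R := ∫⁻ p, ENNReal.ofReal ((ρ - lam) * Real.exp (-(ρ - lam) * p.2) * (u.val p.2 p.1 : ℝ))
    ∂(P.prod timeMeasure) with hR
  have hf0 : ∀ p : Ω × ℝ≥0, 0 ≤ f p + Real.exp (-ρ * p.2) * κ₂ := fun p => by
    have := h.lower_nonneg (freeState S Z x p.2 p.1
      + (Real.exp (lam * p.2) * (u.val p.2 p.1 : ℝ)) • n)
    rw [hf, ← mul_add]
    positivity
  have hAB : A + ENNReal.ofReal (κ₂ / ρ) = A' + B := by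
    rw [← hK, hA, hA', hB, ← lintegral_add_left' hfm.ennreal_ofReal,
      ← lintegral_add_right' _ hfnm]
    refine lintegral_congr fun p => ?_
    have he : 0 ≤ Real.exp (-ρ * p.2) * κ₂ := by positivity
    rcases le_total 0 (f p) with h0 | h0
    · rw [ENNReal.ofReal_of_nonpos (p := -f p) (by linarith), add_zero, ENNReal.ofReal_add h0 he]
    · rw [ENNReal.ofReal_of_nonpos h0, zero_add, ← ENNReal.ofReal_add (hf0 p) (by linarith)]
      congr 1
      ring
  have hBtop : B ≠ ∞ := by
    refine ne_top_of_le_ne_top (b := ENNReal.ofReal (κ₂ / ρ)) ENNReal.ofReal_ne_top ?_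
    rw [← hK]
    exact lintegral_mono fun p => ENNReal.ofReal_le_ofReal (by linarith [hf0 p])
  have hred : redCost P S Z G ρ lam n κ₂ x u = A' + R := by
    rw [redCost, hA', hR, ← lintegral_add_left' hfκm]
    refine lintegral_congr fun p => ?_
    have hr := h.rate_pos
    rw [← ENNReal.ofReal_add (hf0 p) (by positivity), runCost, hf, mul_add]
  have hcost : cost S Z G ρ x I = (A : EReal) - (B : EReal) + (R : EReal) := by
    rw [cost, h.lintegral_action_eq hqn]
    simp_rw [h.state_eq hqn]
    rw [hA, hB, lintegral_prod _ hfm.ennreal_ofReal, lintegral_prod _ hfnm]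
  have hAB' := coe_sub_coe_eq (by positivity) hBtop hAB
  rw [hcost, hAB', hred, EReal.coe_ennreal_add, sub_eq_add_neg, sub_eq_add_neg, add_right_comm]

theorem redCost_congr (x : H) {u v : Intensity 𝓕} (huv : ∀ t ω, u.val t ω = v.val t ω) :
    redCost P S Z G ρ lam n κ₂ x u = redCost P S Z G ρ lam n κ₂ x v := by
  simp only [redCost, huv]

theorem cost_ofReduced [CompleteSpace H] [IsProbabilityMeasure P]
    (h : IsReducedProblem P S Z G ρ lam n c κ₁ κ₂ C) (hqn : ⟪q, n⟫_ℝ = 1) (x : H)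
    (u : Intensity 𝓕) (hu : u.SqIntegrable P ρ lam) :
    cost S Z G ρ x (Control.ofReduced h.rho_pos h.lam_neg hqn u hu)
      = ((redCostReal P S Z G ρ lam n κ₂ x u - κ₂ / ρ : ℝ) : EReal) := by
  have hval : redCost P S Z G ρ lam n κ₂ x ((u.reweight lam).reweight (-lam))
      = redCost P S Z G ρ lam n κ₂ x u := redCost_congr x (u.reweight_neg_reweight lam)
  rw [h.cost_eq hqn, Control.ofReduced, hval, h.redCost_eq_ofReal x hu, EReal.coe_ennreal_ofReal, max_eq_left (h.redCostReal_nonneg x u),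
    EReal.coe_sub]

/-- The value is the minimal reduced cost, up to the constant `κ₂ / ρ`, and it is attained. -/
theorem exists_value_eq [CompleteSpace H] [IsProbabilityMeasure P]
    (h : IsReducedProblem P S Z G ρ lam n c κ₁ κ₂ C) (hqn : ⟪q, n⟫_ℝ = 1)
    (h𝓕 : UsualConditions P 𝓕) (x : H) :
    ∃ (u : Intensity 𝓕) (hu : u.SqIntegrable P ρ lam),
      value P 𝓕 q (ray n) S Z G ρ x
        = ((redCostReal P S Z G ρ lam n κ₂ x u - κ₂ / ρ : ℝ) : EReal) ∧
      cost S Z G ρ x (Control.ofReduced h.rho_pos h.lam_neg hqn u hu)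
        = value P 𝓕 q (ray n) S Z G ρ x ∧
      ∀ v : Intensity 𝓕, v.SqIntegrable P ρ lam →
        redCostReal P S Z G ρ lam n κ₂ x u ≤ redCostReal P S Z G ρ lam n κ₂ x v := by
  obtain ⟨u, hu, hmin⟩ := h.exists_minimizer h𝓕 x
  have hval : value P 𝓕 q (ray n) S Z G ρ x
      = ((redCostReal P S Z G ρ lam n κ₂ x u - κ₂ / ρ : ℝ) : EReal) := by
    refine le_antisymm (iInf_le_of_le _ (h.cost_ofReduced hqn x u hu).le) (le_iInf fun I => ?_)
    rw [← h.cost_ofReduced hqn x u hu, h.cost_eq hqn, h.cost_eq hqn]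
    refine EReal.sub_le_sub (EReal.coe_ennreal_le_coe_ennreal_iff.2 ?_) le_rfl
    exact (redCost_congr x (u.reweight_neg_reweight lam)).le.trans (hmin _)
  refine ⟨u, hu, hval, (h.cost_ofReduced hqn x u hu).trans hval.symm, fun v hv => ?_⟩
  exact (h.redCostReal_le_iff x hu hv).1 (hmin v)

theorem isReducedValue_value [CompleteSpace H] [IsProbabilityMeasure P]
    (h : IsReducedProblem P S Z G ρ lam n c κ₁ κ₂ C) (hqn : ⟪q, n⟫_ℝ = 1)
    (h𝓕 : UsualConditions P 𝓕) : IsReducedValue P 𝓕 S Z G ρ lam n κ₂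
      (fun x => (value P 𝓕 q (ray n) S Z G ρ x).toReal + κ₂ / ρ) := by
  intro x
  obtain ⟨u, hu, hval, -, hmin⟩ := h.exists_value_eq hqn h𝓕 x
  have hx : (value P 𝓕 q (ray n) S Z G ρ x).toReal + κ₂ / ρ
      = redCostReal P S Z G ρ lam n κ₂ x u := by
    rw [hval, EReal.toReal_coe, sub_add_cancel]
  exact ⟨⟨u, hu, hx⟩, fun v hv => hx.le.trans (hmin v hv)⟩

/-- An optimal control corresponds to a minimiser of the reduced cost. -/
theorem reduced_of_optimal [CompleteSpace H] [IsProbabilityMeasure P]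
    (h : IsReducedProblem P S Z G ρ lam n c κ₁ κ₂ C) (hqn : ⟪q, n⟫_ℝ = 1)
    (h𝓕 : UsualConditions P 𝓕) (x : H) {I : Control P 𝓕 q (ray n)}
    (hI : cost S Z G ρ x I = value P 𝓕 q (ray n) S Z G ρ x) :
    (I.intensity.reweight (-lam)).SqIntegrable P ρ lam ∧
      redCostReal P S Z G ρ lam n κ₂ x (I.intensity.reweight (-lam))
        = (value P 𝓕 q (ray n) S Z G ρ x).toReal + κ₂ / ρ := by
  obtain ⟨u, -, hval, -, -⟩ := h.exists_value_eq hqn h𝓕 x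
  rw [hval, h.cost_eq hqn] at hI
  have hfin : redCost P S Z G ρ lam n κ₂ x (I.intensity.reweight (-lam)) ≠ ∞ := fun htop => by
    rw [htop, EReal.coe_ennreal_top, EReal.top_sub_coe] at hI
    exact EReal.top_ne_coe _ hI
  have hsq := h.sqIntegrable_of_redCost_ne_top x hfin
  refine ⟨hsq, ?_⟩
  rw [h.redCost_eq_ofReal x hsq, EReal.coe_ennreal_ofReal,
    max_eq_left (h.redCostReal_nonneg x _), ← EReal.coe_sub, EReal.coe_eq_coe_iff] at hI
  rw [hval, EReal.toReal_coe]
  linarith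

/-- The derivative of the value along `n` is the value of the optimal stopping problem; the supremum
is attained at the first time an optimal control acts. -/
theorem isLUB_payoff [CompleteSpace H] [IsProbabilityMeasure P]
    (h : IsReducedProblem P S Z G ρ lam n c κ₁ κ₂ C) (h𝓕 : UsualConditions P 𝓕) {F : H → ℝ}
    (hF : IsReducedValue P 𝓕 S Z G ρ lam n κ₂ F) (x : H) :
    IsLUB {r : ℝ | ∃ τ, IsStoppingTime 𝓕 τ ∧
      r = ∫ ω, stoppingPayoff (ρ - lam) (dirDeriv G n) (freeState S Z x) τ ω ∂P}
      (dirDeriv F n x) := by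
  obtain ⟨u, hu, hxu⟩ := (hF x).1
  refine IsGreatest.isLUB ⟨⟨u.firstAction, u.isStoppingTime_firstAction h𝓕, ?_⟩, ?_⟩
  · exact le_antisymm (h.dirDeriv_le_payoff h𝓕 hF x hu hxu)
      (h.payoff_le_dirDeriv hF x (u.isStoppingTime_firstAction h𝓕))
  · rintro r ⟨τ, hτ, rfl⟩
    exact h.payoff_le_dirDeriv hF x hτ

end IsReducedProblem

/-- The spectral bound of `A` forces the eigenvalue to be negative. -/
theorem eigenvalue_neg {A : H →ₗ.[ℝ] H} {δ : ℝ} (hδ : 0 < δ)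
    (hA : ∀ x : A.domain, ⟪A x, (x : H)⟫_ℝ ≤ -δ * ‖(x : H)‖ ^ 2) (hn : n ≠ 0)
    (hgraph : (n, lam • n) ∈ A.graph) : lam < 0 := by
  obtain ⟨y, hy, hAy⟩ := (LinearPMap.mem_graph_iff A).1 hgraph
  have h1 := hA y
  simp only at hy hAy
  rw [hAy, hy, real_inner_smul_left, real_inner_self_eq_norm_sq] at h1
  have h2 : 0 < ‖n‖ ^ 2 := by have := norm_pos_iff.2 hn; positivity
  by_contra! hcon
  nlinarith [mul_nonneg hcon h2.le]

theorem IsRunningCost.second_difference_le {c : ℝ} (hG : ∀ x y : H, ∀ l ∈ Icc (0 : ℝ) 1,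
    l * G x + (1 - l) * G y - G (l • x + (1 - l) • y) ≤ c / 2 * l * (1 - l) * ‖x - y‖ ^ 2)
    (x z : H) : G (x + z) + G (x - z) - 2 * G x ≤ c * ‖z‖ ^ 2 := by
  have h1 := hG (x + z) (x - z) (1 / 2) ⟨by norm_num, by norm_num⟩
  have h2 : (1 / 2 : ℝ) • (x + z) + (1 - 1 / 2 : ℝ) • (x - z) = x := by module
  have h3 : x + z - (x - z) = (2 : ℝ) • z := by module
  rw [h2, h3, norm_smul, mul_pow, Real.norm_of_nonneg two_pos.le] at h1
  linarith

/-- The standing assumptions lead to a reduced problem. -/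
theorem exists_isReducedProblem [CompleteSpace H] [SecondCountableTopology H]
    [IsProbabilityMeasure P] {A : H →ₗ.[ℝ] H} (hA_dense : Dense (A.domain : Set H)) {δ : ℝ}
    (hδ : 0 < δ) (hA : ∀ x : A.domain, ⟪A x, (x : H)⟫_ℝ ≤ -δ * ‖(x : H)‖ ^ 2)
    (hS : IsSemigroupGeneratedBy A S) {K : Type*} [NormedAddCommGroup K] [InnerProductSpace ℝ K]
    [CompleteSpace K] {W : ℝ≥0 → K → Ω → ℝ} (hW : IsCylindricalWiener P 𝓕 W) {σ : K →L[ℝ] H}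
    (hσ : IsHilbertSchmidt σ) (hZ : IsStochasticConvolution P W S σ Z) (hG : IsRunningCost G)
    (hρ : 0 < ρ) (hn : n ≠ 0) (hn_eigen : (n, lam • n) ∈ A.graph) :
    ∃ c κ₁ κ₂ C, IsReducedProblem P S Z G ρ lam n c κ₁ κ₂ C := by
  obtain ⟨c, κ₁, κ₂, hc, hκ₁, hκ₂, hgrowth⟩ := hG.growth
  obtain ⟨C, hC, hsemi⟩ := hG.semiconcave
  have hcontr : ∀ t x, ‖S t x‖ ≤ ‖x‖ := hS.norm_apply_le hA_dense fun x =>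
    (hA x).trans (mul_nonpos_of_nonpos_of_nonneg (by linarith) (sq_nonneg _))
  exact ⟨c, κ₁, κ₂, C,
    { norm_le := hcontr
      eigen := hS.apply_eigenvector hn_eigen
      ne_zero := hn
      rho_pos := hρ
      lam_neg := eigenvalue_neg hδ hA hn hn_eigen
      meas := hZ.aestronglyMeasurable_freeState hS.toIsC0Semigroup
      int_sq := fun a ha x => hZ.integrable_freeState_sq hW hS.toIsC0Semigroup hcontr hσ ha x
      convex := hG.convex
      c_pos := hc
      k1_pos := hκ₁
      k2_pos := hκ₂
      C_pos := hC
      lower := fun x => (hgrowth x).1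
      upper := fun x => (hgrowth x).2
      semiconcave := IsRunningCost.second_difference_le hsemi }⟩

end SingularControl

theorem theorem4p1
    {D : Type*} [MeasurableSpace D] [StandardBorelSpace D]
    (μ : MeasureTheory.Measure D) [MeasureTheory.IsProbabilityMeasure μ]
    -- the operator `A` and its semigroup `S t = e^{tA}` on `H = L²(D, μ; ℝ)`
    (A : MeasureTheory.Lp ℝ 2 μ →ₗ.[ℝ] MeasureTheory.Lp ℝ 2 μ)
    (hA_dense : Dense (A.domain : Set (MeasureTheory.Lp ℝ 2 μ)))
    (hA_closed : A.IsClosed) (hA_selfAdjoint : IsSelfAdjoint A)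
    (δ : ℝ) (hδ : 0 < δ) (hA_neg : ∀ x : A.domain, ⟪A x, (x : MeasureTheory.Lp ℝ 2 μ)⟫_ℝ
      ≤ -δ * ‖(x : MeasureTheory.Lp ℝ 2 μ)‖ ^ 2)
    (S : ℝ≥0 → MeasureTheory.Lp ℝ 2 μ →L[ℝ] MeasureTheory.Lp ℝ 2 μ)
    (hS : SingularControl.IsSemigroupGeneratedBy A S)
    (hS_pos : ∀ t, ∀ x : MeasureTheory.Lp ℝ 2 μ, 0 ≤ x → 0 ≤ S t x)
    -- the filtered probability space and the noise
    {Ω : Type*} {mΩ : MeasurableSpace Ω} (P : MeasureTheory.Measure Ω)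
    [MeasureTheory.IsProbabilityMeasure P] (𝓕 : MeasureTheory.Filtration ℝ≥0 mΩ)
    (h𝓕 : SingularControl.UsualConditions P 𝓕)
    {K : Type*} [NormedAddCommGroup K] [InnerProductSpace ℝ K] [CompleteSpace K]
    (W : ℝ≥0 → K → Ω → ℝ) (hW : SingularControl.IsCylindricalWiener P 𝓕 W)
    (σ : K →L[ℝ] MeasureTheory.Lp ℝ 2 μ) (hσ : SingularControl.IsHilbertSchmidt σ)
    (Z : ℝ≥0 → Ω → MeasureTheory.Lp ℝ 2 μ)
    (hZ : SingularControl.IsStochasticConvolution P W S σ Z)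
    -- the cost and the direction of action
    (G : MeasureTheory.Lp ℝ 2 μ → ℝ) (hG : SingularControl.IsRunningCost G)
    (ρ : ℝ) (hρ : 0 < ρ)
    (q : MeasureTheory.Lp ℝ 2 μ) (q₀ : ℝ) (hq₀ : 0 < q₀) (hq : ∀ᵐ ξ ∂μ, q₀ ≤ q ξ)
    (n : MeasureTheory.Lp ℝ 2 μ) (hn_nonneg : 0 ≤ n) (hn_ne : n ≠ 0) (hqn : ⟪q, n⟫_ℝ = 1)
    (lam : ℝ) (hn_eigen : (n, lam • n) ∈ A.graph) :
    -- the value function is finite and differentiable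
    (∀ x, SingularControl.value P 𝓕 q (SingularControl.ray n) S Z G ρ x ≠ ⊥ ∧
      SingularControl.value P 𝓕 q (SingularControl.ray n) S Z G ρ x ≠ ⊤) ∧
    Differentiable ℝ
      (fun x => (SingularControl.value P 𝓕 q (SingularControl.ray n) S Z G ρ x).toReal) ∧
    Differentiable ℝ G ∧
    ∀ x,
      -- the optimal stopping problem is well posed
      MeasureTheory.Integrable (fun p : Ω × ℝ≥0 => Real.exp (-(ρ - lam) * p.2) *
          SingularControl.dirDeriv G n (SingularControl.freeState S Z x p.2 p.1))
        (P.prod SingularControl.timeMeasure) ∧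
      (∀ τ, MeasureTheory.IsStoppingTime 𝓕 τ →
        MeasureTheory.Integrable (SingularControl.stoppingPayoff (ρ - lam)
          (SingularControl.dirDeriv G n) (SingularControl.freeState S Z x) τ) P) ∧
      -- its value is the directional derivative of the value function
      IsLUB {r : ℝ | ∃ τ, MeasureTheory.IsStoppingTime 𝓕 τ ∧
          r = ∫ ω, SingularControl.stoppingPayoff (ρ - lam)
            (SingularControl.dirDeriv G n) (SingularControl.freeState S Z x) τ ω ∂P}
        (SingularControl.dirDeriv
          (fun y => (SingularControl.value P 𝓕 q (SingularControl.ray n) S Z G ρ y).toReal) n x) ∧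
      -- an optimal control exists
      (∃ I : SingularControl.Control P 𝓕 q (SingularControl.ray n),
        SingularControl.cost S Z G ρ x I
          = SingularControl.value P 𝓕 q (SingularControl.ray n) S Z G ρ x) ∧
      -- and it is unique up to indistinguishability if the running cost is strictly convex
      (StrictConvexOn ℝ Set.univ G →
        ∀ I I' : SingularControl.Control P 𝓕 q (SingularControl.ray n),
          SingularControl.cost S Z G ρ x I
            = SingularControl.value P 𝓕 q (SingularControl.ray n) S Z G ρ x →
          SingularControl.cost S Z G ρ x I'
            = SingularControl.value P 𝓕 q (SingularControl.ray n) S Z G ρ x →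
          ∀ᵐ ω ∂P, ∀ t, I.dir t ω = I'.dir t ω ∧
            I.intensity.val t ω = I'.intensity.val t ω) := by
  have : Fact ((2 : ℝ≥0∞) ≠ ∞) := ⟨ENNReal.ofNat_ne_top⟩
  obtain ⟨c, κ₁, κ₂, C, h⟩ := SingularControl.exists_isReducedProblem hA_dense hδ hA_neg hS hW hσ hZ
    hG hρ hn_ne hn_eigen
  have hF := h.isReducedValue_value hqn h𝓕
  have hdiff := h.differentiable_value hF
  have hderiv : ∀ x, SingularControl.dirDeriv (fun y =>
      (SingularControl.value P 𝓕 q (SingularControl.ray n) S Z G ρ y).toReal) n x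
      = SingularControl.dirDeriv (fun y =>
      (SingularControl.value P 𝓕 q (SingularControl.ray n) S Z G ρ y).toReal + κ₂ / ρ) n x :=
    fun x => by
      rw [SingularControl.dirDeriv_eq_fderiv, SingularControl.dirDeriv_eq_fderiv,
        fderiv_add_const]
  refine ⟨fun x => ?_, ?_, h.differentiable, fun x => ⟨h.integrable_dirDeriv x,
    fun τ hτ => (h.integrable_stoppingPayoff x hτ).1, ?_, ?_, fun hGs I I' hI hI' => ?_⟩⟩
  · obtain ⟨u, -, hval, -, -⟩ := h.exists_value_eq hqn h𝓕 x
    rw [hval]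
    exact ⟨EReal.coe_ne_bot _, EReal.coe_ne_top _⟩
  · simpa using hdiff.sub_const (κ₂ / ρ)
  · rw [hderiv]
    exact h.isLUB_payoff h𝓕 hF x
  · obtain ⟨u, hu, -, hopt, -⟩ := h.exists_value_eq hqn h𝓕 x
    exact ⟨_, hopt⟩
  · obtain ⟨hsq, hr⟩ := h.reduced_of_optimal hqn h𝓕 x hI
    obtain ⟨hsq', hr'⟩ := h.reduced_of_optimal hqn h𝓕 x hI'
    have huniq := h.minimizer_unique hGs x hsq hsq'
      (fun w hw => hr.le.trans ((hF x).2 w hw)) (hr.trans hr'.symm)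
    filter_upwards [huniq] with ω hω t
    refine ⟨(I.dir_eq hqn t ω).trans (I'.dir_eq hqn t ω).symm, ?_⟩
    have h1 := SingularControl.Intensity.reweight_val_congr lam hω t
    have h2 := I.intensity.reweight_neg_reweight (-lam) t ω
    have h3 := I'.intensity.reweight_neg_reweight (-lam) t ω
    rw [neg_neg] at h2 h3
    rw [← h2, h1, h3]
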